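/- Let $n\ge 2$, $p\ge 1$, $m\ge1$ be integers and $a\in(0,1)$. For a $p\times p$ covariance matrix $\Sigma=(\sigma_{ij})$ let $X_1,\dots,X_n$ be i.i.d. $\mathcal N_p(0,\Sigma)$, let $(\varepsilon_{k,j})$ be i.i.d. Bernoulli($a$) variables independent of the $X_k$, and observe $Y_{k,j}=\varepsilon_{k,j}X_{k,j}$. Write $\mathbb E_{a,\Sigma}$, $\mathrm{Var}_{a,\Sigma}$ for the mean and variance under the law of $(Y_1,\dots,Y_n)$, and put $$\widehat{\mathcal D}_{n,p,m}=\frac{1}{n(n-1)p}\cdot\frac1{\sqrt{2m}}\sum_{1\le k\ne l\le n}\ \sum_{\substack{1\le i<j\le p\\ |i-j|<m}}Y_{k,i}Y_{k,j}Y_{l,i}Y_{l,j}.$$ For $\alpha>0$ let $\mathcal F(\alpha)$ be the set of symmetric positive definite $p\times p$ matrices $\Sigma$ with $\sigma_{ii}=1$ for all $i$ and $\frac1p\sum_{1\le i<j\le p}\sigma_{ij}^2|i-j|^{2\alpha}\le1$. **Null hypothesis** ($\Sigma=I$). The statistic $\widehat{\mathcal D}_{n,p,m}$ is square integrable and centered,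 and for $1\le m\le p$ $$\mathrm{Var}_{a,I}(\widehat{\mathcal D}_{n,p,m})=\frac{a^4}{n(n-1)p}\Big(1-\frac1m\Big)\Big(1-\frac m{2p}\Big).$$ In particular, $\mathrm{Var}_{a,I}(\widehat{\mathcal D}_{n,p,m})=\frac{a^4}{n(n-1)p}(1+o(1))$ as $m\to\infty$ and $m/p\to0$, uniformly in $n\geq 2$ and $a\in(0,1)$. Moreover, along any sequences $n,p,m,a$ (with $a\in(0,1)$ fixed or varying) such that $n,p,m\to\infty$, $m/p\to0$ and $a^2n\sqrt p\to\infty$, one has under $\Sigma=I$ $$\frac{n\sqrt p}{a^2}\,\widehat{\mathcal D}_{n,p,m}\ \longrightarrow\ \mathcal N(0,1)\quad\text{in distribution}.$$ **Alternative.** There are quantities $T_1,T_2$, depending on $p,m,a,\Sigma$ but not on $n$, such that for every $\alpha>1/2$ the following holds. For all $n\ge2$, $p\ge1$, $m\ge1$, $a\in(0,1)$ and all $\Sigma\in\mathcal F(\alpha)$, the statistic is square integrable and $$\mathbb E_{a,\Sigma}(\widehat{\mathcal D}_{n,p,m})=\frac{a^4}{p\sqrt{2m}}\sum_{\substack{1\le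 i<j\le p\\|i-j|<m}}\sigma_{ij}^2,\qquad \mathrm{Var}_{a,\Sigma}(\widehat{\mathcal D}_{n,p,m})=\frac{T_1}{n(n-1)p^2}+\frac{T_2}{np^2}.$$ Moreover, with $E=\mathbb E_{a,\Sigma}(\widehat{\mathcal D}_{n,p,m})$, as $m\to\infty$ and $m/p\to0$, $$T_1\le p\,a^4(1+o(1))+p\,E\cdot O(a^2m\sqrt m),$$ $$T_2\le p\,E\cdot O(a^2\sqrt m)+p^{3/2}\Big(E^{3/2}\,O(a^2m^{3/4})+E\cdot o(a^4)\Big),$$ where the $O$ and $o$ terms are uniform in $n\geq2$, $a\in(0,1)$ and $\Sigma\in\mathcal F(\alpha)$. That is, there is a constant $C$ depending only on $\alpha$, and for every $\eta>0$ there are $M$ and $\delta>0$, such that for all $m\ge M$ with $m\le\delta p$, all $n\geq 2$, $a\in(0,1)$ and $\Sigma\in\mathcal F(\alpha)$ the bounds hold with $O(x)$ replaced by $Cx$, $o(1)$ by $\eta$ and $o(a^4)$ by $\eta a^4$. -/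

import Mathlib

open MeasureTheory ProbabilityTheory Filter Topology

noncomputable section

/-- The law `P_{a,S}` of one partially observed vector `Y = (ε₁ X₁, …, ε_p X_p)`, where
`X ∼ N_p(0, S)` and the `ε_j` are i.i.d. Bernoulli variables with parameter `a`,
independent of `X`. -/
def missingLaw {p : ℕ} (a : unitInterval) (S : Matrix (Fin p) (Fin p) ℝ) :
    Measure (Fin p → ℝ) :=
  ((Measure.pi fun _ : Fin p => bernoulliMeasure (1 : ℝ) 0 a).prod
    (multivariateGaussian 0 S)).map (fun z i => z.1 i * z.2 i)

instance {p : ℕ} (a : unitInterval) (S : Matrix (Fin p) (Fin p) ℝ) :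
    IsProbabilityMeasure (missingLaw a S) := by
  unfold missingLaw
  exact Measure.isProbabilityMeasure_map (Measurable.aemeasurable (by fun_prop))

/-- The joint law of `n` independent observations `Y₁, …, Y_n` with law `P_{a,S}`. -/
def sampleLaw (n : ℕ) {p : ℕ} (a : unitInterval) (S : Matrix (Fin p) (Fin p) ℝ) :
    Measure (Fin n → Fin p → ℝ) :=
  Measure.pi fun _ : Fin n => missingLaw a S

instance (n : ℕ) {p : ℕ} (a : unitInterval) (S : Matrix (Fin p) (Fin p) ℝ) :
    IsProbabilityMeasure (sampleLaw n a S) := by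
  unfold sampleLaw
  infer_instance

/-- The pairs `i < j` of coordinates with `|i - j| < m`. -/
def bandPairs (p m : ℕ) : Finset (Fin p × Fin p) :=
  Finset.univ.filter fun x => x.1 < x.2 ∧ (x.2 : ℕ) < (x.1 : ℕ) + m

/-- The test statistic `D̂_{n,p,m}` evaluated at the sample `y`. -/
def testStat (n p m : ℕ) (y : Fin n → Fin p → ℝ) : ℝ :=
  1 / ((n : ℝ) * ((n : ℝ) - 1) * (p : ℝ)) * (1 / √(2 * (m : ℝ))) *
    ∑ k : Fin n, ∑ l ∈ Finset.univ.filter (fun l : Fin n => l ≠ k),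
      ∑ x ∈ bandPairs p m, y k x.1 * y k x.2 * y l x.1 * y l x.2

/-- The Sobolev-type class `F(α)` of `p × p` covariance matrices with unit diagonal. -/
def sobolevClass (p : ℕ) (α : ℝ) : Set (Matrix (Fin p) (Fin p) ℝ) :=
  {S | S.PosDef ∧ (∀ i, S i i = 1) ∧
    1 / (p : ℝ) * ∑ i : Fin p, ∑ j ∈ Finset.univ.filter (fun j : Fin p => i < j),
      S i j ^ 2 * |(i : ℝ) - (j : ℝ)| ^ (2 * α) ≤ 1}

end

/-! Let h(y) be the vector of products y_i y_j over the band pairs. Up to normalisation the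
statistic is the U-statistic of order two with kernel ⟨h(y), h(z)⟩, called `pairSum`. Appending an
observation z to a sample with feature sum S adds 2⟨S, h(z)⟩ (`pairSum_cons`), so each fact about
samples is proved by induction on the sample size, integrating the new observation out first
(`integral_pi_finCons`).

Mean and variance. Centring h = g + v splits the statistic into a constant, a linear term with
weights 2(n-1)v and a degenerate U-statistic (`pairSum_eq_of_eq_add`). With Γ the covariance matrix
of the features, `integral_pairSum_add_sq` yields the second moment from Tr Γ² and vᵀΓv; after
normalisation these are T₁ = Tr Γ² / m and T₂ = 2 vᵀΓv / m. The entries of Γ come from Wick's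
formula, with a raised to the number of distinct indices, because a Bernoulli variable equals its
powers. Under the null hypothesis v = 0 and Γ = a² I, so the variance only needs the number of band
pairs.

Normality. For isotropic centred features the increments 2⟨S, h(z)⟩ are martingale differences with
conditional variance proportional to ‖S‖². Each new observation therefore multiplies the
characteristic function by a Gaussian factor, up to a third-moment term, the fluctuation of ‖S‖²
around its mean and a second-order term (`norm_charFun_pairSum_succ_sub_le`). Summing these errors
gives the quantitative limit theorem `norm_charFun_pairSum_sub_le`, whose inputs are the variance of
‖h(Y)‖² and the fourth moment of ⟨h(Y), h(Y')⟩. The latter is bounded by randomising the signs of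
the coordinates of Y, which makes the inner product a Rademacher chaos of degree two, and applying
Bonami's inequality. The errors vanish when n, m and a²n√p tend to infinity.

Alternative. The diagonal of Γ gives the leading term p a⁴ of T₁. Off the diagonal, pairs sharing an
index are few (at most 4m for each pair), and the crossed Wick products always contain an
off-diagonal entry of Σ. The Sobolev condition bounds the squared off-diagonal mass by twice the
band mass plus p m^(-2α) (`sum_offSq_le`); α > 1/2 makes the second part o(p/m), which produces the
o-terms, while the band mass is expressed through the mean E. -/

/-! ### Functions with finite moments of every order -/

/-- A real function all of whose absolute moments are finite. -/
def HasMoments {Ω : Type*} [MeasurableSpace Ω] (f : Ω → ℝ) (μ : Measure Ω) : Prop :=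
  ∀ k : ℕ, MemLp f k μ

namespace HasMoments

variable {Ω : Type*} [MeasurableSpace Ω] {μ : Measure Ω} {f g : Ω → ℝ}

lemma memLp_two (hf : HasMoments f μ) : MemLp f 2 μ := by
  simpa using hf 2

lemma integrable (hf : HasMoments f μ) : Integrable f μ :=
  memLp_one_iff_integrable.1 (by simpa using hf 1)

lemma aestronglyMeasurable (hf : HasMoments f μ) : AEStronglyMeasurable f μ :=
  hf.integrable.aestronglyMeasurable

lemma const [IsFiniteMeasure μ] (c : ℝ) : HasMoments (fun _ => c) μ :=
  fun _ => memLp_const c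

lemma add (hf : HasMoments f μ) (hg : HasMoments g μ) :
    HasMoments (fun x => f x + g x) μ :=
  fun k => (hf k).add (hg k)

lemma sub (hf : HasMoments f μ) (hg : HasMoments g μ) :
    HasMoments (fun x => f x - g x) μ :=
  fun k => (hf k).sub (hg k)

/-- Hölder with both exponents 2k. Closure under products is why all moments are required at once:
integrability of any polynomial in the coordinates then follows formally. -/
lemma mul (hf : HasMoments f μ) (hg : HasMoments g μ) :
    HasMoments (fun x => f x * g x) μ := by
  intro k
  have : ENNReal.HolderTriple ((2 * k : ℕ) : ENNReal) ((2 * k : ℕ) : ENNReal) (k : ENNReal) := by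
    refine ⟨?_⟩
    rw [← two_mul]
    push_cast
    rw [ENNReal.mul_inv (Or.inl two_ne_zero) (Or.inl ENNReal.ofNat_ne_top), ← mul_assoc,
      ENNReal.mul_inv_cancel two_ne_zero ENNReal.ofNat_ne_top, one_mul]
  exact (hg (2 * k)).mul' (hf (2 * k))

lemma const_mul (hf : HasMoments f μ) (c : ℝ) : HasMoments (fun x => c * f x) μ :=
  fun k => (hf k).const_mul c

lemma pow [IsFiniteMeasure μ] (hf : HasMoments f μ) (n : ℕ) :
    HasMoments (fun x => f x ^ n) μ := by
  induction n with
  | zero => simpa using HasMoments.const (μ := μ) 1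
  | succ n ih => simpa only [pow_succ] using ih.mul hf

lemma abs (hf : HasMoments f μ) : HasMoments (fun x => |f x|) μ :=
  fun k => (hf k).abs

lemma sum {ι : Type*} (s : Finset ι) {F : ι → Ω → ℝ} (hF : ∀ i ∈ s, HasMoments (F i) μ) :
    HasMoments (fun x => ∑ i ∈ s, F i x) μ :=
  fun k => memLp_finsetSum s fun i hi => hF i hi k

lemma comp {Ω' : Type*} [MeasurableSpace Ω'] {μ' : Measure Ω'} (hf : HasMoments f μ)
    {φ : Ω' → Ω} (hφ : MeasurePreserving φ μ' μ) : HasMoments (fun x => f (φ x)) μ' :=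
  fun k => (hf k).comp_measurePreserving hφ

end HasMoments

/-- The absolute first moment is at most the root of the second moment. -/
lemma integral_abs_le_sqrt {Ω : Type*} [MeasurableSpace Ω] {μ : Measure Ω}
    [IsProbabilityMeasure μ] {f : Ω → ℝ} (hf : MemLp f 2 μ) :
    ∫ x, |f x| ∂μ ≤ √(∫ x, f x ^ 2 ∂μ) := by
  refine Real.le_sqrt_of_sq_le ?_
  have h := variance_nonneg |f| μ
  rw [variance_eq_sub hf.abs] at h
  simpa using h

/-- The Cauchy–Schwarz inequality for the third absolute moment. -/
lemma integral_abs_pow_three_le_sqrt {Ω : Type*} [MeasurableSpace Ω] {μ : Measure Ω}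
    [IsProbabilityMeasure μ] {f : Ω → ℝ} (hf : HasMoments f μ) :
    ∫ x, |f x| ^ 3 ∂μ ≤ √((∫ x, f x ^ 2 ∂μ) * ∫ x, f x ^ 4 ∂μ) := by
  have h := integral_mul_le_Lp_mul_Lq_of_nonneg (μ := μ) (p := 2) (q := 2)
    (f := fun x => |f x|) (g := fun x => f x ^ 2) Real.HolderConjugate.two_two
    (Eventually.of_forall fun x => abs_nonneg _) (Eventually.of_forall fun x => sq_nonneg _)
    (by simpa using hf.abs.memLp_two) (by simpa using (hf.pow 2).memLp_two)
  rw [Real.sqrt_mul (integral_nonneg fun x => sq_nonneg _), Real.sqrt_eq_rpow, Real.sqrt_eq_rpow]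
  have h3 : ∀ x, |f x| * f x ^ 2 = |f x| ^ 3 := fun x => by rw [← sq_abs (f x)]; ring
  have h4 : ∀ x, (f x ^ 2) ^ 2 = f x ^ 4 := fun x => by ring
  simpa only [h3, h4, Real.rpow_two, sq_abs] using h

/-! ### Independent observations -/

section Engine

variable {E : Type*} [MeasurableSpace E] (μ : Measure E) [IsProbabilityMeasure μ]

/-- The new observation is the head of the tuple but the second factor of the product, so that
iterated integration conditions on the old sample. -/
lemma measurePreserving_finCons (n : ℕ) :
    MeasurePreserving (fun w : (Fin n → E) × E => (Fin.cons w.2 w.1 : Fin (n + 1) → E))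
      ((Measure.pi fun _ : Fin n => μ).prod μ) (Measure.pi fun _ : Fin (n + 1) => μ) := by
  have h := (measurePreserving_piFinSuccAbove (fun _ : Fin (n + 1) => μ) 0).symm
  have h2 := h.comp (Measure.measurePreserving_swap
    (μ := Measure.pi fun _ : Fin n => μ) (ν := μ))
  convert! h2 using 2 with w
  simp [MeasurableEquiv.piFinSuccAbove, Fin.insertNthEquiv]

lemma integral_pi_finCons {G : Type*} [NormedAddCommGroup G] [NormedSpace ℝ G] {n : ℕ}
    {F : (Fin (n + 1) → E) → G} (hF : Integrable F (Measure.pi fun _ : Fin (n + 1) => μ)) :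
    ∫ y, F y ∂(Measure.pi fun _ : Fin (n + 1) => μ) =
      ∫ y, ∫ z, F (Fin.cons z y) ∂μ ∂(Measure.pi fun _ : Fin n => μ) := by
  have h := measurePreserving_finCons μ n
  rw [← h.map_eq, integral_map h.measurable.aemeasurable (by rw [h.map_eq]; exact hF.1),
    integral_prod (fun w : (Fin n → E) × E => F (Fin.cons w.2 w.1))
      (h.integrable_comp_of_integrable hF)]

end Engine

/-! ### Sums over pairs of distinct observations -/

section PairSum

variable {E : Type*} {B : Type*} [Fintype B]

/-- The sum of the feature vectors of a sample. -/
def sumVec (h : E → B → ℝ) {n : ℕ} (y : Fin n → E) : B → ℝ := fun x => ∑ k, h (y k) x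

/-- The sum of the inner products of feature vectors over pairs of distinct observations. -/
def pairSum (h : E → B → ℝ) {n : ℕ} (y : Fin n → E) : ℝ :=
  ∑ k, ∑ l ∈ Finset.univ.filter (fun l : Fin n => l ≠ k), h (y k) ⬝ᵥ h (y l)

variable (h : E → B → ℝ)

omit [Fintype B] in
lemma sumVec_cons {n : ℕ} (z : E) (y : Fin n → E) :
    sumVec h (Fin.cons z y : Fin (n + 1) → E) = h z + sumVec h y := by
  ext x
  simp [sumVec, Fin.sum_univ_succ]

lemma pairSum_eq {n : ℕ} (y : Fin n → E) :
    pairSum h y = sumVec h y ⬝ᵥ sumVec h y - ∑ k, h (y k) ⬝ᵥ h (y k) := by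
  have h1 : sumVec h y = ∑ k, h (y k) := by ext x; simp [sumVec]
  rw [h1, sum_dotProduct, ← Finset.sum_sub_distrib]
  refine Finset.sum_congr rfl fun k _ => ?_
  rw [dotProduct_sum, Finset.filter_ne', ← Finset.add_sum_erase _ _ (Finset.mem_univ k)]
  ring

/-- The martingale increment behind all the inductions: only the pairs containing z are new, and
each is counted in both orders. -/
lemma pairSum_cons {n : ℕ} (z : E) (y : Fin n → E) :
    pairSum h (Fin.cons z y : Fin (n + 1) → E) = pairSum h y + 2 * (sumVec h y ⬝ᵥ h z) := by
  rw [pairSum_eq, pairSum_eq, sumVec_cons, Fin.sum_univ_succ]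
  simp only [Fin.cons_zero, Fin.cons_succ, add_dotProduct, dotProduct_add]
  rw [dotProduct_comm (h z) (sumVec h y)]
  ring

end PairSum

/-! ### First and second moments of sums and pair sums. -/

section Moments

variable {E : Type*} [MeasurableSpace E] {μ : Measure E} [IsProbabilityMeasure μ]
  {B : Type*} [Fintype B] {h : E → B → ℝ}

lemma HasMoments.dotProduct {Ω : Type*} [MeasurableSpace Ω] {P : Measure Ω} {f g : Ω → B → ℝ}
    (hf : ∀ x, HasMoments (fun ω => f ω x) P) (hg : ∀ x, HasMoments (fun ω => g ω x) P) :
    HasMoments (fun ω => f ω ⬝ᵥ g ω) P :=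
  HasMoments.sum _ fun x _ => (hf x).mul (hg x)

omit [Fintype B] in
lemma HasMoments.sumVec (hm : ∀ x, HasMoments (fun z => h z x) μ) (n : ℕ) (x : B) :
    HasMoments (fun y : Fin n → E => sumVec h y x) (Measure.pi fun _ : Fin n => μ) :=
  HasMoments.sum _ fun k _ => (hm x).comp (measurePreserving_eval (fun _ : Fin n => μ) k)

lemma HasMoments.pairSum (hm : ∀ x, HasMoments (fun z => h z x) μ) (n : ℕ) :
    HasMoments (fun y : Fin n → E => pairSum h y) (Measure.pi fun _ : Fin n => μ) :=
  HasMoments.sum _ fun k _ => HasMoments.sum _ fun l _ => HasMoments.dotProduct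
    (fun x => (hm x).comp (measurePreserving_eval (fun _ : Fin n => μ) k))
    (fun x => (hm x).comp (measurePreserving_eval (fun _ : Fin n => μ) l))

omit [IsProbabilityMeasure μ] in
lemma integral_dotProduct_left (hm : ∀ x, HasMoments (fun z => h z x) μ) (u : B → ℝ) :
    ∫ z, u ⬝ᵥ h z ∂μ = u ⬝ᵥ fun x => ∫ z, h z x ∂μ := by
  simp only [dotProduct]
  rw [integral_finsetSum _ fun x _ => ((hm x).const_mul _).integrable]
  simp only [integral_const_mul]

omit [IsProbabilityMeasure μ] in
lemma integral_dotProduct_sq (hm : ∀ x, HasMoments (fun z => h z x) μ) (u : B → ℝ) :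
    ∫ z, (u ⬝ᵥ h z) ^ 2 ∂μ = ∑ x, ∑ x', u x * u x' * ∫ z, h z x * h z x' ∂μ := by
  have h1 : ∀ z, (u ⬝ᵥ h z) ^ 2 = ∑ x, ∑ x', u x * u x' * (h z x * h z x') := by
    intro z
    rw [sq, dotProduct, Finset.sum_mul_sum]
    exact Finset.sum_congr rfl fun x _ => Finset.sum_congr rfl fun x' _ => by ring
  simp only [h1]
  have hi : ∀ x x', HasMoments (fun z => u x * u x' * (h z x * h z x')) μ := fun x x' =>
    ((hm x).mul (hm x')).const_mul _
  rw [integral_finsetSum _ fun x _ => (HasMoments.sum _ fun x' _ => hi x x').integrable]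
  refine Finset.sum_congr rfl fun x _ => ?_
  rw [integral_finsetSum _ fun x' _ => (hi x x').integrable]
  simp only [integral_const_mul]

omit [Fintype B] in
lemma integral_sumVec (hm : ∀ x, HasMoments (fun z => h z x) μ) (h0 : ∀ x, ∫ z, h z x ∂μ = 0)
    (n : ℕ) (x : B) : ∫ y, sumVec h y x ∂(Measure.pi fun _ : Fin n => μ) = 0 := by
  simp only [sumVec]
  rw [integral_finsetSum _ fun k _ =>
    ((hm x).comp (measurePreserving_eval (fun _ : Fin n => μ) k)).integrable]
  refine Finset.sum_eq_zero fun k _ => ?_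
  rw [← h0 x]
  exact integral_comp_eval (μ := fun _ : Fin n => μ) (f := fun z => h z x)
    (hm x).aestronglyMeasurable

lemma integral_sumVec_mul (hm : ∀ x, HasMoments (fun z => h z x) μ)
    (h0 : ∀ x, ∫ z, h z x ∂μ = 0) (n : ℕ) (x x' : B) :
    ∫ y, sumVec h y x * sumVec h y x' ∂(Measure.pi fun _ : Fin n => μ) =
      n * ∫ z, h z x * h z x' ∂μ := by
  induction n with
  | zero => simp [sumVec]
  | succ n ih =>
    have hs := HasMoments.sumVec hm n
    rw [integral_pi_finCons μ
      ((HasMoments.sumVec hm _ x).mul (HasMoments.sumVec hm _ x')).integrable]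
    have h1 : ∀ y : Fin n → E, ∫ z, sumVec h (Fin.cons z y : Fin (n + 1) → E) x *
        sumVec h (Fin.cons z y : Fin (n + 1) → E) x' ∂μ =
        sumVec h y x * sumVec h y x' + ∫ z, h z x * h z x' ∂μ := by
      intro y
      have h2 : ∀ z, sumVec h (Fin.cons z y : Fin (n + 1) → E) x *
          sumVec h (Fin.cons z y : Fin (n + 1) → E) x' =
          (sumVec h y x * sumVec h y x' + h z x * h z x') +
          (sumVec h y x' * h z x + sumVec h y x * h z x') := by
        intro z
        rw [sumVec_cons, Pi.add_apply, Pi.add_apply]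
        ring
      simp only [h2]
      rw [integral_add, integral_add, integral_add]
      · simp [integral_const_mul, h0]
      · exact ((hm x).const_mul _).integrable
      · exact ((hm x').const_mul _).integrable
      · exact integrable_const _
      · exact ((hm x).mul (hm x')).integrable
      · exact ((HasMoments.const _).add ((hm x).mul (hm x'))).integrable
      · exact (((hm x).const_mul _).add ((hm x').const_mul _)).integrable
    simp only [h1]
    rw [integral_add ((hs x).mul (hs x')).integrable (integrable_const _), ih]
    simp
    ring

/-- The second moment of a degenerate quadratic statistic plus a linear one. -/
lemma integral_pairSum_add_sq (hm : ∀ x, HasMoments (fun z => h z x) μ)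
    (h0 : ∀ x, ∫ z, h z x ∂μ = 0) (v : B → ℝ) (n : ℕ) :
    ∫ y, (pairSum h y + sumVec h y ⬝ᵥ v) ^ 2 ∂(Measure.pi fun _ : Fin n => μ) =
      2 * n * (n - 1) * ∑ x, ∑ x', (∫ z, h z x * h z x' ∂μ) ^ 2 +
        n * ∑ x, ∑ x', v x * v x' * ∫ z, h z x * h z x' ∂μ := by
  induction n with
  | zero => simp [sumVec, pairSum, dotProduct]
  | succ n ih =>
    have hs := HasMoments.sumVec hm n
    have hW : ∀ n, HasMoments (fun y : Fin n → E => pairSum h y + sumVec h y ⬝ᵥ v)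
        (Measure.pi fun _ : Fin n => μ) := fun n =>
      (HasMoments.pairSum hm n).add
        (HasMoments.dotProduct (HasMoments.sumVec hm n) fun x => HasMoments.const _)
    rw [integral_pi_finCons μ ((hW _).pow 2).integrable]
    have h1 : ∀ y : Fin n → E, ∫ z, (pairSum h (Fin.cons z y : Fin (n + 1) → E) +
        sumVec h (Fin.cons z y : Fin (n + 1) → E) ⬝ᵥ v) ^ 2 ∂μ =
        (pairSum h y + sumVec h y ⬝ᵥ v) ^ 2 + ∑ x, ∑ x',
          (2 * sumVec h y x + v x) * (2 * sumVec h y x' + v x') * ∫ z, h z x * h z x' ∂μ := by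
      intro y
      set q := pairSum h y + sumVec h y ⬝ᵥ v
      -- Given the old sample, the statistic grows by u · h(z), which is centred; hence the cross
      -- term vanishes and the increment contributes uᵀΓu with Γ the second-moment matrix of h.
      set u : B → ℝ := fun x => 2 * sumVec h y x + v x with hu
      have h2 : ∀ z, (pairSum h (Fin.cons z y : Fin (n + 1) → E) +
          sumVec h (Fin.cons z y : Fin (n + 1) → E) ⬝ᵥ v) ^ 2 =
          q ^ 2 + 2 * q * (u ⬝ᵥ h z) + (u ⬝ᵥ h z) ^ 2 := by
        intro z
        have : pairSum h (Fin.cons z y : Fin (n + 1) → E) +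
          sumVec h (Fin.cons z y : Fin (n + 1) → E) ⬝ᵥ v = q + u ⬝ᵥ h z := by
          rw [pairSum_cons, sumVec_cons, add_dotProduct,
            show u = 2 • sumVec h y + v by ext x; simp [hu], add_dotProduct, smul_dotProduct,
            dotProduct_comm (h z) v]
          simp only [q, nsmul_eq_mul]
          push_cast
          ring
        rw [this]; ring
      have hd : HasMoments (fun z => u ⬝ᵥ h z) μ :=
        HasMoments.dotProduct (fun x => HasMoments.const _) hm
      simp only [h2]
      rw [integral_add ((HasMoments.const _).add (hd.const_mul _)).integrable (hd.pow 2).integrable,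
        integral_add (integrable_const _) (hd.const_mul _).integrable, integral_const_mul,
        integral_dotProduct_left hm, integral_dotProduct_sq hm]
      simp [h0, dotProduct, hu]
    simp only [h1]
    have hu : ∀ x, HasMoments (fun y : Fin n → E => 2 * sumVec h y x + v x)
        (Measure.pi fun _ : Fin n => μ) := fun x => ((hs x).const_mul 2).add (HasMoments.const _)
    have hi : ∀ x x', HasMoments (fun y : Fin n → E =>
        (2 * sumVec h y x + v x) * (2 * sumVec h y x' + v x') * ∫ z, h z x * h z x' ∂μ)
        (Measure.pi fun _ : Fin n => μ) := fun x x' =>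
      ((hu x).mul (hu x')).mul (HasMoments.const _)
    rw [integral_add ((hW n).pow 2).integrable
      (HasMoments.sum _ fun x _ => HasMoments.sum _ fun x' _ => hi x x').integrable, ih,
      integral_finsetSum _ fun x _ => (HasMoments.sum _ fun x' _ => hi x x').integrable]
    -- The feature sum is centred with second-moment matrix nΓ, so the mean of uᵀΓu is 4n Tr Γ² +
    -- vᵀΓv; adding this up over the sample sizes below n gives 2n(n-1) and n.
    have h3 : ∀ x x', ∫ y, (2 * sumVec h y x + v x) * (2 * sumVec h y x' + v x') *
        (∫ z, h z x * h z x' ∂μ) ∂(Measure.pi fun _ : Fin n => μ) =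
        4 * n * (∫ z, h z x * h z x' ∂μ) ^ 2 + v x * v x' * ∫ z, h z x * h z x' ∂μ := by
      intro x x'
      have h4 : ∀ y : Fin n → E, (2 * sumVec h y x + v x) * (2 * sumVec h y x' + v x') =
          (4 * (sumVec h y x * sumVec h y x') + v x * v x') +
          (2 * v x' * sumVec h y x + 2 * v x * sumVec h y x') := fun y => by ring
      rw [integral_mul_const]
      simp only [h4]
      rw [integral_add, integral_add, integral_add]
      · simp only [integral_const_mul, integral_sumVec hm h0, integral_sumVec_mul hm h0]
        simp
        ring
      · exact ((hs x).const_mul _).integrable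
      · exact ((hs x').const_mul _).integrable
      · exact (((hs x).mul (hs x')).const_mul _).integrable
      · exact integrable_const _
      · exact ((((hs x).mul (hs x')).const_mul _).add (HasMoments.const _)).integrable
      · exact (((hs x).const_mul _).add ((hs x').const_mul _)).integrable
    have h5 : ∀ x, ∫ y, ∑ x', (2 * sumVec h y x + v x) * (2 * sumVec h y x' + v x') *
        (∫ z, h z x * h z x' ∂μ) ∂(Measure.pi fun _ : Fin n => μ) =
        4 * n * ∑ x', (∫ z, h z x * h z x' ∂μ) ^ 2 +
          ∑ x', v x * v x' * ∫ z, h z x * h z x' ∂μ := by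
      intro x
      rw [integral_finsetSum _ fun x' _ => (hi x x').integrable, Finset.mul_sum,
        ← Finset.sum_add_distrib]
      exact Finset.sum_congr rfl fun x' _ => h3 x x'
    simp only [h5]
    rw [Finset.sum_add_distrib, ← Finset.mul_sum]
    push_cast
    ring

end Moments

/-! ### A quantitative normal approximation for degenerate quadratic statistics -/

/-- For |x| ≤ 1 this is Taylor's remainder with e < 4; for |x| ≥ 1 each of the four terms is at most
|x|³. -/
lemma norm_exp_mul_I_sub_taylor_le (x : ℝ) :
    ‖Complex.exp (x * Complex.I) - 1 - x * Complex.I + (x : ℂ) ^ 2 / 2‖ ≤ 4 * |x| ^ 3 := by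
  rcases le_total |x| 1 with hx | hx
  · have h := Complex.norm_exp_sub_sum_le_norm_mul_exp (x * Complex.I) 3
    have hn : ‖(x : ℂ) * Complex.I‖ = |x| := by simp
    rw [hn] at h
    have he : Real.exp |x| ≤ 4 := by
      have := Real.exp_le_exp.2 hx
      linarith [Real.exp_one_lt_d9]
    have e : Complex.exp (x * Complex.I) - 1 - x * Complex.I + (x : ℂ) ^ 2 / 2 =
        Complex.exp (x * Complex.I) -
          ∑ m ∈ Finset.range 3, (x * Complex.I) ^ m / (Nat.factorial m : ℂ) := by
      simp only [Finset.sum_range_succ, Finset.sum_range_zero, mul_pow, Complex.I_sq]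
      norm_num [Nat.factorial]
      ring
    rw [e]
    nlinarith [pow_nonneg (abs_nonneg x) 3]
  · have h1 : ‖Complex.exp (x * Complex.I)‖ = 1 := Complex.norm_exp_ofReal_mul_I x
    have h2 : ‖(x : ℂ) ^ 2 / 2‖ = |x| ^ 2 / 2 := by simp
    have h3 : ‖(x : ℂ) * Complex.I‖ = |x| := by simp
    calc _ ≤ ‖Complex.exp (x * Complex.I)‖ + ‖(1 : ℂ)‖ + ‖(x : ℂ) * Complex.I‖ +
          ‖(x : ℂ) ^ 2 / 2‖ :=
          (norm_add_le _ _).trans (add_le_add_left ((norm_sub_le _ _).trans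
            (add_le_add_left (norm_sub_le _ _) _)) _)
      _ ≤ 4 * |x| ^ 3 := by
          rw [h1, h2, h3, norm_one]
          nlinarith [pow_le_pow_left₀ zero_le_one hx 2, pow_le_pow_left₀ zero_le_one hx 3,
            mul_nonneg (sub_nonneg.2 hx) (sq_nonneg |x|), mul_nonneg (sub_nonneg.2 hx) (abs_nonneg x)]

/-- Inverting 1 + u + u²/2 ≤ exp u suffices, since (1 + u²/2)² - u² = 1 + u⁴/4 ≥ 1. -/
lemma abs_exp_neg_sub_le {u : ℝ} (hu : 0 ≤ u) : |Real.exp (-u) - 1 + u| ≤ u ^ 2 / 2 := by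
  have h1 := Real.add_one_le_exp (-u)
  have h2 := Real.quadratic_le_exp_of_nonneg hu
  have h3 : Real.exp (-u) * Real.exp u = 1 := by rw [← Real.exp_add]; simp
  rw [abs_of_nonneg (by linarith)]
  have h4 : Real.exp (-u) * (1 + u + u ^ 2 / 2) ≤ 1 :=
    (mul_le_mul_of_nonneg_left h2 (Real.exp_pos _).le).trans_eq h3
  nlinarith [Real.exp_pos (-u), sq_nonneg (u ^ 2), sq_nonneg u]

/-! ### Moments of sums of isotropic features. -/

section Isotropic

variable {E : Type*} [MeasurableSpace E] {μ : Measure E} [IsProbabilityMeasure μ]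
  {B : Type*} [Fintype B] [DecidableEq B] {h : E → B → ℝ} {b : ℝ}

omit [IsProbabilityMeasure μ] in
lemma integral_dotProduct_sq_of_isotropic (hm : ∀ x, HasMoments (fun z => h z x) μ)
    (hΓ : ∀ x x', ∫ z, h z x * h z x' ∂μ = if x = x' then b else 0) (u : B → ℝ) :
    ∫ z, (u ⬝ᵥ h z) ^ 2 ∂μ = b * (u ⬝ᵥ u) := by
  rw [integral_dotProduct_sq hm]
  simp [hΓ, dotProduct, Finset.mul_sum, mul_comm]

omit [IsProbabilityMeasure μ] in
lemma integral_dotProduct_self (hm : ∀ x, HasMoments (fun z => h z x) μ)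
    (hΓ : ∀ x x', ∫ z, h z x * h z x' ∂μ = if x = x' then b else 0) :
    ∫ z, h z ⬝ᵥ h z ∂μ = b * Fintype.card B := by
  simp only [dotProduct]
  rw [integral_finsetSum _ fun x _ => ((hm x).mul (hm x)).integrable]
  simp [hΓ, mul_comm]

lemma integral_sumVec_dotProduct_self (hm : ∀ x, HasMoments (fun z => h z x) μ)
    (h0 : ∀ x, ∫ z, h z x ∂μ = 0)
    (hΓ : ∀ x x', ∫ z, h z x * h z x' ∂μ = if x = x' then b else 0) (n : ℕ) :
    ∫ y, sumVec h y ⬝ᵥ sumVec h y ∂(Measure.pi fun _ : Fin n => μ) =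
      n * (b * Fintype.card B) := by
  have hs := HasMoments.sumVec hm n
  simp only [dotProduct]
  rw [integral_finsetSum _ fun x _ => ((hs x).mul (hs x)).integrable]
  simp only [integral_sumVec_mul hm h0, hΓ]
  simp
  ring

/-- The squared norm of a sum of isotropic vectors concentrates around its mean. -/
lemma integral_sumVec_dotProduct_self_sub_sq_le (hm : ∀ x, HasMoments (fun z => h z x) μ)
    (h0 : ∀ x, ∫ z, h z x ∂μ = 0)
    (hΓ : ∀ x x', ∫ z, h z x * h z x' ∂μ = if x = x' then b else 0) (n : ℕ) :
    ∫ y, (sumVec h y ⬝ᵥ sumVec h y - n * (b * Fintype.card B)) ^ 2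
        ∂(Measure.pi fun _ : Fin n => μ) ≤
      4 * n ^ 2 * b ^ 2 * Fintype.card B +
        2 * n * ∫ z, (h z ⬝ᵥ h z - b * Fintype.card B) ^ 2 ∂μ := by
  set D : ℝ := (Fintype.card B : ℝ)
  set V := ∫ z, (h z ⬝ᵥ h z - b * D) ^ 2 ∂μ with hV
  have hhh : HasMoments (fun z => h z ⬝ᵥ h z) μ := HasMoments.dotProduct hm hm
  have hw : HasMoments (fun z => h z ⬝ᵥ h z - b * D) μ := hhh.sub (HasMoments.const _)
  have hq : ∀ n : ℕ, HasMoments (fun y : Fin n → E => sumVec h y ⬝ᵥ sumVec h y - n * (b * D))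
      (Measure.pi fun _ : Fin n => μ) := fun n =>
    (HasMoments.dotProduct (HasMoments.sumVec hm n) (HasMoments.sumVec hm n)).sub
      (HasMoments.const _)
  -- The factor n(n-1) in place of n² is what the induction produces: the increments 8b · n b D sum
  -- to exactly 4n(n-1)b²D.
  suffices H : ∫ y, (sumVec h y ⬝ᵥ sumVec h y - n * (b * D)) ^ 2
      ∂(Measure.pi fun _ : Fin n => μ) ≤ 4 * n * (n - 1) * b ^ 2 * D + 2 * n * V by
    have : 0 ≤ 4 * (n : ℝ) * b ^ 2 * D := by positivity
    linarith
  induction n with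
  | zero => simp [sumVec, dotProduct]
  | succ n ih =>
    rw [integral_pi_finCons μ ((hq _).pow 2).integrable]
    have hs := HasMoments.sumVec hm n
    have h1 : ∀ y : Fin n → E, ∫ z, (sumVec h (Fin.cons z y : Fin (n + 1) → E) ⬝ᵥ
        sumVec h (Fin.cons z y : Fin (n + 1) → E) - ((n + 1 : ℕ) : ℝ) * (b * D)) ^ 2 ∂μ ≤
        (sumVec h y ⬝ᵥ sumVec h y - n * (b * D)) ^ 2 +
          (8 * b * (sumVec h y ⬝ᵥ sumVec h y) + 2 * V) := by
      intro y
      set q := sumVec h y ⬝ᵥ sumVec h y - n * (b * D)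
      have hd : HasMoments (fun z => sumVec h y ⬝ᵥ h z) μ :=
        HasMoments.dotProduct (fun x => HasMoments.const _) hm
      have h2 : ∀ z, (sumVec h (Fin.cons z y : Fin (n + 1) → E) ⬝ᵥ
          sumVec h (Fin.cons z y : Fin (n + 1) → E) - ((n + 1 : ℕ) : ℝ) * (b * D)) ^ 2 ≤
          (q ^ 2 + (4 * q * (sumVec h y ⬝ᵥ h z) + 2 * q * (h z ⬝ᵥ h z - b * D))) +
          (8 * (sumVec h y ⬝ᵥ h z) ^ 2 + 2 * (h z ⬝ᵥ h z - b * D) ^ 2) := by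
        intro z
        have : sumVec h (Fin.cons z y : Fin (n + 1) → E) ⬝ᵥ
          sumVec h (Fin.cons z y : Fin (n + 1) → E) - ((n + 1 : ℕ) : ℝ) * (b * D) =
          q + 2 * (sumVec h y ⬝ᵥ h z) + (h z ⬝ᵥ h z - b * D) := by
          rw [sumVec_cons, add_dotProduct, dotProduct_add, dotProduct_add,
            dotProduct_comm (h z) (sumVec h y)]
          simp only [q]
          push_cast
          ring
        rw [this]
        -- The cross term between the two parts of the increment need not have mean zero; it is
        -- removed by (x + y)² ≤ 2x² + 2y².
        nlinarith [sq_nonneg (2 * (sumVec h y ⬝ᵥ h z) - (h z ⬝ᵥ h z - b * D))]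
      have i1 := (hd.const_mul (4 * q)).add (hw.const_mul (2 * q))
      have i2 := ((hd.pow 2).const_mul 8).add ((hw.pow 2).const_mul 2)
      refine (integral_mono_of_nonneg (Eventually.of_forall fun z => sq_nonneg _)
        (((HasMoments.const _).add i1).add i2).integrable (Eventually.of_forall h2)).trans
        (le_of_eq ?_)
      rw [integral_add ((HasMoments.const _).add i1).integrable i2.integrable,
        integral_add (integrable_const _) i1.integrable,
        integral_add (hd.const_mul _).integrable (hw.const_mul _).integrable,
        integral_add ((hd.pow 2).const_mul _).integrable ((hw.pow 2).const_mul _).integrable]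
      simp only [integral_const_mul]
      rw [integral_dotProduct_left hm, integral_dotProduct_sq_of_isotropic hm hΓ,
        integral_sub hhh.integrable (integrable_const _), integral_dotProduct_self hm hΓ]
      simp [h0, dotProduct, D, V]
      ring
    have hA : HasMoments (fun y : Fin n → E => sumVec h y ⬝ᵥ sumVec h y)
      (Measure.pi fun _ : Fin n => μ) := HasMoments.dotProduct hs hs
    have i3 := (hA.const_mul (8 * b)).add (HasMoments.const (2 * V))
    refine (integral_mono_of_nonneg (Eventually.of_forall fun y => integral_nonneg fun z =>
      sq_nonneg _) (((hq n).pow 2).add i3).integrable (Eventually.of_forall h1)).trans ?_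
    rw [integral_add ((hq n).pow 2).integrable i3.integrable,
      integral_add (hA.const_mul _).integrable (integrable_const _), integral_const_mul,
      integral_sumVec_dotProduct_self hm h0 hΓ]
    simp only [integral_const, probReal_univ, one_smul]
    push_cast
    refine (add_le_add_left ih _).trans (le_of_eq ?_)
    ring

/-- The fourth moment of a linear form in a sum of isotropic vectors. -/
lemma integral_sumVec_dotProduct_pow_four (hm : ∀ x, HasMoments (fun z => h z x) μ)
    (h0 : ∀ x, ∫ z, h z x ∂μ = 0)
    (hΓ : ∀ x x', ∫ z, h z x * h z x' ∂μ = if x = x' then b else 0) (u : B → ℝ) (n : ℕ) :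
    ∫ y, (sumVec h y ⬝ᵥ u) ^ 4 ∂(Measure.pi fun _ : Fin n => μ) =
      3 * n * (n - 1) * b ^ 2 * (u ⬝ᵥ u) ^ 2 + n * ∫ z, (h z ⬝ᵥ u) ^ 4 ∂μ := by
  have hd : HasMoments (fun z => h z ⬝ᵥ u) μ :=
    HasMoments.dotProduct hm fun x => HasMoments.const _
  have hd1 : ∫ z, h z ⬝ᵥ u ∂μ = 0 := by
    simp only [dotProduct_comm _ u]
    rw [integral_dotProduct_left hm]
    simp [h0, dotProduct]
  have hd2 : ∫ z, (h z ⬝ᵥ u) ^ 2 ∂μ = b * (u ⬝ᵥ u) := by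
    simp only [dotProduct_comm _ u]
    exact integral_dotProduct_sq_of_isotropic hm hΓ u
  induction n with
  | zero => simp [sumVec, dotProduct]
  | succ n ih =>
    have hs := HasMoments.sumVec hm n
    have hS : ∀ n, HasMoments (fun y : Fin n → E => sumVec h y ⬝ᵥ u)
        (Measure.pi fun _ : Fin n => μ) := fun n =>
      HasMoments.dotProduct (HasMoments.sumVec hm n) fun x => HasMoments.const _
    have hS1 : ∫ y : Fin n → E, sumVec h y ⬝ᵥ u ∂(Measure.pi fun _ : Fin n => μ) = 0 := by
      simp only [dotProduct_comm _ u]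
      rw [integral_dotProduct_left hs]
      simp [integral_sumVec hm h0, dotProduct]
    have hS2 : ∫ y : Fin n → E, (sumVec h y ⬝ᵥ u) ^ 2 ∂(Measure.pi fun _ : Fin n => μ) =
        n * (b * (u ⬝ᵥ u)) := by
      simp only [dotProduct_comm _ u]
      rw [integral_dotProduct_sq hs]
      simp only [integral_sumVec_mul hm h0, hΓ]
      simp [dotProduct, Finset.mul_sum]
      exact Finset.sum_congr rfl fun x _ => by ring
    rw [integral_pi_finCons μ ((hS _).pow 4).integrable]
    have h1 : ∀ y : Fin n → E, ∫ z, (sumVec h (Fin.cons z y : Fin (n + 1) → E) ⬝ᵥ u) ^ 4 ∂μ =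
        (sumVec h y ⬝ᵥ u) ^ 4 + (6 * (b * (u ⬝ᵥ u)) * (sumVec h y ⬝ᵥ u) ^ 2 +
          (4 * (∫ z, (h z ⬝ᵥ u) ^ 3 ∂μ) * (sumVec h y ⬝ᵥ u) + ∫ z, (h z ⬝ᵥ u) ^ 4 ∂μ)) := by
      intro y
      set q := sumVec h y ⬝ᵥ u
      have h2 : ∀ z, (sumVec h (Fin.cons z y : Fin (n + 1) → E) ⬝ᵥ u) ^ 4 =
          (q ^ 4 + 4 * q ^ 3 * (h z ⬝ᵥ u)) + (6 * q ^ 2 * (h z ⬝ᵥ u) ^ 2 +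
            (4 * q * (h z ⬝ᵥ u) ^ 3 + (h z ⬝ᵥ u) ^ 4)) := by
        intro z
        rw [sumVec_cons, add_dotProduct]
        ring
      simp only [h2]
      have i1 := ((hd.pow 3).const_mul (4 * q)).add (hd.pow 4)
      rw [integral_add ((HasMoments.const _).add (hd.const_mul _)).integrable
          (((hd.pow 2).const_mul _).add i1).integrable,
        integral_add (integrable_const _) (hd.const_mul _).integrable,
        integral_add ((hd.pow 2).const_mul _).integrable i1.integrable,
        integral_add ((hd.pow 3).const_mul _).integrable (hd.pow 4).integrable]
      simp only [integral_const_mul, hd1, hd2]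
      simp
      ring
    simp only [h1]
    have i2 := ((hS n).const_mul (4 * (∫ z, (h z ⬝ᵥ u) ^ 3 ∂μ))).add
      (HasMoments.const (∫ z, (h z ⬝ᵥ u) ^ 4 ∂μ))
    have i3 := ((hS n).pow 2).const_mul (6 * (b * (u ⬝ᵥ u)))
    rw [integral_add ((hS n).pow 4).integrable (i3.add i2).integrable,
      integral_add i3.integrable i2.integrable,
      integral_add ((hS n).const_mul _).integrable (integrable_const _), ih]
    simp only [integral_const_mul, hS1, hS2]
    simp
    ring

/-- Fixing the new observation z turns the increment into a linear form in the old sum with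
coefficients u = h z; its fourth moment is then averaged over z. This controls the Lyapunov term of
the limit theorem. -/
lemma integral_prod_sumVec_dotProduct_pow_four_le (hm : ∀ x, HasMoments (fun z => h z x) μ)
    (h0 : ∀ x, ∫ z, h z x ∂μ = 0)
    (hΓ : ∀ x x', ∫ z, h z x * h z x' ∂μ = if x = x' then b else 0) (n : ℕ) :
    ∫ w, (sumVec h w.1 ⬝ᵥ h w.2) ^ 4 ∂((Measure.pi fun _ : Fin n => μ).prod μ) ≤
      3 * n ^ 2 * b ^ 2 * ((∫ z, (h z ⬝ᵥ h z - b * Fintype.card B) ^ 2 ∂μ) +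
        b ^ 2 * Fintype.card B ^ 2) + n * ∫ z, ∫ y, (h y ⬝ᵥ h z) ^ 4 ∂μ ∂μ := by
  set D : ℝ := (Fintype.card B : ℝ)
  have hs := HasMoments.sumVec hm n
  have hp : HasMoments (fun w : (Fin n → E) × E => sumVec h w.1 ⬝ᵥ h w.2)
      ((Measure.pi fun _ : Fin n => μ).prod μ) :=
    HasMoments.dotProduct (fun x => (hs x).comp measurePreserving_fst)
      (fun x => (hm x).comp measurePreserving_snd)
  have hk : HasMoments (fun w : E × E => h w.2 ⬝ᵥ h w.1) (μ.prod μ) :=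
    HasMoments.dotProduct (fun x => (hm x).comp measurePreserving_snd)
      (fun x => (hm x).comp measurePreserving_fst)
  have hhh : HasMoments (fun z => h z ⬝ᵥ h z) μ := HasMoments.dotProduct hm hm
  rw [integral_prod_symm _ (hp.pow 4).integrable]
  simp only [integral_sumVec_dotProduct_pow_four hm h0 hΓ]
  rw [integral_add ((hhh.pow 2).const_mul _).integrable
    ((hk.pow 4).integrable.integral_prod_left.const_mul _), integral_const_mul, integral_const_mul]
  have hV : ∫ z, (h z ⬝ᵥ h z) ^ 2 ∂μ =
      (∫ z, (h z ⬝ᵥ h z - b * D) ^ 2 ∂μ) + b ^ 2 * D ^ 2 := by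
    have : ∀ z, (h z ⬝ᵥ h z - b * D) ^ 2 =
      (h z ⬝ᵥ h z) ^ 2 - (2 * (b * D) * (h z ⬝ᵥ h z) - b ^ 2 * D ^ 2) := fun z => by ring
    simp only [this]
    rw [integral_sub (hhh.pow 2).integrable ((hhh.const_mul _).sub (HasMoments.const _)).integrable,
      integral_sub (hhh.const_mul _).integrable (integrable_const _), integral_const_mul,
      integral_dotProduct_self hm hΓ]
    simp [D]
    ring
  rw [← hV]
  have : 0 ≤ ∫ z, (h z ⬝ᵥ h z) ^ 2 ∂μ := integral_nonneg fun z => sq_nonneg _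
  have : 0 ≤ 3 * (n : ℝ) * b ^ 2 * ∫ z, (h z ⬝ᵥ h z) ^ 2 ∂μ := by positivity
  linarith

end Isotropic

/-! ### Recursion for the characteristic function. -/

section CharFun

variable {E : Type*} [MeasurableSpace E] {μ : Measure E} [IsProbabilityMeasure μ]
  {B : Type*} [Fintype B] [DecidableEq B] {h : E → B → ℝ} {b : ℝ}

lemma integrable_cexp_mul_I {Ω : Type*} [MeasurableSpace Ω] {P : Measure Ω} [IsFiniteMeasure P]
    {f : Ω → ℝ} (hf : AEStronglyMeasurable f P) :
    Integrable (fun ω => Complex.exp (f ω * Complex.I)) P := by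
  refine Integrable.of_bound (C := 1) ?_ (Eventually.of_forall fun ω => ?_)
  · exact (by fun_prop : Continuous fun x : ℝ => Complex.exp (x * Complex.I)).comp_aestronglyMeasurable hf
  · rw [Complex.norm_exp_ofReal_mul_I]

lemma integrable_cexp_mul_I_mul {Ω : Type*} [MeasurableSpace Ω] {P : Measure Ω}
    [IsFiniteMeasure P] {f : Ω → ℝ} {g : Ω → ℂ} (hf : AEStronglyMeasurable f P)
    (hg : Integrable g P) :
    Integrable (fun ω => Complex.exp (f ω * Complex.I) * g ω) P :=
  hg.bdd_mul (c := 1) (integrable_cexp_mul_I hf).1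
    (Eventually.of_forall fun ω => by rw [Complex.norm_exp_ofReal_mul_I])

/-- Adding one observation multiplies the characteristic function of the statistic by
approximately a Gaussian factor. -/
lemma norm_charFun_pairSum_succ_sub_le (hm : ∀ x, HasMoments (fun z => h z x) μ)
    (h0 : ∀ x, ∫ z, h z x ∂μ = 0) (hb : 0 ≤ b)
    (hΓ : ∀ x x', ∫ z, h z x * h z x' ∂μ = if x = x' then b else 0) (c : ℝ) (n : ℕ) :
    ‖(∫ y, Complex.exp ((c * pairSum h y : ℝ) * Complex.I)
          ∂(Measure.pi fun _ : Fin (n + 1) => μ)) -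
      (∫ y, Complex.exp ((c * pairSum h y : ℝ) * Complex.I) ∂(Measure.pi fun _ : Fin n => μ)) *
        Real.exp (-(2 * c ^ 2 * b ^ 2 * Fintype.card B * n))‖ ≤
    4 * √(4 * c ^ 2 * (n * (b * (b * Fintype.card B))) *
        (16 * c ^ 4 * (3 * n ^ 2 * b ^ 2 * ((∫ z, (h z ⬝ᵥ h z - b * Fintype.card B) ^ 2 ∂μ) +
          b ^ 2 * Fintype.card B ^ 2) + n * ∫ z, ∫ y, (h y ⬝ᵥ h z) ^ 4 ∂μ ∂μ))) +
      2 * c ^ 2 * b * √(4 * n ^ 2 * b ^ 2 * Fintype.card B +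
        2 * n * ∫ z, (h z ⬝ᵥ h z - b * Fintype.card B) ^ 2 ∂μ) +
      (2 * c ^ 2 * b ^ 2 * Fintype.card B * n) ^ 2 / 2 := by
  set D : ℝ := (Fintype.card B : ℝ) with hD
  set P := Measure.pi fun _ : Fin n => μ with hP
  set s : ℝ := 2 * c ^ 2 * b ^ 2 * D * n with hs'
  have hs0 : 0 ≤ s := by positivity
  have hs := HasMoments.sumVec hm n
  have hp : HasMoments (fun w : (Fin n → E) × E => sumVec h w.1 ⬝ᵥ h w.2) (P.prod μ) :=
    HasMoments.dotProduct (fun x => (hs x).comp measurePreserving_fst)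
      (fun x => (hm x).comp measurePreserving_snd)
  have hA : HasMoments (fun y : Fin n → E => sumVec h y ⬝ᵥ sumVec h y) P :=
    HasMoments.dotProduct hs hs
  have hA' : HasMoments (fun w : (Fin n → E) × E => sumVec h w.1 ⬝ᵥ sumVec h w.1) (P.prod μ) :=
    hA.comp measurePreserving_fst
  have hU : HasMoments (fun y : Fin n → E => c * pairSum h y) P :=
    (HasMoments.pairSum hm n).const_mul c
  have hU' : HasMoments (fun w : (Fin n → E) × E => c * pairSum h w.1) (P.prod μ) :=
    hU.comp measurePreserving_fst
  -- ξ is the scaled increment and σ its conditional variance given the old sample; σ/2 has mean s.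
  set ξ : (Fin n → E) × E → ℝ := fun w => 2 * c * (sumVec h w.1 ⬝ᵥ h w.2) with hξ
  set σ : (Fin n → E) × E → ℝ := fun w => 4 * c ^ 2 * (b * (sumVec h w.1 ⬝ᵥ sumVec h w.1)) with hσ
  have hξm : HasMoments ξ (P.prod μ) := hp.const_mul _
  have hσm : HasMoments σ (P.prod μ) := (hA'.const_mul b).const_mul _
  set e : (Fin n → E) × E → ℂ := fun w => Complex.exp ((c * pairSum h w.1 : ℝ) * Complex.I) with he
  have hei : Integrable e (P.prod μ) := integrable_cexp_mul_I hU'.aestronglyMeasurable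
  -- the first characteristic function as an integral over the product space
  have e1 : (∫ y, Complex.exp ((c * pairSum h y : ℝ) * Complex.I)
      ∂(Measure.pi fun _ : Fin (n + 1) => μ)) =
      ∫ w, e w * Complex.exp (ξ w * Complex.I) ∂(P.prod μ) := by
    have hmp := measurePreserving_finCons μ n
    have hi : Integrable (fun y : Fin (n + 1) → E =>
        Complex.exp ((c * pairSum h y : ℝ) * Complex.I)) (Measure.pi fun _ : Fin (n + 1) => μ) :=
      integrable_cexp_mul_I ((HasMoments.pairSum hm _).const_mul c).aestronglyMeasurable
    rw [← hmp.map_eq, integral_map hmp.measurable.aemeasurable (by rw [hmp.map_eq]; exact hi.1)]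
    refine integral_congr_ae (Eventually.of_forall fun w => ?_)
    simp only [he, hξ, pairSum_cons, ← Complex.exp_add]
    congr 1
    push_cast
    ring
  have e2 : (∫ y, Complex.exp ((c * pairSum h y : ℝ) * Complex.I) ∂P) * Real.exp (-s) =
      ∫ w, e w * (Real.exp (-s) : ℂ) ∂(P.prod μ) := by
    rw [integral_mul_const]
    congr 1
    exact (integral_fun_fst (μ := P) (ν := μ)
      (fun y : Fin n → E => Complex.exp ((c * pairSum h y : ℝ) * Complex.I))).symm ▸ by simp
  have hξ2 : Integrable (fun w => (ξ w : ℂ) * Complex.I) (P.prod μ) :=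
    hξm.integrable.ofReal.mul_const _
  have hξσ : Integrable (fun w => (((σ w - ξ w ^ 2) / 2 : ℝ) : ℂ)) (P.prod μ) :=
    ((hσm.sub (hξm.pow 2)).integrable.div_const 2).ofReal
  have hlin : Integrable (fun w => (ξ w : ℂ) * Complex.I + (((σ w - ξ w ^ 2) / 2 : ℝ) : ℂ))
    (P.prod μ) := hξ2.add hξσ
  have hei3 : Integrable (fun w => e w * ((ξ w : ℂ) * Complex.I +
      (((σ w - ξ w ^ 2) / 2 : ℝ) : ℂ))) (P.prod μ) :=
    integrable_cexp_mul_I_mul hU'.aestronglyMeasurable hlin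
  -- the conditional first two moments
  have e3 : ∫ w, e w * ((ξ w : ℂ) * Complex.I + (((σ w - ξ w ^ 2) / 2 : ℝ) : ℂ)) ∂(P.prod μ) =
      0 := by
    rw [integral_prod _ hei3]
    refine integral_eq_zero_of_ae (Eventually.of_forall fun y => ?_)
    have hd : HasMoments (fun z => sumVec h y ⬝ᵥ h z) μ :=
      HasMoments.dotProduct (fun x => HasMoments.const _) hm
    have hey : ∀ z, e (y, z) = Complex.exp ((c * pairSum h y : ℝ) * Complex.I) := fun z => rfl
    simp only [hey, Pi.zero_apply, hξ, hσ]
    rw [integral_const_mul, integral_add, integral_mul_const, integral_complex_ofReal,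
      integral_complex_ofReal,
      integral_div, integral_sub]
    · simp only [mul_pow, integral_const_mul, integral_dotProduct_left hm, h0,
        integral_dotProduct_sq_of_isotropic hm hΓ]
      simp [dotProduct]
      ring
    · exact integrable_const _
    · exact ((hd.const_mul _).pow 2).integrable
    · exact (hd.const_mul _).integrable.ofReal.mul_const _
    · exact ((((HasMoments.const _).sub ((hd.const_mul _).pow 2))).integrable.div_const 2).ofReal
  have hei1 : Integrable (fun w => e w * Complex.exp (ξ w * Complex.I)) (P.prod μ) :=
    integrable_cexp_mul_I_mul hU'.aestronglyMeasurable
      (integrable_cexp_mul_I hξm.aestronglyMeasurable)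
  rw [e1, e2, ← sub_zero (∫ w, e w * Complex.exp (ξ w * Complex.I) ∂(P.prod μ)), ← e3,
    ← integral_sub hei1 hei3, ← integral_sub (f := fun w => e w * Complex.exp (ξ w * Complex.I) -
      e w * ((ξ w : ℂ) * Complex.I + (((σ w - ξ w ^ 2) / 2 : ℝ) : ℂ))) (hei1.sub hei3)
      (hei.mul_const _)]
  set bound : (Fin n → E) × E → ℝ := fun w =>
    4 * |ξ w| ^ 3 + 2 * c ^ 2 * b * |sumVec h w.1 ⬝ᵥ sumVec h w.1 - n * (b * D)| + s ^ 2 / 2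
    with hbound
  have hdev : HasMoments (fun y : Fin n → E => sumVec h y ⬝ᵥ sumVec h y - n * (b * D)) P :=
    hA.sub (HasMoments.const _)
  have i1 : Integrable (fun w => 4 * |ξ w| ^ 3) (P.prod μ) :=
    ((hξm.abs.pow 3).const_mul 4).integrable
  have hdev' := (hdev.comp (μ' := P.prod μ) measurePreserving_fst)
  have i2 : Integrable (fun w : (Fin n → E) × E =>
      2 * c ^ 2 * b * |sumVec h w.1 ⬝ᵥ sumVec h w.1 - n * (b * D)|) (P.prod μ) :=
    (hdev'.abs.const_mul _).integrable
  have hle : ∀ w, ‖e w * Complex.exp (ξ w * Complex.I) -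
      e w * ((ξ w : ℂ) * Complex.I + (((σ w - ξ w ^ 2) / 2 : ℝ) : ℂ)) -
      e w * (Real.exp (-s) : ℂ)‖ ≤ bound w := by
    intro w
    have n1 : ‖e w‖ = 1 := Complex.norm_exp_ofReal_mul_I _
    -- Three errors, one for each summand of `bound`: the Taylor remainder of exp(iξ), the
    -- fluctuation s - σ/2 of the conditional variance, and the remainder of exp(-s).
    have : e w * Complex.exp (ξ w * Complex.I) -
      e w * ((ξ w : ℂ) * Complex.I + (((σ w - ξ w ^ 2) / 2 : ℝ) : ℂ)) -
      e w * (Real.exp (-s) : ℂ) = e w * ((Complex.exp (ξ w * Complex.I) - 1 - ξ w * Complex.I +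
        (ξ w : ℂ) ^ 2 / 2) + ((s - σ w / 2 : ℝ) : ℂ) + ((-(Real.exp (-s) - 1 + s) : ℝ) : ℂ)) := by
      push_cast
      ring
    rw [this, norm_mul, n1, one_mul]
    refine (norm_add₃_le).trans ?_
    rw [Complex.norm_real, Complex.norm_real, norm_neg, Real.norm_eq_abs, Real.norm_eq_abs]
    have h1 := norm_exp_mul_I_sub_taylor_le (ξ w)
    have h2 := abs_exp_neg_sub_le hs0
    have h3 : |s - σ w / 2| =
        2 * c ^ 2 * b * |sumVec h w.1 ⬝ᵥ sumVec h w.1 - n * (b * D)| := by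
      rw [abs_sub_comm, ← abs_of_nonneg (by positivity : 0 ≤ 2 * c ^ 2 * b), ← abs_mul]
      congr 1
      simp only [hσ, hs']
      ring
    simp only [hbound]
    linarith
  refine (norm_integral_le_of_norm_le ((i1.add i2).add (integrable_const _))
    (Eventually.of_forall hle)).trans ?_
  rw [integral_add' (i1.add i2) (integrable_const _), integral_add' i1 i2]
  simp only [integral_const, probReal_univ, one_smul]
  rw [integral_const_mul, integral_const_mul]
  have b1 : ∫ w, |ξ w| ^ 3 ∂(P.prod μ) ≤ √(4 * c ^ 2 * (n * (b * (b * D))) *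
        (16 * c ^ 4 * (3 * n ^ 2 * b ^ 2 * ((∫ z, (h z ⬝ᵥ h z - b * D) ^ 2 ∂μ) +
          b ^ 2 * D ^ 2) + n * ∫ z, ∫ y, (h y ⬝ᵥ h z) ^ 4 ∂μ ∂μ))) := by
    refine (integral_abs_pow_three_le_sqrt hξm).trans (Real.sqrt_le_sqrt ?_)
    have j2 : ∫ w, ξ w ^ 2 ∂(P.prod μ) = 4 * c ^ 2 * (n * (b * (b * D))) := by
      rw [integral_prod _ (hξm.pow 2).integrable]
      simp only [hξ, mul_pow, integral_const_mul, integral_dotProduct_sq_of_isotropic hm hΓ,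
        hP, integral_sumVec_dotProduct_self hm h0 hΓ]
      ring
    have j4 : ∫ w, ξ w ^ 4 ∂(P.prod μ) =
        16 * c ^ 4 * ∫ w, (sumVec h w.1 ⬝ᵥ h w.2) ^ 4 ∂(P.prod μ) := by
      simp only [hξ, mul_pow, integral_const_mul]
      ring
    rw [j2, j4]
    have := integral_prod_sumVec_dotProduct_pow_four_le hm h0 hΓ n
    gcongr
  have b2 : ∫ w : (Fin n → E) × E, |sumVec h w.1 ⬝ᵥ sumVec h w.1 - n * (b * D)| ∂(P.prod μ) ≤
      √(4 * n ^ 2 * b ^ 2 * D + 2 * n * ∫ z, (h z ⬝ᵥ h z - b * D) ^ 2 ∂μ) := by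
    refine (integral_abs_le_sqrt hdev'.memLp_two).trans (Real.sqrt_le_sqrt ?_)
    refine le_trans (le_of_eq ?_) (integral_sumVec_dotProduct_self_sub_sq_le hm h0 hΓ n)
    rw [integral_fun_fst (μ := P) (ν := μ)
      (fun y : Fin n → E => (sumVec h y ⬝ᵥ sumVec h y - n * (b * D)) ^ 2)]
    simp [hP, hD]
  gcongr

/-- A quantitative central limit theorem for the sum over pairs of distinct observations of the
inner products of centred isotropic feature vectors. -/
theorem norm_charFun_pairSum_sub_le (hm : ∀ x, HasMoments (fun z => h z x) μ)
    (h0 : ∀ x, ∫ z, h z x ∂μ = 0) (hb : 0 ≤ b)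
    (hΓ : ∀ x x', ∫ z, h z x * h z x' ∂μ = if x = x' then b else 0) (c : ℝ) (n : ℕ) :
    ‖(∫ y, Complex.exp ((c * pairSum h y : ℝ) * Complex.I) ∂(Measure.pi fun _ : Fin n => μ)) -
      Real.exp (-(c ^ 2 * b ^ 2 * Fintype.card B * (n * (n - 1))))‖ ≤
    n * (4 * √(4 * c ^ 2 * (n * (b * (b * Fintype.card B))) *
        (16 * c ^ 4 * (3 * n ^ 2 * b ^ 2 * ((∫ z, (h z ⬝ᵥ h z - b * Fintype.card B) ^ 2 ∂μ) +
          b ^ 2 * Fintype.card B ^ 2) + n * ∫ z, ∫ y, (h y ⬝ᵥ h z) ^ 4 ∂μ ∂μ))) +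
      2 * c ^ 2 * b * √(4 * n ^ 2 * b ^ 2 * Fintype.card B +
        2 * n * ∫ z, (h z ⬝ᵥ h z - b * Fintype.card B) ^ 2 ∂μ) +
      (2 * c ^ 2 * b ^ 2 * Fintype.card B * n) ^ 2 / 2) := by
  have hV : 0 ≤ ∫ z, (h z ⬝ᵥ h z - b * Fintype.card B) ^ 2 ∂μ :=
    integral_nonneg fun z => sq_nonneg _
  have hK : 0 ≤ ∫ z, ∫ y, (h y ⬝ᵥ h z) ^ 4 ∂μ ∂μ :=
    integral_nonneg fun z => integral_nonneg fun y => by positivity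
  set D : ℝ := (Fintype.card B : ℝ) with hD
  set V := ∫ z, (h z ⬝ᵥ h z - b * D) ^ 2 ∂μ
  set K := ∫ z, ∫ y, (h y ⬝ᵥ h z) ^ 4 ∂μ ∂μ
  have hD0 : 0 ≤ D := Nat.cast_nonneg _
  set err : ℕ → ℝ := fun n => 4 * √(4 * c ^ 2 * (n * (b * (b * D))) *
        (16 * c ^ 4 * (3 * n ^ 2 * b ^ 2 * (V + b ^ 2 * D ^ 2) + n * K))) +
      2 * c ^ 2 * b * √(4 * n ^ 2 * b ^ 2 * D + 2 * n * V) +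
      (2 * c ^ 2 * b ^ 2 * D * n) ^ 2 / 2 with herr
  -- One-step errors increase with the sample size, so their sum is at most n times the error at n.
  -- Earlier errors are not amplified, being multiplied only by factors exp(-s) ≤ 1.
  have hmono : ∀ k, err k ≤ err (k + 1) := by
    intro k
    simp only [herr]
    push_cast
    gcongr <;> linarith
  have herr0 : ∀ k, 0 ≤ err k := fun k => by simp only [herr]; positivity
  change _ ≤ (n : ℝ) * err n
  induction n with
  | zero => simp [pairSum]
  | succ n ih =>
    set φ : ℂ := ∫ y, Complex.exp ((c * pairSum h y : ℝ) * Complex.I)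
      ∂(Measure.pi fun _ : Fin n => μ)
    have hstep := norm_charFun_pairSum_succ_sub_le hm h0 hb hΓ c n
    set φ' : ℂ := ∫ y, Complex.exp ((c * pairSum h y : ℝ) * Complex.I)
      ∂(Measure.pi fun _ : Fin (n + 1) => μ)
    set s := 2 * c ^ 2 * b ^ 2 * D * n with hs
    have hstep' : ‖φ' - φ * Real.exp (-s)‖ ≤ err n := hstep
    set v := c ^ 2 * b ^ 2 * D * (n * (n - 1)) with hv
    have hv' : c ^ 2 * b ^ 2 * D * (((n + 1 : ℕ) : ℝ) * (((n + 1 : ℕ) : ℝ) - 1)) = v + s := by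
      push_cast
      ring
    have hs0 : 0 ≤ s := by positivity
    rw [hv', neg_add, Real.exp_add]
    calc ‖φ' - ((Real.exp (-v) * Real.exp (-s) : ℝ) : ℂ)‖
        = ‖(φ' - φ * Real.exp (-s)) + (φ - Real.exp (-v)) * Real.exp (-s)‖ := by
          push_cast
          ring_nf
      _ ≤ err n + ‖φ - Real.exp (-v)‖ * 1 := by
          refine (norm_add_le _ _).trans (add_le_add hstep' ?_)
          rw [norm_mul]
          gcongr
          rw [Complex.norm_real, Real.norm_of_nonneg (Real.exp_pos _).le]
          exact Real.exp_le_one_iff.2 (by linarith)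
      _ ≤ err n + n * err n := by
          rw [mul_one]
          gcongr
      _ ≤ ((n + 1 : ℕ) : ℝ) * err (n + 1) := by
          push_cast
          nlinarith [hmono n, herr0 n]

end CharFun

/-! ### Moments of Gaussian and Bernoulli variables -/

/-- The moment is the fourth derivative of the moment generating function at 0. Each derivative
keeps the form polynomial times exp(vt²/2), the polynomial q becoming q' + vtq. -/
lemma integral_pow_four_gaussianReal (v : NNReal) :
    ∫ x, x ^ 4 ∂(gaussianReal 0 v) = 3 * (v : ℝ) ^ 2 := by
  have h := iteratedDeriv_mgf_zero (X := id) (μ := gaussianReal 0 v)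
    (by rw [integrableExpSet_id_gaussianReal]; simp) 4
  have hd : ∀ (q q' : ℝ → ℝ), (∀ t, HasDerivAt q (q' t) t) →
      deriv (fun t => q t * Real.exp (v * t ^ 2 / 2)) =
        fun t => (q' t + q t * (v * t)) * Real.exp (v * t ^ 2 / 2) := by
    intro q q' hq
    ext t
    have h1 : HasDerivAt (fun t : ℝ => (v : ℝ) * t ^ 2 / 2) (v * t) t := by
      have := ((hasDerivAt_pow 2 t).const_mul (v : ℝ)).div_const 2
      convert! this using 1
      simp
      ring
    rw [((hq t).fun_mul h1.exp).deriv]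
    ring
  have h0 : mgf id (gaussianReal 0 v) = fun t => 1 * Real.exp (v * t ^ 2 / 2) := by
    rw [mgf_id_gaussianReal]
    simp
  have d1 : deriv (mgf id (gaussianReal 0 v)) = fun t => (v * t) * Real.exp (v * t ^ 2 / 2) := by
    rw [h0, hd (fun _ => 1) (fun _ => 0) fun t => hasDerivAt_const t 1]
    simp
  have d2 : deriv (fun t : ℝ => (v * t) * Real.exp (v * t ^ 2 / 2)) =
      fun t => (v + v ^ 2 * t ^ 2) * Real.exp (v * t ^ 2 / 2) := by
    rw [hd (fun t => v * t) (fun _ => v) fun t => by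
      simpa using (hasDerivAt_id t).const_mul (v : ℝ)]
    ext t; ring
  have d3 : deriv (fun t : ℝ => (v + v ^ 2 * t ^ 2) * Real.exp (v * t ^ 2 / 2)) =
      fun t => (3 * v ^ 2 * t + v ^ 3 * t ^ 3) * Real.exp (v * t ^ 2 / 2) := by
    rw [hd (fun t => v + v ^ 2 * t ^ 2) (fun t => v ^ 2 * (2 * t)) fun t => by
      simpa using ((hasDerivAt_pow 2 t).const_mul ((v : ℝ) ^ 2)).const_add (v : ℝ)]
    ext t; ring
  have d4 : deriv (fun t : ℝ => (3 * v ^ 2 * t + v ^ 3 * t ^ 3) * Real.exp (v * t ^ 2 / 2)) =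
      fun t => (3 * v ^ 2 + v ^ 3 * (3 * t ^ 2) + (3 * v ^ 2 * t + v ^ 3 * t ^ 3) * (v * t)) *
        Real.exp (v * t ^ 2 / 2) := by
    rw [hd (fun t => 3 * v ^ 2 * t + v ^ 3 * t ^ 3) (fun t => 3 * v ^ 2 + v ^ 3 * (3 * t ^ 2))
      fun t => by
        simpa using ((hasDerivAt_id t).const_mul (3 * (v : ℝ) ^ 2)).fun_add
          ((hasDerivAt_pow 3 t).const_mul ((v : ℝ) ^ 3))]
  rw [iteratedDeriv_succ', iteratedDeriv_succ', iteratedDeriv_succ', iteratedDeriv_succ',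
    iteratedDeriv_zero, d1, d2, d3, d4] at h
  simpa using h.symm

lemma integral_sq_gaussianReal (v : NNReal) : ∫ x, x ^ 2 ∂(gaussianReal 0 v) = v := by
  have := variance_id_gaussianReal (μ := 0) (v := v)
  rw [variance_eq_integral aemeasurable_id] at this
  simpa using this

/-- The mean of a product of independent Bernoulli variables. -/
lemma integral_prod_bernoulli {ι : Type*} [Fintype ι] [DecidableEq ι] (a : unitInterval) {q : ℕ}
    (idx : Fin q → ι) :
    ∫ ε, ∏ r, ε (idx r) ∂(Measure.pi fun _ : ι => bernoulliMeasure (1 : ℝ) 0 a) =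
      (a : ℝ) ^ (Finset.univ.image idx).card := by
  -- Regrouping by coordinate lets Fubini apply; a coordinate hit at least once contributes a,
  -- whatever its multiplicity.
  have h1 : ∀ ε : ι → ℝ, ∏ r, ε (idx r) = ∏ t, ∏ r, if t = idx r then ε t else 1 := by
    intro ε
    rw [Finset.prod_comm]
    simp
  simp only [h1]
  rw [integral_fintype_prod_eq_prod (f := fun t e => ∏ r, if t = idx r then e else 1)]
  have h2 : ∀ t, ∫ e, (∏ r, if t = idx r then e else 1) ∂(bernoulliMeasure (1 : ℝ) 0 a) =
      if t ∈ Finset.univ.image idx then (a : ℝ) else 1 := by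
    intro t
    rw [integral_bernoulliMeasure]
    simp only [ite_self, Finset.prod_const_one, smul_eq_mul, mul_one]
    split_ifs with ht
    · obtain ⟨r, -, hr⟩ := Finset.mem_image.1 ht
      rw [Finset.prod_eq_zero (Finset.mem_univ r) (by simp [hr])]
      simp
    · rw [Finset.prod_eq_one fun r _ => by
        rw [if_neg fun h => ht (Finset.mem_image.2 ⟨r, Finset.mem_univ r, h.symm⟩)]]
      ring
  simp only [h2]
  rw [Finset.prod_ite, Finset.prod_const, Finset.prod_const_one, mul_one]
  simp

/-! ### Fourth-order moments of a Gaussian vector. -/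

section Wick

variable {p : ℕ} {S : Matrix (Fin p) (Fin p) ℝ}

lemma hasMoments_multivariateGaussian (i : Fin p) :
    HasMoments (fun x : EuclideanSpace ℝ (Fin p) => x i) (multivariateGaussian 0 S) :=
  fun k => IsGaussian.memLp_dual _ (EuclideanSpace.proj i : EuclideanSpace ℝ (Fin p) →L[ℝ] ℝ) k
    (ENNReal.natCast_ne_top k)

lemma integral_multivariateGaussian_eval (i : Fin p) :
    ∫ x : EuclideanSpace ℝ (Fin p), x i ∂(multivariateGaussian 0 S) = 0 := by
  have := (EuclideanSpace.proj i : EuclideanSpace ℝ (Fin p) →L[ℝ] ℝ).integral_comp_id_comm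
    (μ := multivariateGaussian 0 S) IsGaussian.integrable_id
  simpa using this

lemma integral_multivariateGaussian_mul (hS : S.PosSemidef) (i j : Fin p) :
    ∫ x : EuclideanSpace ℝ (Fin p), x i * x j ∂(multivariateGaussian 0 S) = S i j := by
  rw [← covariance_eval_multivariateGaussian (μ := 0) hS i j,
    covariance_eq_sub (hasMoments_multivariateGaussian i).memLp_two
      (hasMoments_multivariateGaussian j).memLp_two]
  simp [integral_multivariateGaussian_eval]

/-- A linear form of the vector is a centred real Gaussian, whose fourth moment is three times its
squared variance. The indices may repeat, as Wick's formula requires. -/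
lemma integral_multivariateGaussian_pow_four (hS : S.PosSemidef) {q : ℕ} (idx : Fin q → Fin p)
    (u : Fin q → ℝ) :
    ∫ x : EuclideanSpace ℝ (Fin p), (u ⬝ᵥ fun r => x (idx r)) ^ 4 ∂(multivariateGaussian 0 S) =
      3 * (∑ r, ∑ r', u r * u r' * S (idx r) (idx r')) ^ 2 := by
  set L : EuclideanSpace ℝ (Fin p) →L[ℝ] ℝ :=
    ∑ r, u r • (EuclideanSpace.proj (idx r) : EuclideanSpace ℝ (Fin p) →L[ℝ] ℝ) with hL
  have hLx : ∀ x : EuclideanSpace ℝ (Fin p), L x = u ⬝ᵥ fun r => x (idx r) := by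
    intro x
    simp [hL, dotProduct]
  have hm := fun r => hasMoments_multivariateGaussian (S := S) (idx r)
  have h1 : ∫ x, L x ∂(multivariateGaussian 0 S) = 0 := by
    simp only [hLx]
    rw [integral_dotProduct_left hm]
    simp [integral_multivariateGaussian_eval, dotProduct]
  have h2 : ∫ x, L x ^ 2 ∂(multivariateGaussian 0 S) =
      ∑ r, ∑ r', u r * u r' * S (idx r) (idx r') := by
    simp only [hLx]
    rw [integral_dotProduct_sq hm]
    simp only [integral_multivariateGaussian_mul hS]
  have hmap := IsGaussian.map_eq_gaussianReal (μ := multivariateGaussian 0 S) L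
  rw [h1] at hmap
  have hv : ∫ x, L x ^ 2 ∂(multivariateGaussian 0 S) = (Var[⇑L; multivariateGaussian 0 S].toNNReal : ℝ) := by
    rw [← integral_sq_gaussianReal, ← hmap, integral_map (by fun_prop) (by fun_prop)]
  simp only [← hLx]
  rw [← h2, hv, ← integral_pow_four_gaussianReal, ← hmap, integral_map (by fun_prop) (by fun_prop)]

/-- Wick's formula for four coordinates of a centred Gaussian vector. -/
lemma integral_multivariateGaussian_mul_four (hS : S.PosSemidef) (i j k l : Fin p) :
    ∫ x : EuclideanSpace ℝ (Fin p), x i * x j * x k * x l ∂(multivariateGaussian 0 S) =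
      S i j * S k l + S i k * S j l + S i l * S j k := by
  set f : (Fin 4 → ℝ) → EuclideanSpace ℝ (Fin p) → ℝ :=
    fun u x => (u ⬝ᵥ fun r => x (![i, j, k, l] r)) ^ 4 with hf
  have hfm : ∀ u, HasMoments (f u) (multivariateGaussian 0 S) := fun u =>
    (HasMoments.dotProduct (fun r => HasMoments.const (u r))
      fun r => hasMoments_multivariateGaussian (![i, j, k, l] r)).pow 4
  -- Polarisation: the alternating sum over the 8 sign patterns with first sign + isolates the
  -- multilinear term, with coefficient 8 · 4! = 192.
  have key : ∀ x : EuclideanSpace ℝ (Fin p), x i * x j * x k * x l =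
      (1 / 192) * (((f ![1, 1, 1, 1] x - f ![1, 1, 1, -1] x) -
        (f ![1, 1, -1, 1] x - f ![1, 1, -1, -1] x)) -
        ((f ![1, -1, 1, 1] x - f ![1, -1, 1, -1] x) -
        (f ![1, -1, -1, 1] x - f ![1, -1, -1, -1] x))) := by
    intro x
    simp [hf, dotProduct, Fin.sum_univ_four]
    ring
  have hsym : ∀ s t, S s t = S t s := fun s t => by
    simpa using (hS.isHermitian.apply s t).symm
  simp only [key]
  have e := fun u => integral_multivariateGaussian_pow_four hS ![i, j, k, l] u
  rw [integral_const_mul, integral_sub, integral_sub, integral_sub, integral_sub, integral_sub,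
    integral_sub, integral_sub]
  · simp only [hf, e]
    simp [Fin.sum_univ_four]
    rw [hsym j i, hsym k i, hsym l i, hsym k j, hsym l j, hsym l k]
    ring
  all_goals first
    | exact (hfm _).integrable
    | exact ((hfm _).sub (hfm _)).integrable
    | exact (((hfm _).sub (hfm _)).sub ((hfm _).sub (hfm _))).integrable

end Wick

/-! ### Moments of partially observed Gaussian vectors -/

section MissingLaw

variable {p : ℕ} (a : unitInterval) (S : Matrix (Fin p) (Fin p) ℝ)

lemma measurePreserving_missingLaw :
    MeasurePreserving (fun (z : (Fin p → ℝ) × EuclideanSpace ℝ (Fin p)) i => z.1 i * z.2 i)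
      ((Measure.pi fun _ : Fin p => bernoulliMeasure (1 : ℝ) 0 a).prod (multivariateGaussian 0 S))
      (missingLaw a S) :=
  ⟨by fun_prop, rfl⟩

lemma hasMoments_id_bernoulliMeasure :
    HasMoments (fun e : ℝ => e) (bernoulliMeasure (1 : ℝ) 0 a) := by
  intro k
  refine MemLp.of_bound (by fun_prop) 1 ?_
  rw [bernoulliMeasure_def, ae_add_measure_iff]
  exact ⟨Measure.ae_smul_measure (by simp [ae_dirac_eq]) _, Measure.ae_smul_measure (by simp [ae_dirac_eq]) _⟩

lemma hasMoments_missingLaw (i : Fin p) : HasMoments (fun y : Fin p → ℝ => y i) (missingLaw a S) := by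
  intro k
  rw [missingLaw, memLp_map_measure_iff (Measurable.aestronglyMeasurable (by fun_prop)) (by fun_prop)]
  have h1 := ((hasMoments_id_bernoulliMeasure a).comp
    (measurePreserving_eval (fun _ : Fin p => bernoulliMeasure (1 : ℝ) 0 a) i))
  exact ((h1.comp measurePreserving_fst).mul
    ((hasMoments_multivariateGaussian (S := S) i).comp measurePreserving_snd)) k

variable {S}

lemma integral_missingLaw_mul (hS : S.PosSemidef) {i j : Fin p} (hij : i ≠ j) :
    ∫ y, y i * y j ∂(missingLaw a S) = (a : ℝ) ^ 2 * S i j := by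
  have hm := measurePreserving_missingLaw a S
  rw [← hm.map_eq, integral_map hm.measurable.aemeasurable (by fun_prop)]
  have h1 : ∀ z : (Fin p → ℝ) × EuclideanSpace ℝ (Fin p), z.1 i * z.2 i * (z.1 j * z.2 j) =
      (∏ r, z.1 (![i, j] r)) * (z.2 i * z.2 j) := fun z => by simp; ring
  simp only [h1]
  rw [integral_prod_mul (fun e : Fin p → ℝ => ∏ r, e (![i, j] r))
    (fun x : EuclideanSpace ℝ (Fin p) => x i * x j), integral_prod_bernoulli,
    integral_multivariateGaussian_mul hS]
  congr 2
  rw [Finset.card_image_of_injective _ (by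
    intro r s; fin_cases r <;> fin_cases s <;> simp [hij, hij.symm])]
  simp

/-- Mask and Gaussian vector are independent. The cardinality of the index set, not 4, is the
exponent of a because repeated masks collapse. -/
lemma integral_missingLaw_mul_four (hS : S.PosSemidef) (i j k l : Fin p) :
    ∫ y, y i * y j * (y k * y l) ∂(missingLaw a S) =
      (a : ℝ) ^ ({i, j, k, l} : Finset (Fin p)).card *
        (S i j * S k l + S i k * S j l + S i l * S j k) := by
  have hm := measurePreserving_missingLaw a S
  rw [← hm.map_eq, integral_map hm.measurable.aemeasurable (by fun_prop)]
  have h1 : ∀ z : (Fin p → ℝ) × EuclideanSpace ℝ (Fin p),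
      z.1 i * z.2 i * (z.1 j * z.2 j) * (z.1 k * z.2 k * (z.1 l * z.2 l)) =
      (∏ r, z.1 (![i, j, k, l] r)) * (z.2 i * z.2 j * z.2 k * z.2 l) := fun z => by
    simp [Fin.prod_univ_four]; ring
  simp only [h1]
  rw [integral_prod_mul (fun e : Fin p → ℝ => ∏ r, e (![i, j, k, l] r))
    (fun x : EuclideanSpace ℝ (Fin p) => x i * x j * x k * x l), integral_prod_bernoulli,
    integral_multivariateGaussian_mul_four hS]
  congr 3
  ext t
  simp [Fin.exists_fin_succ, eq_comm]

end MissingLaw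

/-! ### Independent coordinates under the identity covariance -/

section CoordLaw

variable (a : unitInterval)

/-- The law of one partially observed standard Gaussian coordinate. -/
noncomputable def coordLaw : Measure ℝ :=
  ((bernoulliMeasure (1 : ℝ) 0 a).prod (gaussianReal 0 1)).map fun z => z.1 * z.2

instance : IsProbabilityMeasure (coordLaw a) :=
  Measure.isProbabilityMeasure_map (Measurable.aemeasurable (by fun_prop))

/-- Independence of the coordinates is what gives access to moments beyond the fourth and to sign
flips under the null hypothesis. -/
lemma missingLaw_one (p : ℕ) :
    missingLaw a (1 : Matrix (Fin p) (Fin p) ℝ) = Measure.pi fun _ : Fin p => coordLaw a := by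
  rw [missingLaw, multivariateGaussian_zero_one, ← map_pi_eq_stdGaussian]
  have h1 := (measurePreserving_arrowProdEquivProdArrow ℝ ℝ (Fin p)
    (fun _ => bernoulliMeasure (1 : ℝ) 0 a) (fun _ => gaussianReal 0 1)).map_eq
  have h2 := Measure.map_prod_map (f := id) (g := WithLp.toLp 2)
    (Measure.pi fun _ : Fin p => bernoulliMeasure (1 : ℝ) 0 a)
    (Measure.pi fun _ : Fin p => gaussianReal 0 1) measurable_id (by fun_prop)
  rw [Measure.map_id] at h2
  rw [h2, ← h1, Measure.map_map (by fun_prop) (by fun_prop),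
    Measure.map_map (by fun_prop) (by fun_prop)]
  unfold coordLaw
  rw [← Measure.pi_map_pi (fun _ => by fun_prop)]
  rfl

lemma integral_pow_coordLaw {k : ℕ} (hk : k ≠ 0) :
    ∫ y, y ^ k ∂(coordLaw a) = a * ∫ x, x ^ k ∂(gaussianReal 0 1) := by
  rw [coordLaw, integral_map (by fun_prop) (by fun_prop)]
  simp only [mul_pow]
  rw [integral_prod_mul (fun e : ℝ => e ^ k) (fun x : ℝ => x ^ k), integral_bernoulliMeasure]
  simp [hk]

lemma integral_sq_coordLaw : ∫ y, y ^ 2 ∂(coordLaw a) = a := by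
  rw [integral_pow_coordLaw a two_ne_zero, integral_sq_gaussianReal]
  simp

lemma integral_pow_four_coordLaw : ∫ y, y ^ 4 ∂(coordLaw a) = 3 * a := by
  rw [integral_pow_coordLaw a four_ne_zero, integral_pow_four_gaussianReal]
  simp
  ring

lemma measurePreserving_neg_coordLaw : MeasurePreserving (fun y : ℝ => -y) (coordLaw a) (coordLaw a) := by
  refine ⟨by fun_prop, ?_⟩
  have h2 := Measure.map_prod_map (f := id) (g := fun x : ℝ => -x)
    (bernoulliMeasure (1 : ℝ) 0 a) (gaussianReal 0 1) measurable_id (by fun_prop)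
  rw [Measure.map_id, gaussianReal_map_neg, neg_zero] at h2
  conv_rhs => rw [coordLaw, h2]
  rw [coordLaw, Measure.map_map (by fun_prop) (by fun_prop),
    Measure.map_map (by fun_prop) (by fun_prop)]
  congr 1
  ext z
  simp

end CoordLaw

/-! ### Fourth moments of Rademacher chaos of degree two -/

/-- The sign attached to a Boolean. -/
def boolSign (b : Bool) : ℝ := if b then 1 else -1

lemma sum_bool_cons {p : ℕ} (F : (Fin (p + 1) → Bool) → ℝ) :
    ∑ s, F s = ∑ s : Fin p → Bool, (F (Fin.cons true s) + F (Fin.cons false s)) := by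
  rw [← (Fin.consEquiv fun _ : Fin (p + 1) => Bool).sum_comp, Fintype.sum_prod_type,
    Fintype.sum_bool, Finset.sum_add_distrib]
  rfl

/-- Khinchine's inequality with its constant 3. Averaging over the first sign removes the odd terms,
and the induction closes because 6 c₀² l is the cross term of 3(c₀² + l)². -/
lemma sum_linear_chaos_pow_four_le {p : ℕ} (c : Fin p → ℝ) :
    (∑ s : Fin p → Bool, (∑ i, c i * boolSign (s i)) ^ 2 = 2 ^ p * ∑ i, c i ^ 2) ∧
    ∑ s : Fin p → Bool, (∑ i, c i * boolSign (s i)) ^ 4 ≤ 2 ^ p * (3 * (∑ i, c i ^ 2) ^ 2) := by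
  induction p with
  | zero => simp
  | succ p ih =>
    obtain ⟨ih2, ih4⟩ := ih fun i => c i.succ
    simp only [sum_bool_cons, Fin.sum_univ_succ, Fin.cons_zero, Fin.cons_succ]
    set L : (Fin p → Bool) → ℝ := fun s => ∑ i, c i.succ * boolSign (s i)
    set l : ℝ := ∑ i, c (Fin.succ i) ^ 2
    replace ih2 : ∑ s, L s ^ 2 = 2 ^ p * l := ih2
    replace ih4 : ∑ s, L s ^ 4 ≤ 2 ^ p * (3 * l ^ 2) := ih4
    have e2 : ∀ s, (c 0 * boolSign true + L s) ^ 2 + (c 0 * boolSign false + L s) ^ 2 =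
        2 * c 0 ^ 2 + 2 * L s ^ 2 := fun s => by simp [boolSign]; ring
    have e4 : ∀ s, (c 0 * boolSign true + L s) ^ 4 + (c 0 * boolSign false + L s) ^ 4 =
        2 * c 0 ^ 4 + (12 * c 0 ^ 2 * L s ^ 2 + 2 * L s ^ 4) := fun s => by simp [boolSign]; ring
    constructor
    · refine (Finset.sum_congr rfl fun s _ => e2 s).trans ?_
      rw [Finset.sum_add_distrib, ← Finset.mul_sum, ← Finset.mul_sum, ih2]
      simp
      ring
    · refine (Finset.sum_congr rfl fun s _ => e4 s).trans_le ?_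
      rw [Finset.sum_add_distrib, Finset.sum_add_distrib, ← Finset.mul_sum, ← Finset.mul_sum,
        ← Finset.mul_sum, ih2]
      have hl : 0 ≤ l := Finset.sum_nonneg fun i _ => sq_nonneg _
      simp only [Finset.sum_const, Finset.card_univ, Fintype.card_fun, Fintype.card_bool,
        Fintype.card_fin, nsmul_eq_mul]
      push_cast
      have h2 : (0 : ℝ) ≤ 2 ^ p * c 0 ^ 4 := by positivity
      rw [pow_succ (2 : ℝ) p]
      nlinarith [ih4]

/-- The quadratic form of a strictly upper triangular array of coefficients. -/
def upperForm {p : ℕ} (c : Fin p → Fin p → ℝ) (σ : Fin p → ℝ) : ℝ :=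
  ∑ i, ∑ j, if i < j then c i j * (σ i * σ j) else 0

lemma upperForm_succ {p : ℕ} (c : Fin (p + 1) → Fin (p + 1) → ℝ) (σ : Fin (p + 1) → ℝ) :
    upperForm c σ = σ 0 * (∑ j : Fin p, c 0 j.succ * σ j.succ) +
      upperForm (fun i j => c i.succ j.succ) fun i => σ i.succ := by
  simp only [upperForm, Fin.sum_univ_succ, Fin.succ_lt_succ_iff, Fin.succ_pos, if_true,
    if_false, Fin.not_lt_zero, zero_add, Finset.mul_sum]
  congr 1
  exact Finset.sum_congr rfl fun j _ => by ring

/-- Bonami's inequality for a homogeneous Rademacher chaos of degree two. -/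
lemma sum_quadratic_chaos_pow_four_le {p : ℕ} (c : Fin p → Fin p → ℝ) :
    ∑ s : Fin p → Bool, upperForm c (fun i => boolSign (s i)) ^ 4 ≤
      2 ^ p * (81 * (∑ i, ∑ j, if i < j then c i j ^ 2 else 0) ^ 2) := by
  induction p with
  | zero => simp [upperForm]
  | succ p ih =>
    have ih4 := ih fun i j => c i.succ j.succ
    obtain ⟨-, hL4⟩ := sum_linear_chaos_pow_four_le fun j : Fin p => c 0 j.succ
    have hsq : ∑ i, ∑ j, (if i < j then c i j ^ 2 else 0) = ∑ j : Fin p, c 0 j.succ ^ 2 +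
        ∑ i : Fin p, ∑ j : Fin p, if i < j then c i.succ j.succ ^ 2 else 0 := by
      simp [Fin.sum_univ_succ]
    rw [hsq]
    simp only [sum_bool_cons, upperForm_succ, Fin.cons_zero, Fin.cons_succ]
    set L : (Fin p → Bool) → ℝ := fun s => ∑ j : Fin p, c 0 j.succ * boolSign (s j)
    set Q : (Fin p → Bool) → ℝ := fun s =>
      upperForm (fun i j => c (Fin.succ i) (Fin.succ j)) fun i => boolSign (s i)
    set l : ℝ := ∑ j : Fin p, c 0 j.succ ^ 2
    set q : ℝ := ∑ i : Fin p, ∑ j : Fin p, if i < j then c i.succ j.succ ^ 2 else 0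
    have hl : 0 ≤ l := Finset.sum_nonneg fun i _ => sq_nonneg _
    have hq : 0 ≤ q := Finset.sum_nonneg fun i _ => Finset.sum_nonneg fun j _ => by
      split_ifs <;> positivity
    have e4 : ∀ s, (boolSign true * L s + Q s) ^ 4 + (boolSign false * L s + Q s) ^ 4 =
        2 * L s ^ 4 + (12 * (L s ^ 2 * Q s ^ 2) + 2 * Q s ^ 4) := fun s => by
      simp [boolSign]; ring
    refine (Finset.sum_congr rfl fun s _ => e4 s).trans_le ?_
    rw [Finset.sum_add_distrib, Finset.sum_add_distrib, ← Finset.mul_sum, ← Finset.mul_sum,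
      ← Finset.mul_sum]
    have hL4' : ∑ s, L s ^ 4 ≤ 2 ^ p * (3 * l ^ 2) := hL4
    have hQ4 : ∑ s, Q s ^ 4 ≤ 2 ^ p * (81 * q ^ 2) := ih4
    -- Cauchy–Schwarz; 16 rounds up √(3 · 81). The induction closes since 12 · 16 is below 4 · 81,
    -- the coefficient of lq in 2 · 81 (l + q)².
    have hLQ : ∑ s, L s ^ 2 * Q s ^ 2 ≤ 2 ^ p * (16 * (l * q)) := by
      refine abs_le_of_sq_le_sq' ?_ (by positivity) |>.2
      refine (Finset.sum_mul_sq_le_sq_mul_sq _ _ _).trans ?_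
      simp only [← pow_mul, Nat.reduceMul]
      have h4 : 0 ≤ ∑ s, Q s ^ 4 := Finset.sum_nonneg fun s _ => by positivity
      calc (∑ s, L s ^ 4) * ∑ s, Q s ^ 4 ≤ (2 ^ p * (3 * l ^ 2)) * (2 ^ p * (81 * q ^ 2)) :=
            mul_le_mul hL4' hQ4 h4 (by positivity)
        _ ≤ (2 ^ p * (16 * (l * q))) ^ 2 := by
            have : 0 ≤ (2 ^ p * (l * q)) ^ 2 := by positivity
            nlinarith
    have h2 : (0 : ℝ) ≤ 2 ^ p * (l * q) := by positivity
    have h3 : (0 : ℝ) ≤ 2 ^ p * l ^ 2 := by positivity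
    rw [pow_succ (2 : ℝ) p]
    nlinarith

/-! ### The features of a partially observed vector -/

/-- The products of pairs of coordinates within the band. -/
def bandFeature (p m : ℕ) (y : Fin p → ℝ) (x : bandPairs p m) : ℝ := y x.1.1 * y x.1.2

lemma mem_bandPairs {p m : ℕ} {x : Fin p × Fin p} :
    x ∈ bandPairs p m ↔ x.1 < x.2 ∧ (x.2 : ℕ) < (x.1 : ℕ) + m := by
  simp [bandPairs]

lemma card_filter_val_mem_Ico_le (p A m : ℕ) :
    (Finset.univ.filter fun l : Fin p => A ≤ (l : ℕ) ∧ (l : ℕ) < A + m).card ≤ m := by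
  calc _ = ((Finset.univ.filter fun l : Fin p => A ≤ (l : ℕ) ∧ (l : ℕ) < A + m).map
        Fin.valEmbedding).card := (Finset.card_map _).symm
    _ ≤ (Finset.Ico A (A + m)).card := by
        refine Finset.card_le_card fun t ht => ?_
        simp only [Finset.mem_map, Finset.mem_filter, Finset.mem_univ, true_and,
          Fin.valEmbedding_apply] at ht
        obtain ⟨l, hl, rfl⟩ := ht
        exact Finset.mem_Ico.2 hl
    _ = m := by simp

lemma card_bandPairs_fst_le (p m : ℕ) (i : Fin p) :
    ((bandPairs p m).filter fun x => x.1 = i).card ≤ m := by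
  refine le_trans ?_ (card_filter_val_mem_Ico_le p i m)
  refine Finset.card_le_card_of_injOn Prod.snd (fun x hx => ?_) fun x hx x' hx' hxx => ?_
  · obtain ⟨hxm, rfl⟩ := Finset.mem_filter.1 hx
    rw [mem_bandPairs] at hxm
    simp only [Finset.coe_filter, Finset.mem_univ, true_and, Set.mem_ofPred_eq]
    omega
  · exact Prod.ext ((Finset.mem_filter.1 hx).2.trans (Finset.mem_filter.1 hx').2.symm) hxx

lemma card_bandPairs_snd_le (p m : ℕ) (j : Fin p) :
    ((bandPairs p m).filter fun x => x.2 = j).card ≤ m := by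
  refine le_trans ?_ (card_filter_val_mem_Ico_le p (j + 1 - m) m)
  refine Finset.card_le_card_of_injOn Prod.fst (fun x hx => ?_) fun x hx x' hx' hxx => ?_
  · obtain ⟨hxm, rfl⟩ := Finset.mem_filter.1 hx
    rw [mem_bandPairs] at hxm
    simp only [Finset.coe_filter, Finset.mem_univ, true_and, Set.mem_ofPred_eq]
    omega
  · exact Prod.ext hxx ((Finset.mem_filter.1 hx).2.trans (Finset.mem_filter.1 hx').2.symm)

/-- Two pairs have a common coordinate. -/
def Touch {p : ℕ} (x x' : Fin p × Fin p) : Prop :=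
  x'.1 = x.1 ∨ x'.1 = x.2 ∨ x'.2 = x.1 ∨ x'.2 = x.2

instance {p : ℕ} (x x' : Fin p × Fin p) : Decidable (Touch x x') := by
  unfold Touch; infer_instance

/-- A common index can occur in four ways, each leaving at most m choices for the other index. -/
lemma card_touch_le (p m : ℕ) (x : Fin p × Fin p) :
    ((bandPairs p m).filter fun x' => Touch x x').card ≤ 4 * m := by
  have hsub : ((bandPairs p m).filter fun x' => Touch x x') ⊆
      (((bandPairs p m).filter fun x' => x'.1 = x.1) ∪
        ((bandPairs p m).filter fun x' => x'.1 = x.2)) ∪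
      (((bandPairs p m).filter fun x' => x'.2 = x.1) ∪
        ((bandPairs p m).filter fun x' => x'.2 = x.2)) := by
    intro x' hx'
    simp only [Finset.mem_filter, Finset.mem_union] at hx' ⊢
    unfold Touch at hx'
    tauto
  have h1 := card_bandPairs_fst_le p m x.1
  have h2 := card_bandPairs_fst_le p m x.2
  have h3 := card_bandPairs_snd_le p m x.1
  have h4 := card_bandPairs_snd_le p m x.2
  refine (Finset.card_le_card hsub).trans ((Finset.card_union_le _ _).trans ?_)
  have h5 := Finset.card_union_le ((bandPairs p m).filter fun x' => x'.1 = x.1)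
    ((bandPairs p m).filter fun x' => x'.1 = x.2)
  have h6 := Finset.card_union_le ((bandPairs p m).filter fun x' => x'.2 = x.1)
    ((bandPairs p m).filter fun x' => x'.2 = x.2)
  omega

lemma hasMoments_bandFeature {p m : ℕ} (a : unitInterval) (S : Matrix (Fin p) (Fin p) ℝ)
    (x : bandPairs p m) : HasMoments (fun y => bandFeature p m y x) (missingLaw a S) :=
  (hasMoments_missingLaw a S _).mul (hasMoments_missingLaw a S _)

/-! ### Feature moments under the null hypothesis. -/

section Null

variable {p m : ℕ} (a : unitInterval)

lemma integral_bandFeature_one (x : bandPairs p m) :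
    ∫ y, bandFeature p m y x ∂(missingLaw a (1 : Matrix (Fin p) (Fin p) ℝ)) = 0 := by
  have hx := (mem_bandPairs.1 x.2).1.ne
  simp only [bandFeature]
  rw [integral_missingLaw_mul a Matrix.PosSemidef.one hx, Matrix.one_apply_ne hx, mul_zero]

lemma integral_bandFeature_mul_one (x x' : bandPairs p m) :
    ∫ y, bandFeature p m y x * bandFeature p m y x'
      ∂(missingLaw a (1 : Matrix (Fin p) (Fin p) ℝ)) = if x = x' then (a : ℝ) ^ 2 else 0 := by
  have hx := (mem_bandPairs.1 x.2).1
  have hx' := (mem_bandPairs.1 x'.2).1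
  simp only [bandFeature]
  rw [integral_missingLaw_mul_four a Matrix.PosSemidef.one]
  split_ifs with h
  · subst h
    have : ({x.1.1, x.1.2, x.1.1, x.1.2} : Finset (Fin p)) = {x.1.1, x.1.2} := by
      ext t; simp
    rw [this, Finset.card_pair hx.ne, Matrix.one_apply_ne hx.ne]
    simp
  · rw [Matrix.one_apply_ne hx.ne]
    have h1 : ¬ (x.1.1 = x'.1.1 ∧ x.1.2 = x'.1.2) := fun hh => h (Subtype.ext (Prod.ext hh.1 hh.2))
    have h2 : ¬ (x.1.1 = x'.1.2 ∧ x.1.2 = x'.1.1) := fun hh => by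
      rw [hh.1, hh.2] at hx
      exact lt_asymm hx hx'
    simp only [Matrix.one_apply, mul_ite, mul_one, mul_zero, ← ite_and,
      show ¬ (x.1.2 = x'.1.1 ∧ x.1.1 = x'.1.2) from fun hh => h2 hh.symm,
      show ¬ (x.1.2 = x'.1.2 ∧ x.1.1 = x'.1.1) from fun hh => h1 hh.symm]
    simp

lemma integral_prod_pow_coordLaw (e : Fin p → ℕ) :
    ∫ y, ∏ t, y t ^ e t ∂(missingLaw a (1 : Matrix (Fin p) (Fin p) ℝ)) =
      ∏ t, ∫ y, y ^ e t ∂(coordLaw a) := by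
  rw [missingLaw_one, integral_fintype_prod_eq_prod (f := fun t y => y ^ e t)]

/-- Mixed second moments of the squared features under the null hypothesis. -/
lemma integral_bandFeature_sq_mul_sq (x x' : bandPairs p m) :
    ∫ y, bandFeature p m y x ^ 2 * bandFeature p m y x' ^ 2
      ∂(missingLaw a (1 : Matrix (Fin p) (Fin p) ℝ)) =
      if x = x' then 9 * (a : ℝ) ^ 2 else if Touch x.1 x'.1 then 3 * (a : ℝ) ^ 3
        else (a : ℝ) ^ 4 := by
  obtain ⟨⟨i, j⟩, hx⟩ := x
  obtain ⟨⟨k, l⟩, hx'⟩ := x'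
  have hij : i < j := (mem_bandPairs.1 hx).1
  have hkl : k < l := (mem_bandPairs.1 hx').1
  set e : Fin p → ℕ := fun t => (if t = i then 2 else 0) + (if t = j then 2 else 0) +
    ((if t = k then 2 else 0) + (if t = l then 2 else 0)) with he
  have h1 : ∀ y : Fin p → ℝ, bandFeature p m y ⟨(i, j), hx⟩ ^ 2 *
      bandFeature p m y ⟨(k, l), hx'⟩ ^ 2 = ∏ t, y t ^ e t := by
    intro y
    simp only [he, pow_add, Finset.prod_mul_distrib, pow_ite, pow_zero, Finset.prod_ite_eq',
      Finset.mem_univ, if_true, bandFeature]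
    ring
  simp only [h1]
  rw [integral_prod_pow_coordLaw]
  have h2 : ∀ T : Finset (Fin p), (∀ t, t ∉ T → e t = 0) →
      ∏ t, ∫ y, y ^ e t ∂(coordLaw a) = ∏ t ∈ T, ∫ y, y ^ e t ∂(coordLaw a) := by
    intro T hT
    refine (Finset.prod_subset (Finset.subset_univ T) fun t _ ht => ?_).symm
    simp [hT t ht]
  have hij' := hij.ne
  have hkl' := hkl.ne
  have m2 := integral_sq_coordLaw a
  have m4 := integral_pow_four_coordLaw a
  split_ifs with hxx ht
  · obtain ⟨rfl, rfl⟩ : i = k ∧ j = l := by simpa using hxx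
    rw [h2 {i, j} fun t ht => by simp at ht; simp [he, ht], Finset.prod_pair hij']
    simp [he, hij', hij'.symm, m4]
    ring
  · have hne : ¬ (i = k ∧ j = l) := by simpa using hxx
    rcases ht with h | h | h | h <;> simp only at h
    · subst h
      have hjl : j ≠ l := fun h => hne ⟨rfl, h⟩
      rw [h2 {k, j, l} fun t ht => by simp at ht; simp [he, ht],
        Finset.prod_insert (by simp [hij', hkl']), Finset.prod_pair hjl]
      simp [he, hij', hij'.symm, hkl', hkl'.symm, hjl, hjl.symm, m4, m2]
      ring
    · subst h
      have hil : i ≠ l := (hij.trans hkl).ne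
      rw [h2 {i, k, l} fun t ht => by simp at ht; simp [he, ht],
        Finset.prod_insert (by simp [hij', hil]), Finset.prod_pair hkl']
      simp [he, hij', hij'.symm, hkl', hkl'.symm, hil, hil.symm, m4, m2]
      ring
    · subst h
      have hjk : j ≠ k := (hkl.trans hij).ne'
      rw [h2 {l, j, k} fun t ht => by simp at ht; simp [he, ht],
        Finset.prod_insert (by simp [hij', hkl'.symm]), Finset.prod_pair hjk]
      simp [he, hij', hij'.symm, hkl', hkl'.symm, hjk, hjk.symm, m4, m2]
      ring
    · subst h
      have hik : i ≠ k := fun h => hne ⟨h, rfl⟩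
      rw [h2 {i, k, l} fun t ht => by simp at ht; simp [he, ht],
        Finset.prod_insert (by simp [hij', hik]), Finset.prod_pair hkl']
      simp [he, hij', hij'.symm, hkl', hkl'.symm, hik, hik.symm, m4, m2]
      ring
  · simp only [Touch, not_or] at ht
    obtain ⟨hki, hkj, hli, hlj⟩ := ht
    rw [h2 {i, j, k, l} fun t ht => by simp at ht; simp [he, ht],
      Finset.prod_insert (by simp [hij', Ne.symm hki, Ne.symm hli]),
      Finset.prod_insert (by simp [Ne.symm hkj, Ne.symm hlj]), Finset.prod_pair hkl']
    simp [he, hij', hij'.symm, hkl', hkl'.symm, hki, hkj, hli, hlj, Ne.symm hki, Ne.symm hli,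
      Ne.symm hkj, Ne.symm hlj, m2]
    ring

lemma sum_indicator_touch_le (x : bandPairs p m) :
    ∑ x' : bandPairs p m, (if Touch x.1 x'.1 then (1 : ℝ) else 0) ≤ 4 * m := by
  rw [Finset.sum_coe_sort (bandPairs p m) fun x' => if Touch x.1 x' then (1 : ℝ) else 0,
    Finset.sum_boole]
  exact_mod_cast card_touch_le p m x.1

/-- Squared features of disjoint pairs are uncorrelated: their a⁴ cancels against the squared mean
a⁴D². Only the D diagonal terms and at most 4mD touching ones survive. -/
lemma integral_bandFeature_norm_dev_le :
    ∫ y, (bandFeature p m y ⬝ᵥ bandFeature p m y - (a : ℝ) ^ 2 * Fintype.card (bandPairs p m)) ^ 2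
      ∂(missingLaw a (1 : Matrix (Fin p) (Fin p) ℝ)) ≤
      (9 * (a : ℝ) ^ 2 + 12 * (a : ℝ) ^ 3 * m) * Fintype.card (bandPairs p m) := by
  set μ := missingLaw a (1 : Matrix (Fin p) (Fin p) ℝ)
  set D : ℝ := (Fintype.card (bandPairs p m) : ℝ) with hD
  have hm := hasMoments_bandFeature (m := m) a (1 : Matrix (Fin p) (Fin p) ℝ)
  have ha := a.2.1
  have hhh : HasMoments (fun z => bandFeature p m z ⬝ᵥ bandFeature p m z) μ :=
    HasMoments.dotProduct hm hm
  have h1 : ∫ y, (bandFeature p m y ⬝ᵥ bandFeature p m y) ^ 2 ∂μ =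
      ∑ x : bandPairs p m, ∑ x' : bandPairs p m, (if x = x' then 9 * (a : ℝ) ^ 2
        else if Touch x.1 x'.1 then 3 * (a : ℝ) ^ 3 else (a : ℝ) ^ 4) := by
    have h2 : ∀ y, (bandFeature p m y ⬝ᵥ bandFeature p m y) ^ 2 =
        ((fun _ => (1 : ℝ)) ⬝ᵥ fun x => bandFeature p m y x ^ 2) ^ 2 := by
      intro y
      simp [dotProduct, sq]
    simp only [h2]
    rw [integral_dotProduct_sq (h := fun y x => bandFeature p m y x ^ 2) fun x => (hm x).pow 2]
    simp only [one_mul, integral_bandFeature_sq_mul_sq]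
  have h3 : ∀ y, (bandFeature p m y ⬝ᵥ bandFeature p m y - (a : ℝ) ^ 2 * D) ^ 2 =
      (bandFeature p m y ⬝ᵥ bandFeature p m y) ^ 2 - (2 * ((a : ℝ) ^ 2 * D) *
        (bandFeature p m y ⬝ᵥ bandFeature p m y) - (a : ℝ) ^ 4 * D ^ 2) := fun y => by ring
  simp only [h3]
  rw [integral_sub (hhh.pow 2).integrable ((hhh.const_mul _).sub (HasMoments.const _)).integrable,
    integral_sub (hhh.const_mul _).integrable (integrable_const _), integral_const_mul,
    integral_dotProduct_self hm (integral_bandFeature_mul_one a), h1]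
  have h4 : ∀ x : bandPairs p m, ∑ x' : bandPairs p m, (if x = x' then 9 * (a : ℝ) ^ 2
      else if Touch x.1 x'.1 then 3 * (a : ℝ) ^ 3 else (a : ℝ) ^ 4) ≤
      9 * (a : ℝ) ^ 2 + 3 * (a : ℝ) ^ 3 * (4 * m) + (a : ℝ) ^ 4 * D := by
    intro x
    calc _ ≤ ∑ x' : bandPairs p m, ((if x = x' then 9 * (a : ℝ) ^ 2 else 0) +
          3 * (a : ℝ) ^ 3 * (if Touch x.1 x'.1 then 1 else 0) + (a : ℝ) ^ 4) := by
          refine Finset.sum_le_sum fun x' _ => ?_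
          have := pow_nonneg ha 2
          have := pow_nonneg ha 3
          have := pow_nonneg ha 4
          split_ifs <;> linarith
      _ ≤ _ := by
          rw [Finset.sum_add_distrib, Finset.sum_add_distrib, ← Finset.mul_sum]
          have := sum_indicator_touch_le x
          have := pow_nonneg ha 3
          simp only [Finset.sum_ite_eq, Finset.mem_univ, if_true, Finset.sum_const,
            Finset.card_univ, nsmul_eq_mul, ← hD]
          nlinarith
  have h5 := Finset.sum_le_sum fun x (_ : x ∈ Finset.univ) => h4 x
  rw [Finset.sum_const, Finset.card_univ, nsmul_eq_mul, ← hD] at h5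
  simp only [integral_const, probReal_univ, one_smul, ← hD]
  linarith

/-- Flipping the signs of coordinates preserves the null law. -/
lemma measurePreserving_boolSign_mul (s : Fin p → Bool) :
    MeasurePreserving (fun (y : Fin p → ℝ) i => boolSign (s i) * y i)
      (missingLaw a (1 : Matrix (Fin p) (Fin p) ℝ)) (missingLaw a (1 : Matrix (Fin p) (Fin p) ℝ)) := by
  rw [missingLaw_one]
  refine measurePreserving_pi (fun _ => coordLaw a) (fun _ => coordLaw a)
    (f := fun i y => boolSign (s i) * y) fun i => ?_
  cases h : s i
  · simpa [boolSign, h] using measurePreserving_neg_coordLaw a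
  · simpa [boolSign, h] using! MeasurePreserving.id (coordLaw a)

lemma bandFeature_dotProduct_eq_upperForm (s : Fin p → ℝ) (y z : Fin p → ℝ) :
    bandFeature p m (fun i => s i * y i) ⬝ᵥ bandFeature p m z =
      upperForm (fun i j => if (i, j) ∈ bandPairs p m then y i * y j * (z i * z j) else 0) s := by
  simp only [dotProduct, bandFeature]
  rw [Finset.sum_coe_sort (bandPairs p m) fun x => s x.1 * y x.1 * (s x.2 * y x.2) * (z x.1 * z x.2),
    upperForm, ← Fintype.sum_prod_type', ← Finset.sum_subset (Finset.subset_univ (bandPairs p m))]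
  · refine Finset.sum_congr rfl fun x hx => ?_
    rw [if_pos (mem_bandPairs.1 hx).1, if_pos hx]
    ring
  · intro x _ hx
    simp [hx]

/-- All 2^p sign versions share the same integral C, so an upper bound for their pointwise average
bounds C. -/
lemma le_integral_of_sum_signs_le {Ω : Type*} [MeasurableSpace Ω] {P : Measure Ω} {p : ℕ}
    {G : (Fin p → Bool) → Ω → ℝ} (hG : ∀ s, HasMoments (G s) P) {C : ℝ}
    (hC : ∀ s, ∫ ω, G s ω ∂P = C) {R : Ω → ℝ} (hR : HasMoments R P)
    (hle : ∀ ω, ∑ s, G s ω ≤ 2 ^ p * R ω) : C ≤ ∫ ω, R ω ∂P := by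
  have h1 : ∫ ω, ∑ s, G s ω ∂P = 2 ^ p * C := by
    rw [integral_finsetSum _ fun s _ => (hG s).integrable]
    simp [hC]
  have h2 := integral_mono (HasMoments.sum _ fun s _ => hG s).integrable
    (hR.const_mul (2 ^ p)).integrable hle
  rw [h1, integral_const_mul] at h2
  exact le_of_mul_le_mul_left h2 (by positivity)

/-- For fixed y and z, the inner product is a homogeneous chaos of degree two in the signs, so
Bonami applies with 81 = 3⁴. -/
lemma sum_signs_bandFeature_pow_four_le (y z : Fin p → ℝ) :
    ∑ s : Fin p → Bool,
        (bandFeature p m (fun i => boolSign (s i) * y i) ⬝ᵥ bandFeature p m z) ^ 4 ≤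
      2 ^ p * (81 *
        ((fun x => bandFeature p m z x ^ 2) ⬝ᵥ fun x => bandFeature p m y x ^ 2) ^ 2) := by
  set c : Fin p → Fin p → ℝ := fun i j =>
    if (i, j) ∈ bandPairs p m then y i * y j * (z i * z j) else 0 with hc
  have h1 : ∑ i, ∑ j, (if i < j then c i j ^ 2 else 0) =
      (fun x => bandFeature p m z x ^ 2) ⬝ᵥ fun x => bandFeature p m y x ^ 2 := by
    simp only [dotProduct, bandFeature]
    rw [Finset.sum_coe_sort (bandPairs p m) fun x => (z x.1 * z x.2) ^ 2 * (y x.1 * y x.2) ^ 2,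
      ← Fintype.sum_prod_type', ← Finset.sum_subset (Finset.subset_univ (bandPairs p m))]
    · refine Finset.sum_congr rfl fun x hx => ?_
      rw [if_pos (mem_bandPairs.1 hx).1, hc]
      simp only [hx, if_true]
      ring
    · intro x _ hx
      simp [hc, hx]
  rw [← h1, Finset.sum_congr rfl fun s _ => by
    rw [bandFeature_dotProduct_eq_upperForm (fun i => boolSign (s i)) y z]]
  exact sum_quadratic_chaos_pow_four_le c

lemma integral_comp_boolSign_mul {F : (Fin p → ℝ) → ℝ}
    (hF : HasMoments F (missingLaw a (1 : Matrix (Fin p) (Fin p) ℝ))) (s : Fin p → Bool) :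
    ∫ y, F (fun i => boolSign (s i) * y i) ∂(missingLaw a (1 : Matrix (Fin p) (Fin p) ℝ)) =
      ∫ y, F y ∂(missingLaw a (1 : Matrix (Fin p) (Fin p) ℝ)) := by
  have hmp := measurePreserving_boolSign_mul a s
  have h := integral_map hmp.measurable.aemeasurable (f := F)
    (by rw [hmp.map_eq]; exact hF.aestronglyMeasurable)
  rw [hmp.map_eq] at h
  exact h.symm

/-- Averaging over signs bounds the mean of `F` by the mean of a pointwise bound for the average. -/
lemma integral_le_of_sum_boolSign_le {F R : (Fin p → ℝ) → ℝ}
    (hF : HasMoments F (missingLaw a (1 : Matrix (Fin p) (Fin p) ℝ)))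
    (hR : HasMoments R (missingLaw a (1 : Matrix (Fin p) (Fin p) ℝ)))
    (h : ∀ y, ∑ s : Fin p → Bool, F (fun i => boolSign (s i) * y i) ≤ 2 ^ p * R y) :
    ∫ y, F y ∂(missingLaw a (1 : Matrix (Fin p) (Fin p) ℝ)) ≤
      ∫ y, R y ∂(missingLaw a (1 : Matrix (Fin p) (Fin p) ℝ)) :=
  le_integral_of_sum_signs_le (G := fun s y => F fun i => boolSign (s i) * y i)
    (fun s => hF.comp (measurePreserving_boolSign_mul a s)) (integral_comp_boolSign_mul a hF) hR h

lemma hasMoments_bandFeature_dotProduct (z : Fin p → ℝ) :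
    HasMoments (fun y => bandFeature p m y ⬝ᵥ bandFeature p m z)
      (missingLaw a (1 : Matrix (Fin p) (Fin p) ℝ)) :=
  HasMoments.dotProduct (hasMoments_bandFeature a 1) fun _ => HasMoments.const _

lemma hasMoments_bandFeature_sq_dotProduct (z : Fin p → ℝ) :
    HasMoments (fun y => (fun x => bandFeature p m z x ^ 2) ⬝ᵥ
      fun x => bandFeature p m y x ^ 2) (missingLaw a (1 : Matrix (Fin p) (Fin p) ℝ)) :=
  HasMoments.dotProduct (f := fun _ x => bandFeature p m z x ^ 2)
    (g := fun y x => bandFeature p m y x ^ 2) (fun _ => HasMoments.const _)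
    fun x => (hasMoments_bandFeature a 1 x).pow 2

lemma integral_bandFeature_pow_four_le (z : Fin p → ℝ) :
    ∫ y, (bandFeature p m y ⬝ᵥ bandFeature p m z) ^ 4
        ∂(missingLaw a (1 : Matrix (Fin p) (Fin p) ℝ)) ≤
      ∫ y, 81 * ((fun x => bandFeature p m z x ^ 2) ⬝ᵥ fun x => bandFeature p m y x ^ 2) ^ 2
        ∂(missingLaw a (1 : Matrix (Fin p) (Fin p) ℝ)) := by
  have h1 := (hasMoments_bandFeature_dotProduct (m := m) a z).pow 4
  have h2 := ((hasMoments_bandFeature_sq_dotProduct (m := m) a z).pow 2).const_mul 81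
  have h3 : ∀ y : Fin p → ℝ, _ := fun y => sum_signs_bandFeature_pow_four_le (m := m) y z
  exact integral_le_of_sum_boolSign_le a h1 h2 h3

/-- After Bonami the bound is a quadratic form in squared features of both observations; integrating
over y and then z gives the matrix W of mixed second moments twice, that is ∑ W². This avoids
enumerating quadruples of band pairs. -/
lemma integral_integral_bandFeature_pow_four_le :
    ∫ z, ∫ y, (bandFeature p m y ⬝ᵥ bandFeature p m z) ^ 4
      ∂(missingLaw a (1 : Matrix (Fin p) (Fin p) ℝ)) ∂(missingLaw a (1 : Matrix (Fin p) (Fin p) ℝ)) ≤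
      81 * ((81 * (a : ℝ) ^ 4 + 36 * (a : ℝ) ^ 6 * m) * Fintype.card (bandPairs p m) +
        (a : ℝ) ^ 8 * Fintype.card (bandPairs p m) ^ 2) := by
  set μ := missingLaw a (1 : Matrix (Fin p) (Fin p) ℝ) with hμ
  set D : ℝ := (Fintype.card (bandPairs p m) : ℝ) with hD
  have hm := hasMoments_bandFeature (m := m) a (1 : Matrix (Fin p) (Fin p) ℝ)
  have ha := a.2.1
  set W : bandPairs p m → bandPairs p m → ℝ := fun x x' => if x = x' then 9 * (a : ℝ) ^ 2
    else if Touch x.1 x'.1 then 3 * (a : ℝ) ^ 3 else (a : ℝ) ^ 4 with hW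
  have h1 := fun z : Fin p → ℝ => integral_bandFeature_pow_four_le (m := m) a z
  have h2 : ∀ z, ∫ y, ((fun x => bandFeature p m z x ^ 2) ⬝ᵥ
      fun x => bandFeature p m y x ^ 2) ^ 2 ∂μ =
      ∑ x, ∑ x', bandFeature p m z x ^ 2 * bandFeature p m z x' ^ 2 * W x x' := by
    intro z
    rw [integral_dotProduct_sq (h := fun y x => bandFeature p m y x ^ 2) fun x => (hm x).pow 2]
    simp only [integral_bandFeature_sq_mul_sq, hW]
  have hi : ∀ x x', HasMoments (fun z => bandFeature p m z x ^ 2 * bandFeature p m z x' ^ 2 * W x x') μ :=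
    fun x x' => (((hm x).pow 2).mul ((hm x').pow 2)).mul (HasMoments.const _)
  have h3 : ∫ z, ∑ x, ∑ x', bandFeature p m z x ^ 2 * bandFeature p m z x' ^ 2 * W x x' ∂μ =
      ∑ x, ∑ x', W x x' ^ 2 := by
    rw [integral_finsetSum _ fun x _ => (HasMoments.sum _ fun x' _ => hi x x').integrable]
    refine Finset.sum_congr rfl fun x _ => ?_
    rw [integral_finsetSum _ fun x' _ => (hi x x').integrable]
    refine Finset.sum_congr rfl fun x' _ => ?_
    rw [integral_mul_const, hμ, integral_bandFeature_sq_mul_sq]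
    exact (sq (W x x')).symm
  have h4 : ∀ x, ∑ x', W x x' ^ 2 ≤
      81 * (a : ℝ) ^ 4 + 9 * (a : ℝ) ^ 6 * (4 * m) + (a : ℝ) ^ 8 * D := by
    intro x
    calc _ ≤ ∑ x' : bandPairs p m, ((if x = x' then 81 * (a : ℝ) ^ 4 else 0) +
          9 * (a : ℝ) ^ 6 * (if Touch x.1 x'.1 then 1 else 0) + (a : ℝ) ^ 8) := by
          refine Finset.sum_le_sum fun x' _ => ?_
          have := pow_nonneg ha 4
          have := pow_nonneg ha 6
          have := pow_nonneg ha 8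
          simp only [hW]
          split_ifs <;> nlinarith
      _ ≤ _ := by
          rw [Finset.sum_add_distrib, Finset.sum_add_distrib, ← Finset.mul_sum]
          have := sum_indicator_touch_le x
          have := pow_nonneg ha 6
          simp only [Finset.sum_ite_eq, Finset.mem_univ, if_true, Finset.sum_const,
            Finset.card_univ, nsmul_eq_mul, ← hD]
          nlinarith
  have h5 := Finset.sum_le_sum fun x (_ : x ∈ Finset.univ) => h4 x
  rw [Finset.sum_const, Finset.card_univ, nsmul_eq_mul, ← hD] at h5
  calc _ ≤ ∫ z, 81 * ∑ x, ∑ x', bandFeature p m z x ^ 2 * bandFeature p m z x' ^ 2 * W x x' ∂μ := by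
        refine integral_mono_of_nonneg (Eventually.of_forall fun z => integral_nonneg fun y => by
          positivity) ((HasMoments.sum _ fun x _ => HasMoments.sum _ fun x' _ =>
            hi x x').const_mul _).integrable (Eventually.of_forall fun z => ?_)
        exact (h1 z).trans_eq (by rw [integral_const_mul, h2])
    _ ≤ _ := by
        rw [integral_const_mul, h3]
        linarith

end Null

/-! ### Mean and variance of the test statistic -/

section MeanVariance

variable {E : Type*} [MeasurableSpace E] {μ : Measure E} [IsProbabilityMeasure μ]
  {B : Type*} [Fintype B] {h : E → B → ℝ}

lemma integral_pairSum (hm : ∀ x, HasMoments (fun z => h z x) μ)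
    (h0 : ∀ x, ∫ z, h z x ∂μ = 0) (n : ℕ) :
    ∫ y, pairSum h y ∂(Measure.pi fun _ : Fin n => μ) = 0 := by
  induction n with
  | zero => simp [pairSum]
  | succ n ih =>
    rw [integral_pi_finCons μ (HasMoments.pairSum hm _).integrable, ← ih]
    refine integral_congr_ae (Eventually.of_forall fun y => ?_)
    have hd : HasMoments (fun z => sumVec h y ⬝ᵥ h z) μ :=
      HasMoments.dotProduct (fun x => HasMoments.const _) hm
    simp only [pairSum_cons]
    rw [integral_add (integrable_const _) (hd.const_mul 2).integrable, integral_const_mul,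
      integral_dotProduct_left hm]
    simp [h0, dotProduct]

-- Hoeffding's decomposition: degenerate part, linear part and constant.
omit [MeasurableSpace E] in
lemma pairSum_eq_of_eq_add {g : E → B → ℝ} {v : B → ℝ} (hg : ∀ z x, h z x = g z x + v x) {n : ℕ}
    (y : Fin n → E) :
    pairSum h y = pairSum g y + sumVec g y ⬝ᵥ (fun x => 2 * ((n : ℝ) - 1) * v x) +
      n * (n - 1) * (v ⬝ᵥ v) := by
  have h1 : ∀ z, h z = g z + v := fun z => funext (hg z)
  have h2 : sumVec h y = sumVec g y + (n : ℝ) • v := by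
    ext x
    simp [sumVec, hg, Finset.sum_add_distrib]
  have h3 : ∑ k, g (y k) ⬝ᵥ v = sumVec g y ⬝ᵥ v := by
    rw [← sum_dotProduct]
    congr 1
    ext x
    simp [sumVec]
  have h4 : (fun x => 2 * ((n : ℝ) - 1) * v x) = (2 * ((n : ℝ) - 1)) • v := rfl
  rw [pairSum_eq, pairSum_eq, h2, h4]
  simp only [h1, add_dotProduct, dotProduct_add, smul_dotProduct, dotProduct_smul,
    Finset.sum_add_distrib, dotProduct_comm v, h3, smul_eq_mul]
  simp only [Finset.sum_const, Finset.card_univ, Fintype.card_fin, nsmul_eq_mul]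
  ring

end MeanVariance

section TestStat

variable {p : ℕ} (m : ℕ) (a : unitInterval) (S : Matrix (Fin p) (Fin p) ℝ)

/-- The means of the features. -/
def bandMean (x : bandPairs p m) : ℝ := (a : ℝ) ^ 2 * S x.1.1 x.1.2

/-- The covariances of the features. -/
def bandCov (x x' : bandPairs p m) : ℝ :=
  (a : ℝ) ^ ({x.1.1, x.1.2, x'.1.1, x'.1.2} : Finset (Fin p)).card *
    (S x.1.1 x.1.2 * S x'.1.1 x'.1.2 + S x.1.1 x'.1.1 * S x.1.2 x'.1.2 +
      S x.1.1 x'.1.2 * S x.1.2 x'.1.1) - bandMean m a S x * bandMean m a S x'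

lemma testStat_eq_pairSum {n : ℕ} (y : Fin n → Fin p → ℝ) :
    testStat n p m y =
      1 / ((n : ℝ) * ((n : ℝ) - 1) * (p : ℝ)) * (1 / √(2 * (m : ℝ))) *
        pairSum (bandFeature p m) y := by
  unfold testStat pairSum
  congr 1
  refine Finset.sum_congr rfl fun k _ => Finset.sum_congr rfl fun l _ => ?_
  simp only [dotProduct, bandFeature]
  rw [Finset.sum_coe_sort (bandPairs p m) fun x => y k x.1 * y k x.2 * (y l x.1 * y l x.2)]
  exact Finset.sum_congr rfl fun x _ => by ring

lemma hasMoments_testStat (n : ℕ) : HasMoments (testStat n p m) (sampleLaw n a S) := by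
  have := (HasMoments.pairSum (hasMoments_bandFeature (m := m) a S) n).const_mul
    (1 / ((n : ℝ) * ((n : ℝ) - 1) * (p : ℝ)) * (1 / √(2 * (m : ℝ))))
  simp only [← testStat_eq_pairSum] at this
  exact this

variable {S}

lemma integral_bandFeature (hS : S.PosSemidef) (x : bandPairs p m) :
    ∫ y, bandFeature p m y x ∂(missingLaw a S) = bandMean m a S x :=
  integral_missingLaw_mul a hS (mem_bandPairs.1 x.2).1.ne

lemma integral_bandFeature_sub_mul_sub (hS : S.PosSemidef) (x x' : bandPairs p m) :
    ∫ y, (bandFeature p m y x - bandMean m a S x) * (bandFeature p m y x' - bandMean m a S x')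
      ∂(missingLaw a S) = bandCov m a S x x' := by
  have hm := hasMoments_bandFeature (m := m) a S
  have h1 : ∀ y, (bandFeature p m y x - bandMean m a S x) *
      (bandFeature p m y x' - bandMean m a S x') =
      bandFeature p m y x * bandFeature p m y x' - ((bandMean m a S x * bandFeature p m y x' +
        bandMean m a S x' * bandFeature p m y x) - bandMean m a S x * bandMean m a S x') :=
    fun y => by ring
  simp only [h1]
  rw [integral_sub ((hm x).mul (hm x')).integrable
    ((((hm x').const_mul _).add ((hm x).const_mul _)).sub (HasMoments.const _)).integrable,
    integral_sub (((hm x').const_mul _).add ((hm x).const_mul _)).integrable (integrable_const _),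
    integral_add ((hm x').const_mul _).integrable ((hm x).const_mul _).integrable,
    integral_const_mul, integral_const_mul, integral_bandFeature m a hS, integral_bandFeature m a hS]
  simp only [bandFeature]
  rw [integral_missingLaw_mul_four a hS]
  simp [bandCov]
  ring

lemma integral_pairSum_bandFeature (hS : S.PosSemidef) (n : ℕ) :
    ∫ y, pairSum (bandFeature p m) y ∂(sampleLaw n a S) =
      n * (n - 1) * (bandMean m a S ⬝ᵥ bandMean m a S) ∧
    variance (pairSum (bandFeature p m)) (sampleLaw n a S) =
      2 * n * (n - 1) * ∑ x, ∑ x', bandCov m a S x x' ^ 2 +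
        4 * n * (n - 1) ^ 2 * ∑ x, ∑ x', bandMean m a S x * bandMean m a S x' *
          bandCov m a S x x' := by
  set g : (Fin p → ℝ) → bandPairs p m → ℝ := fun y x => bandFeature p m y x - bandMean m a S x
  set v := bandMean m a S
  set w : bandPairs p m → ℝ := fun x => 2 * ((n : ℝ) - 1) * v x
  have hm := hasMoments_bandFeature (m := m) a S
  have hgm : ∀ x, HasMoments (fun y => g y x) (missingLaw a S) := fun x =>
    (hm x).sub (HasMoments.const _)
  have hg0 : ∀ x, ∫ y, g y x ∂(missingLaw a S) = 0 := fun x => by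
    rw [integral_sub (hm x).integrable (integrable_const _), integral_bandFeature m a hS]
    simp
  have hpair : ∀ y : Fin n → Fin p → ℝ, pairSum (bandFeature p m) y =
      pairSum g y + sumVec g y ⬝ᵥ w + n * (n - 1) * (v ⬝ᵥ v) := fun y =>
    pairSum_eq_of_eq_add (fun z x => by simp [g, v]) y
  have hl : HasMoments (fun y : Fin n → Fin p → ℝ => sumVec g y ⬝ᵥ w) (sampleLaw n a S) :=
    HasMoments.dotProduct (HasMoments.sumVec hgm n) fun _ => HasMoments.const _
  have hp : HasMoments (fun y : Fin n → Fin p → ℝ => pairSum g y) (sampleLaw n a S) :=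
    HasMoments.pairSum hgm n
  have hl0 : ∫ y, sumVec g y ⬝ᵥ w ∂(sampleLaw n a S) = 0 := by
    simp only [dotProduct_comm _ w, sampleLaw]
    rw [integral_dotProduct_left (h := fun y => sumVec g y) (HasMoments.sumVec hgm n)]
    simp [integral_sumVec hgm hg0, dotProduct]
  have hmean : ∫ y, pairSum (bandFeature p m) y ∂(sampleLaw n a S) = n * (n - 1) * (v ⬝ᵥ v) := by
    simp only [hpair]
    rw [integral_add (hp.add hl).integrable (integrable_const _),
      integral_add hp.integrable hl.integrable, hl0, sampleLaw, integral_pairSum hgm hg0]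
    simp
  refine ⟨hmean, ?_⟩
  rw [variance_eq_integral (μ := sampleLaw n a S) (X := pairSum (bandFeature p m))
    (HasMoments.pairSum hm n).aestronglyMeasurable.aemeasurable, hmean]
  simp only [hpair, add_sub_cancel_right]
  rw [sampleLaw, integral_pairSum_add_sq hgm hg0]
  simp only [g, v, integral_bandFeature_sub_mul_sub m a hS, w]
  have : ∀ x x', 2 * ((n : ℝ) - 1) * bandMean m a S x * (2 * ((n : ℝ) - 1) * bandMean m a S x') *
      bandCov m a S x x' = 4 * ((n : ℝ) - 1) ^ 2 *
        (bandMean m a S x * bandMean m a S x' * bandCov m a S x x') := fun x x' => by ring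
  simp only [this, ← Finset.mul_sum]
  ring

lemma integral_testStat (hS : S.PosSemidef) {n : ℕ} (hn : 2 ≤ n) :
    ∫ y, testStat n p m y ∂(sampleLaw n a S) =
      (a : ℝ) ^ 4 / ((p : ℝ) * √(2 * (m : ℝ))) * ∑ x ∈ bandPairs p m, S x.1 x.2 ^ 2 := by
  simp only [testStat_eq_pairSum]
  rw [integral_const_mul, (integral_pairSum_bandFeature m a hS n).1]
  have h1 : bandMean m a S ⬝ᵥ bandMean m a S =
      (a : ℝ) ^ 4 * ∑ x ∈ bandPairs p m, S x.1 x.2 ^ 2 := by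
    simp only [dotProduct, bandMean]
    rw [Finset.sum_coe_sort (bandPairs p m) fun x =>
      (a : ℝ) ^ 2 * S x.1 x.2 * ((a : ℝ) ^ 2 * S x.1 x.2), Finset.mul_sum]
    exact Finset.sum_congr rfl fun x _ => by ring
  rw [h1]
  have hn0 : (n : ℝ) ≠ 0 := by positivity
  have hn1 : (n : ℝ) - 1 ≠ 0 := by
    have : (2 : ℝ) ≤ n := by exact_mod_cast hn
    linarith
  rw [div_mul_div_comm, one_mul]
  rcases eq_or_ne ((p : ℝ) * √(2 * (m : ℝ))) 0 with h0 | h0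
  · rw [mul_assoc, h0]
    simp
  · have hp := left_ne_zero_of_mul h0
    have hq := right_ne_zero_of_mul h0
    field_simp

/-- The degenerate part has variance 2n(n-1) Tr Γ² and the linear part 4n(n-1)² vᵀΓv. Dividing by 2m
n²(n-1)²p² leaves numerators free of n, which are T₁ and T₂. -/
lemma variance_testStat (hS : S.PosSemidef) {n : ℕ} (hn : 2 ≤ n) (hm : 1 ≤ m) :
    variance (testStat n p m) (sampleLaw n a S) =
      ((∑ x, ∑ x', bandCov m a S x x' ^ 2) / m) / ((n : ℝ) * ((n : ℝ) - 1) * (p : ℝ) ^ 2) +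
        (2 * (∑ x, ∑ x', bandMean m a S x * bandMean m a S x' * bandCov m a S x x') / m) /
          ((n : ℝ) * (p : ℝ) ^ 2) := by
  have h1 : testStat n p m = fun y => 1 / ((n : ℝ) * ((n : ℝ) - 1) * (p : ℝ)) *
      (1 / √(2 * (m : ℝ))) * pairSum (bandFeature p m) y := funext fun y => testStat_eq_pairSum m y
  rw [h1, variance_const_mul, (integral_pairSum_bandFeature m a hS n).2]
  have hn0 : (n : ℝ) ≠ 0 := by positivity
  have hn1 : (n : ℝ) - 1 ≠ 0 := by
    have : (2 : ℝ) ≤ n := by exact_mod_cast hn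
    linarith
  have hm0 : (m : ℝ) ≠ 0 := by positivity
  rw [mul_pow, div_pow, div_pow, Real.sq_sqrt (by positivity)]
  rcases eq_or_ne (p : ℝ) 0 with h0 | h0
  · simp [h0]
  · field_simp
    ring

end TestStat

/-! ### The number of band pairs. -/

lemma two_mul_sum_range_min {q p : ℕ} (hqp : q ≤ p) :
    2 * (∑ j ∈ Finset.range p, (min j q : ℕ) : ℝ) = q * (2 * p - q - 1) := by
  induction p, hqp using Nat.le_induction with
  | base =>
    have h1 : ∑ j ∈ Finset.range q, ((min j q : ℕ) : ℝ) = ∑ j ∈ Finset.range q, (j : ℝ) :=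
      Finset.sum_congr rfl fun j hj => by rw [min_eq_left (Finset.mem_range.1 hj).le]
    have h2 := Finset.sum_range_id_mul_two q
    rcases q with _ | q
    · simp
    · rw [h1]
      rw [Nat.add_sub_cancel] at h2
      have h3 : (∑ j ∈ Finset.range (q + 1), (j : ℝ)) * 2 = (q + 1) * q := by
        rw [← Nat.cast_sum]
        exact_mod_cast h2
      push_cast
      linarith
  | succ p hqp ih =>
    rw [Finset.sum_range_succ, min_eq_right hqp, mul_add, ih]
    push_cast
    ring

lemma card_bandPairs_eq_sum (p m : ℕ) :
    (bandPairs p m).card = ∑ j ∈ Finset.range p, min j (m - 1) := by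
  rw [Finset.card_eq_sum_card_fiberwise (f := Prod.snd) (t := Finset.univ) fun x _ => by simp,
    ← Fin.sum_univ_eq_sum_range]
  refine Finset.sum_congr rfl fun j _ => ?_
  -- The first indices paired with j are the m - 1 integers below j, cut off at 0 by truncated
  -- subtraction; hence min j (m - 1) of them.
  have h1 : ((bandPairs p m).filter fun x => x.2 = j).image (fun x => (x.1 : ℕ)) =
      Finset.Ico (j - (m - 1) : ℕ) j := by
    ext t
    simp only [Finset.mem_image, Finset.mem_filter, mem_bandPairs, Finset.mem_Ico]
    constructor
    · rintro ⟨x, ⟨⟨h1, h2⟩, h3⟩, rfl⟩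
      subst h3
      omega
    · rintro ⟨h1, h2⟩
      have ht : t < p := h2.trans j.2
      refine ⟨(⟨t, ht⟩, j), ⟨⟨Fin.lt_def.2 h2, ?_⟩, rfl⟩, rfl⟩
      simp only
      omega
  rw [← Finset.card_image_of_injOn (f := fun x : Fin p × Fin p => (x.1 : ℕ)), h1, Nat.card_Ico]
  · omega
  · intro x hx y hy hxy
    rw [Finset.mem_coe, Finset.mem_filter] at hx hy
    exact Prod.ext (Fin.ext hxy) (hx.2.trans hy.2.symm)

lemma card_bandPairs {p m : ℕ} (hm : 1 ≤ m) (hmp : m ≤ p) :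
    ((bandPairs p m).card : ℝ) = (m - 1) * (p - m / 2) := by
  have h := two_mul_sum_range_min (q := m - 1) (p := p) (by omega)
  rw [card_bandPairs_eq_sum]
  push_cast [Nat.cast_sub hm] at h ⊢
  linarith

/-! ### The null hypothesis: exact mean and variance -/

lemma integral_testStat_one (p m : ℕ) (a : unitInterval) {n : ℕ} (hn : 2 ≤ n) :
    ∫ y, testStat n p m y ∂(sampleLaw n a (1 : Matrix (Fin p) (Fin p) ℝ)) = 0 := by
  rw [integral_testStat m a Matrix.PosSemidef.one hn]
  refine mul_eq_zero_of_right _ (Finset.sum_eq_zero fun x hx => ?_)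
  rw [Matrix.one_apply_ne (mem_bandPairs.1 hx).1.ne, zero_pow two_ne_zero]

lemma bandMean_one {p : ℕ} (m : ℕ) (a : unitInterval) (x : bandPairs p m) :
    bandMean m a (1 : Matrix (Fin p) (Fin p) ℝ) x = 0 := by
  rw [bandMean, Matrix.one_apply_ne (mem_bandPairs.1 x.2).1.ne, mul_zero]

lemma bandCov_one {p : ℕ} (m : ℕ) (a : unitInterval) (x x' : bandPairs p m) :
    bandCov m a (1 : Matrix (Fin p) (Fin p) ℝ) x x' = if x = x' then (a : ℝ) ^ 2 else 0 := by
  rw [← integral_bandFeature_mul_one a x x',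
    ← integral_bandFeature_sub_mul_sub m a Matrix.PosSemidef.one]
  simp only [bandMean_one, sub_zero]

lemma variance_testStat_one {n p m : ℕ} (a : unitInterval) (hn : 2 ≤ n) (hm : 1 ≤ m)
    (hmp : m ≤ p) :
    variance (testStat n p m) (sampleLaw n a (1 : Matrix (Fin p) (Fin p) ℝ)) =
      (a : ℝ) ^ 4 / ((n : ℝ) * ((n : ℝ) - 1) * (p : ℝ)) *
        ((1 - 1 / (m : ℝ)) * (1 - (m : ℝ) / (2 * (p : ℝ)))) := by
  rw [variance_testStat m a Matrix.PosSemidef.one hn hm]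
  simp only [bandMean_one, bandCov_one, zero_mul, Finset.sum_const_zero, mul_zero, zero_div,
    add_zero, ite_pow, ne_eq, OfNat.ofNat_ne_zero, not_false_eq_true, zero_pow,
    Finset.sum_ite_eq, Finset.mem_univ, if_true, Finset.sum_const, Finset.card_univ,
    Fintype.card_coe, nsmul_eq_mul, card_bandPairs hm hmp]
  have hn1 : (n : ℝ) - 1 ≠ 0 := by
    have : (2 : ℝ) ≤ n := by exact_mod_cast hn
    linarith
  have hp : (p : ℝ) ≠ 0 := by
    have : 1 ≤ p := hm.trans hmp
    positivity
  have hm0 : (m : ℝ) ≠ 0 := by positivity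
  field_simp

lemma abs_variance_testStat_one_sub_le {n p m : ℕ} (a : unitInterval) (hn : 2 ≤ n) (hm : 1 ≤ m)
    (hmp : m ≤ p) :
    |variance (testStat n p m) (sampleLaw n a (1 : Matrix (Fin p) (Fin p) ℝ)) -
        (a : ℝ) ^ 4 / ((n : ℝ) * ((n : ℝ) - 1) * (p : ℝ))| ≤
      (1 / (m : ℝ) + m / p) * ((a : ℝ) ^ 4 / ((n : ℝ) * ((n : ℝ) - 1) * (p : ℝ))) := by
  rw [variance_testStat_one a hn hm hmp, ← mul_sub_one, mul_comm, abs_mul]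
  have hn1 : (0 : ℝ) ≤ (n : ℝ) - 1 := by
    have : (2 : ℝ) ≤ n := by exact_mod_cast hn
    linarith
  rw [abs_of_nonneg (a := (a : ℝ) ^ 4 / _) (by positivity)]
  refine mul_le_mul_of_nonneg_right ?_ (by positivity)
  have h1 : (1 : ℝ) / m ≤ 1 := by
    rw [div_le_one (by positivity)]
    exact_mod_cast hm
  have h2 : (m : ℝ) / (2 * p) = m / p / 2 := by rw [mul_comm, div_mul_eq_div_div]
  have h3 : (m : ℝ) / p ≤ 1 := div_le_one_of_le₀ (by exact_mod_cast hmp) (by positivity)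
  have h4 : (0 : ℝ) ≤ 1 / m := by positivity
  have h5 : (0 : ℝ) ≤ m / p := by positivity
  rw [h2, abs_le]
  constructor <;> nlinarith

lemma exists_variance_testStat_one_close {η : ℝ} (hη : 0 < η) :
    ∃ M : ℕ, ∃ δ : ℝ, 0 < δ ∧
      ∀ (n p m : ℕ) (a : unitInterval), 2 ≤ n → 1 ≤ p → M ≤ m → (m : ℝ) ≤ δ * (p : ℝ) →
        0 < (a : ℝ) → (a : ℝ) < 1 →
        |variance (testStat n p m) (sampleLaw n a (1 : Matrix (Fin p) (Fin p) ℝ)) -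
            (a : ℝ) ^ 4 / ((n : ℝ) * ((n : ℝ) - 1) * (p : ℝ))| ≤
          η * ((a : ℝ) ^ 4 / ((n : ℝ) * ((n : ℝ) - 1) * (p : ℝ))) := by
  obtain ⟨M, hM⟩ := exists_nat_gt (2 / η)
  -- 1/m and m/p each receive η/2; the + 1 and the minimum with 1 secure 1 ≤ m ≤ p, where the exact
  -- variance formula holds.
  refine ⟨M + 1, min 1 (η / 2), by positivity, fun n p m a hn hp hMm hmp _ _ => ?_⟩
  have hp0 : (0 : ℝ) < p := by exact_mod_cast hp
  have hm : 1 ≤ m := by omega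
  have hmp1 : (m : ℝ) ≤ p := hmp.trans (by
    calc _ ≤ 1 * (p : ℝ) := mul_le_mul_of_nonneg_right (min_le_left _ _) hp0.le
      _ = p := one_mul _)
  have hmp2 : (m : ℝ) / p ≤ η / 2 := by
    rw [div_le_iff₀ hp0]
    exact hmp.trans (mul_le_mul_of_nonneg_right (min_le_right _ _) hp0.le)
  have hm2 : (1 : ℝ) / m ≤ η / 2 := by
    have h1 : (M : ℝ) < m := by exact_mod_cast hMm
    have h2 : 2 / η ≤ m := (hM.trans h1).le
    rw [div_le_iff₀ (by positivity)] at h2 ⊢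
    linarith
  refine (abs_variance_testStat_one_sub_le a hn hm (by exact_mod_cast hmp1)).trans ?_
  have hn1 : (0 : ℝ) ≤ (n : ℝ) - 1 := by
    have : (2 : ℝ) ≤ n := by exact_mod_cast hn
    linarith
  exact mul_le_mul_of_nonneg_right (by linarith) (by positivity)

/-! ### The null hypothesis: asymptotic normality -/

/-- Rewrites the error in the dimensionless r = c²b²Dn², which stays bounded, and ratios that tend
to 0. -/
lemma charFun_error_eq {n b D c V K : ℝ} (hn : 0 < n) (hb : 0 < b) (hD : 0 < D) :
    n * (4 * √(4 * c ^ 2 * (n * (b * (b * D))) *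
        (16 * c ^ 4 * (3 * n ^ 2 * b ^ 2 * (V + b ^ 2 * D ^ 2) + n * K))) +
      2 * c ^ 2 * b * √(4 * n ^ 2 * b ^ 2 * D + 2 * n * V) +
      (2 * c ^ 2 * b ^ 2 * D * n) ^ 2 / 2) =
    4 * √(64 * (c ^ 2 * b ^ 2 * D * n ^ 2) ^ 3 *
        (3 * (V / (n * b ^ 2 * D ^ 2)) + 3 / n + K / (n ^ 2 * b ^ 4 * D ^ 2))) +
      2 * √((c ^ 2 * b ^ 2 * D * n ^ 2) ^ 2 * (4 / D + 2 * (V / (n * b ^ 2 * D ^ 2)))) +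
      2 * (c ^ 2 * b ^ 2 * D * n ^ 2) ^ 2 / n := by
  have hs : ∀ {u x y : ℝ}, 0 ≤ u → u ^ 2 * x = y → u * √x = √y := fun {u x y} hu h => by
    rw [← h, Real.sqrt_mul (sq_nonneg u), Real.sqrt_sq hu]
  rw [mul_add, mul_add]
  congr 1
  · congr 1
    · rw [mul_left_comm]
      congr 1
      refine hs hn.le ?_
      field_simp
      ring
    · rw [show n * (2 * c ^ 2 * b * √(4 * n ^ 2 * b ^ 2 * D + 2 * n * V)) =
        2 * ((n * c ^ 2 * b) * √(4 * n ^ 2 * b ^ 2 * D + 2 * n * V)) by ring]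
      congr 1
      refine hs (by positivity) ?_
      field_simp
  · field_simp

lemma charFun_error_le {r R X Y n d x y : ℝ} (hr : 0 ≤ r) (hrR : r ≤ R) (hn : 0 < n)
    (hX : X ≤ x) (hY : Y ≤ y) (hd0 : 0 ≤ d) (hx : 0 ≤ x) (hy : 0 ≤ y) {e : ℝ} (hed : e ≤ d) :
    4 * √(64 * r ^ 3 * (3 * X + 3 / n + Y)) + 2 * √(r ^ 2 * (4 * e + 2 * X)) + 2 * r ^ 2 / n ≤
      4 * √(64 * R ^ 3 * (3 * x + 3 / n + y)) + 2 * √(R ^ 2 * (4 * d + 2 * x)) + 2 * R ^ 2 / n := by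
  have hR : 0 ≤ R := hr.trans hrR
  have h1 : 64 * r ^ 3 * (3 * X + 3 / n + Y) ≤ 64 * R ^ 3 * (3 * x + 3 / n + y) :=
    calc _ ≤ 64 * r ^ 3 * (3 * x + 3 / n + y) := by gcongr
      _ ≤ _ := by gcongr
  have h2 : r ^ 2 * (4 * e + 2 * X) ≤ R ^ 2 * (4 * d + 2 * x) :=
    calc _ ≤ r ^ 2 * (4 * d + 2 * x) := by gcongr
      _ ≤ _ := by gcongr
  gcongr

lemma le_card_bandPairs {p m : ℕ} (hm : 2 ≤ m) (hmp : m ≤ p) :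
    (p * m / 4 : ℝ) ≤ (bandPairs p m).card ∧ ((bandPairs p m).card : ℝ) ≤ p * m := by
  rw [card_bandPairs (by omega) hmp]
  have h1 : (2 : ℝ) ≤ m := by exact_mod_cast hm
  have h2 : (m : ℝ) ≤ p := by exact_mod_cast hmp
  constructor <;> nlinarith

/-- Here b = a² and q = √p. The argument gives order 1/(bnp), weakened to 1/(bnq) so that only a²n√p
enters; 84 = 4(9 + 12). -/
lemma norm_dev_ratio_le {V a b n p m D q : ℝ} (hb0 : 0 < b) (ha : a ≤ 1) (hn : 0 < n)
    (hm : 1 ≤ m) (hq : 0 < q) (hqp : q ≤ p) (hD : p * m / 4 ≤ D)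
    (hV : V ≤ (9 * b + 12 * (a * b) * m) * D) : V / (n * b ^ 2 * D ^ 2) ≤ 84 / (b * n * q) := by
  have hm0 : 0 < m := by linarith
  have hp0 : 0 < p := by linarith
  have hD0 : 0 < D := lt_of_lt_of_le (by positivity) hD
  have h1 : V ≤ 21 * b * m * D := by
    refine hV.trans (mul_le_mul_of_nonneg_right ?_ hD0.le)
    have h2 : b * 1 ≤ b * m := mul_le_mul_of_nonneg_left hm hb0.le
    have h3 : a * b * m ≤ 1 * b * m := by gcongr
    linarith
  have h4 : q * m ≤ 4 * D := by
    have : q * m ≤ p * m := mul_le_mul_of_nonneg_right hqp hm0.le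
    linarith
  rw [div_le_div_iff₀ (by positivity) (by positivity)]
  calc V * (b * n * q) ≤ 21 * b * m * D * (b * n * q) := by gcongr
    _ = 21 * (b ^ 2 * n * D) * (q * m) := by ring
    _ ≤ 21 * (b ^ 2 * n * D) * (4 * D) := by gcongr
    _ = _ := by ring

/-- This ratio is where the condition a²n√p → ∞ comes from: the touching and diagonal pairs
contribute order 1/(b²n²p). The constant is 468 = 4(81 + 36). -/
lemma fourth_moment_ratio_le {K b n p m D q : ℝ} (hb0 : 0 < b) (hb : b ≤ 1) (hn : 0 < n)
    (hm : 1 ≤ m) (hq : 0 < q) (hqp : q ^ 2 = p) (hD : p * m / 4 ≤ D)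
    (hK : K ≤ 81 * ((81 * b ^ 2 + 36 * b ^ 3 * m) * D + b ^ 4 * D ^ 2)) :
    K / (n ^ 2 * b ^ 4 * D ^ 2) ≤ 81 * (468 / (b * n * q) ^ 2 + 1 / n ^ 2) := by
  have hm0 : 0 < m := by linarith
  have hp0 : 0 < p := by rw [← hqp]; positivity
  have hD0 : 0 < D := lt_of_lt_of_le (by positivity) hD
  have h1 : (81 * b ^ 2 + 36 * b ^ 3 * m) * D ≤ 117 * b ^ 2 * m * D := by
    refine mul_le_mul_of_nonneg_right ?_ hD0.le
    have h2 : b ^ 2 * 1 ≤ b ^ 2 * m := mul_le_mul_of_nonneg_left hm (by positivity)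
    have h3 : b ^ 2 * b * m ≤ b ^ 2 * 1 * m := by gcongr
    linarith
  have h5 : 117 * b ^ 2 * m * D ≤ 468 / (b * n * q) ^ 2 * (n ^ 2 * b ^ 4 * D ^ 2) := by
    rw [mul_pow, hqp, div_mul_eq_mul_div, le_div_iff₀ (by positivity)]
    calc 117 * b ^ 2 * m * D * ((b * n) ^ 2 * p) = 468 * (b ^ 4 * n ^ 2 * D) * (p * m / 4) := by
          ring
      _ ≤ 468 * (b ^ 4 * n ^ 2 * D) * D := by gcongr
      _ = _ := by ring
  rw [div_le_iff₀ (by positivity)]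
  have h6 : 1 / n ^ 2 * (n ^ 2 * b ^ 4 * D ^ 2) = b ^ 4 * D ^ 2 := by field_simp
  have h7 : 81 * (468 / (b * n * q) ^ 2 + 1 / n ^ 2) * (n ^ 2 * b ^ 4 * D ^ 2) =
      81 * (468 / (b * n * q) ^ 2 * (n ^ 2 * b ^ 4 * D ^ 2) +
        1 / n ^ 2 * (n ^ 2 * b ^ 4 * D ^ 2)) := by ring
  rw [h7, h6]
  linarith

-- The limit theorem specialised to band features, with an error depending only on s, n, m and
-- a²n√p.
set_option maxHeartbeats 800000 in
lemma exp_error_bound {p m n : ℕ} {a : unitInterval} (ha : 0 < (a : ℝ)) (hn : 2 ≤ n) (hm : 2 ≤ m)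
    (hmp : m ≤ p) (s : ℝ) :
    ‖(∫ y, Complex.exp ((s * ((n : ℝ) * √(p : ℝ) / (a : ℝ) ^ 2 * testStat n p m y) : ℝ) *
          Complex.I) ∂(sampleLaw n a (1 : Matrix (Fin p) (Fin p) ℝ))) -
        Real.exp (-(s ^ 2 / 2 * (n / (n - 1)) * ((1 - 1 / m) * (1 - m / p / 2))))‖ ≤
      4 * √(64 * (2 * s ^ 2) ^ 3 * (3 * (84 / ((a : ℝ) ^ 2 * n * √p)) + 3 / n +
          81 * (468 / ((a : ℝ) ^ 2 * n * √p) ^ 2 + 1 / n ^ 2))) +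
        2 * √((2 * s ^ 2) ^ 2 * (4 * (4 / m) + 2 * (84 / ((a : ℝ) ^ 2 * n * √p)))) +
        2 * (2 * s ^ 2) ^ 2 / n := by
  have hn2 : (2 : ℝ) ≤ n := by exact_mod_cast hn
  have hn1 : (0 : ℝ) < (n : ℝ) - 1 := by linarith
  have hn0 : (0 : ℝ) < n := by linarith
  have hm2 : (2 : ℝ) ≤ m := by exact_mod_cast hm
  have hm0 : (0 : ℝ) < m := by linarith
  have hmpR : (m : ℝ) ≤ p := by exact_mod_cast hmp
  have hp1 : (1 : ℝ) ≤ p := by linarith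
  have hp0 : (0 : ℝ) < p := by linarith
  have ha1 : (a : ℝ) ≤ 1 := a.2.2
  have hsp : 0 < √(p : ℝ) := Real.sqrt_pos.2 hp0
  have hsp2 : √(p : ℝ) ^ 2 = p := Real.sq_sqrt hp0.le
  have hspp : √(p : ℝ) ≤ p := by
    rw [Real.sqrt_le_left (by positivity)]
    nlinarith
  set D : ℝ := (Fintype.card (bandPairs p m) : ℝ) with hD
  have hDc : D = ((bandPairs p m).card : ℝ) := by rw [hD, Fintype.card_coe]
  obtain ⟨hD1, hD2⟩ := le_card_bandPairs hm hmp
  rw [← hDc] at hD1 hD2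
  have hDe : D = (m - 1) * (p - m / 2) := by rw [hDc, card_bandPairs (by omega) hmp]
  have hD0 : 0 < D := lt_of_lt_of_le (by positivity) hD1
  set b : ℝ := (a : ℝ) ^ 2 with hb
  have hb0 : 0 < b := by positivity
  -- Chosen so that c times the pair sum equals s times the normalised statistic.
  set c : ℝ := s / ((n - 1) * b * √(2 * p * m)) with hc
  have hc2 : c ^ 2 * b ^ 2 = s ^ 2 / ((n - 1) ^ 2 * (2 * p * m)) := by
    rw [hc, div_pow, mul_pow, mul_pow, Real.sq_sqrt (by positivity)]
    field_simp
  set W : ℝ := b * n * √p with hW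
  have hW0 : 0 < W := by positivity
  have hstat : ∀ y : Fin n → Fin p → ℝ, s * ((n : ℝ) * √(p : ℝ) / b * testStat n p m y) =
      c * pairSum (bandFeature p m) y := fun y => by
    rw [testStat_eq_pairSum, hc, show (2 * p * m : ℝ) = p * (2 * m) by ring, Real.sqrt_mul hp0.le]
    field_simp
    rw [hsp2]
  simp only [hstat]
  have hexp : -(s ^ 2 / 2 * (n / (n - 1)) * ((1 - 1 / m) * (1 - m / p / 2))) =
      -(c ^ 2 * b ^ 2 * D * (n * (n - 1)) : ℝ) := by
    rw [hc2, hDe]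
    field_simp
  rw [hexp]
  have key := norm_charFun_pairSum_sub_le (μ := missingLaw a (1 : Matrix (Fin p) (Fin p) ℝ))
    (h := bandFeature p m) (b := b) (hasMoments_bandFeature a 1) (integral_bandFeature_one a)
    hb0.le (integral_bandFeature_mul_one a) c n
  refine key.trans ?_
  rw [charFun_error_eq hn0 hb0 hD0]
  have hV := integral_bandFeature_norm_dev_le (p := p) (m := m) a
  have hK := integral_integral_bandFeature_pow_four_le (p := p) (m := m) a
  rw [← hD, ← hb] at hV
  rw [← hD] at hK
  generalize (∫ z, (bandFeature p m z ⬝ᵥ bandFeature p m z - b * D) ^ 2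
    ∂(missingLaw a (1 : Matrix (Fin p) (Fin p) ℝ))) = V at hV ⊢
  generalize (∫ z, ∫ y, (bandFeature p m y ⬝ᵥ bandFeature p m z) ^ 4
    ∂(missingLaw a (1 : Matrix (Fin p) (Fin p) ℝ))
    ∂(missingLaw a (1 : Matrix (Fin p) (Fin p) ℝ))) = K at hK ⊢
  -- Uses D ≤ pm and, for n ≥ 2, n ≤ 2(n-1).
  have hr : c ^ 2 * b ^ 2 * D * n ^ 2 ≤ 2 * s ^ 2 := by
    rw [hc2, div_mul_eq_mul_div, div_mul_eq_mul_div, div_le_iff₀ (by positivity)]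
    have h1 : (n : ℝ) ^ 2 ≤ 4 * (n - 1) ^ 2 := by nlinarith
    calc s ^ 2 * D * n ^ 2 ≤ s ^ 2 * (p * m) * (4 * (n - 1) ^ 2) := by gcongr
      _ = _ := by ring
  have hX : V / (n * b ^ 2 * D ^ 2) ≤ 84 / W := by
    refine norm_dev_ratio_le hb0 ha1 hn0 (by linarith) hsp hspp hD1 (hV.trans_eq ?_)
    rw [hb]
    ring
  have hY : K / (n ^ 2 * b ^ 4 * D ^ 2) ≤ 81 * (468 / W ^ 2 + 1 / n ^ 2) := by
    refine fourth_moment_ratio_le hb0 (pow_le_one₀ ha.le ha1) hn0 (by linarith) hsp hsp2 hD1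
      (hK.trans_eq ?_)
    rw [hb]
    ring
  have hd : 1 / D ≤ 4 / m := by
    rw [div_le_div_iff₀ hD0 hm0]
    have := mul_le_mul_of_nonneg_right hp1 hm0.le
    linarith
  rw [← mul_one_div 4 D]
  exact charFun_error_le (by positivity) hr hn0 hX hY (by positivity) (by positivity)
    (by positivity) hd

lemma tendsto_exp_error {n p m : ℕ → ℕ} {a : ℕ → unitInterval}
    (hn : Tendsto n atTop atTop) (hm : Tendsto m atTop atTop)
    (hW : Tendsto (fun t => (a t : ℝ) ^ 2 * (n t : ℝ) * √(p t : ℝ)) atTop atTop) (s : ℝ) :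
    Tendsto (fun t => 4 * √(64 * (2 * s ^ 2) ^ 3 *
        (3 * (84 / ((a t : ℝ) ^ 2 * n t * √(p t))) + 3 / (n t : ℝ) +
          81 * (468 / ((a t : ℝ) ^ 2 * n t * √(p t)) ^ 2 + 1 / (n t : ℝ) ^ 2))) +
        2 * √((2 * s ^ 2) ^ 2 * (4 * (4 / (m t : ℝ)) +
          2 * (84 / ((a t : ℝ) ^ 2 * n t * √(p t))))) +
        2 * (2 * s ^ 2) ^ 2 / (n t : ℝ)) atTop (𝓝 0) := by
  have hn' : Tendsto (fun t => (n t : ℝ)) atTop atTop := tendsto_natCast_atTop_atTop.comp hn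
  have hm' : Tendsto (fun t => (m t : ℝ)) atTop atTop := tendsto_natCast_atTop_atTop.comp hm
  have h1 : ∀ k : ℝ, Tendsto (fun t => k / ((a t : ℝ) ^ 2 * n t * √(p t))) atTop (𝓝 0) :=
    fun k => hW.const_div_atTop k
  have h2 : ∀ k : ℝ, Tendsto (fun t => k / ((a t : ℝ) ^ 2 * n t * √(p t)) ^ 2) atTop (𝓝 0) :=
    fun k => ((tendsto_pow_atTop two_ne_zero).comp hW).const_div_atTop k
  have h3 : ∀ k : ℝ, Tendsto (fun t => k / (n t : ℝ)) atTop (𝓝 0) :=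
    fun k => hn'.const_div_atTop k
  have h4 : ∀ k : ℝ, Tendsto (fun t => k / (n t : ℝ) ^ 2) atTop (𝓝 0) :=
    fun k => ((tendsto_pow_atTop two_ne_zero).comp hn').const_div_atTop k
  have h5 : ∀ k : ℝ, Tendsto (fun t => k / (m t : ℝ)) atTop (𝓝 0) :=
    fun k => hm'.const_div_atTop k
  have h6 := ((((((h1 84).const_mul 3).add (h3 3)).add
    (((h2 468).add (h4 1)).const_mul 81)).const_mul (64 * (2 * s ^ 2) ^ 3)).sqrt).const_mul 4
  have h7 := ((((h5 4).const_mul 4).add ((h1 84).const_mul 2)).const_mul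
    ((2 * s ^ 2) ^ 2)).sqrt.const_mul 2
  have h8 := (h6.add h7).add (h3 (2 * (2 * s ^ 2) ^ 2))
  simpa using h8

lemma tendsto_exp_main {n p m : ℕ → ℕ} (hn : Tendsto n atTop atTop) (hm : Tendsto m atTop atTop)
    (hmp : Tendsto (fun t => (m t : ℝ) / (p t : ℝ)) atTop (𝓝 0)) (s : ℝ) :
    Tendsto (fun t => Real.exp (-(s ^ 2 / 2 * ((n t : ℝ) / ((n t : ℝ) - 1)) *
      ((1 - 1 / (m t : ℝ)) * (1 - (m t : ℝ) / (p t : ℝ) / 2))))) atTop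
        (𝓝 (Real.exp (-(s ^ 2 / 2)))) := by
  have hn' : Tendsto (fun t => (n t : ℝ)) atTop atTop := tendsto_natCast_atTop_atTop.comp hn
  have hm' : Tendsto (fun t => (m t : ℝ)) atTop atTop := tendsto_natCast_atTop_atTop.comp hm
  have h1 : Tendsto (fun t => (n t : ℝ) / ((n t : ℝ) - 1)) atTop (𝓝 1) := by
    have h2 : Tendsto (fun t => 1 + 1 / ((n t : ℝ) - 1)) atTop (𝓝 (1 + 0)) :=
      tendsto_const_nhds.add
        ((tendsto_atTop_add_const_right atTop (-1) hn').const_div_atTop 1)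
    rw [add_zero] at h2
    refine h2.congr' ?_
    filter_upwards [hn.eventually_ge_atTop 2] with t ht
    have : (2 : ℝ) ≤ n t := by exact_mod_cast ht
    have : (n t : ℝ) - 1 ≠ 0 := by linarith
    field_simp
    ring
  have h3 := ((h1.const_mul (s ^ 2 / 2)).mul (((hm'.const_div_atTop 1).const_sub 1).mul
    ((hmp.div_const 2).const_sub 1))).neg
  have h4 := (Real.continuous_exp.tendsto _).comp h3
  simpa [Function.comp_def] using h4

theorem tendstoInDistribution_testStat (n p m : ℕ → ℕ) (a : ℕ → unitInterval)
    (ha : ∀ t, 0 < (a t : ℝ)) (hn : Tendsto n atTop atTop) (hp : Tendsto p atTop atTop)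
    (hm : Tendsto m atTop atTop)
    (hmp : Tendsto (fun t => (m t : ℝ) / (p t : ℝ)) atTop (𝓝 0))
    (hW : Tendsto (fun t => (a t : ℝ) ^ 2 * (n t : ℝ) * √(p t : ℝ)) atTop atTop) :
    TendstoInDistribution
      (fun t (y : Fin (n t) → Fin (p t) → ℝ) =>
        (n t : ℝ) * √(p t : ℝ) / (a t : ℝ) ^ 2 * testStat (n t) (p t) (m t) y)
      atTop (id : ℝ → ℝ)
      (fun t => sampleLaw (n t) (a t) (1 : Matrix (Fin (p t)) (Fin (p t)) ℝ))
      (gaussianReal 0 1) := by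
  have hmeas : ∀ t, AEMeasurable (fun y : Fin (n t) → Fin (p t) → ℝ =>
      (n t : ℝ) * √(p t : ℝ) / (a t : ℝ) ^ 2 * testStat (n t) (p t) (m t) y)
      (sampleLaw (n t) (a t) (1 : Matrix (Fin (p t)) (Fin (p t)) ℝ)) := fun t =>
    ((hasMoments_testStat (m t) (a t) 1 (n t)).const_mul _).aestronglyMeasurable.aemeasurable
  refine ⟨hmeas, aemeasurable_id, ProbabilityMeasure.tendsto_of_tendsto_charFun fun s => ?_⟩
  have hlim : charFun ((gaussianReal 0 1).map id) s = ((Real.exp (-(s ^ 2 / 2)) : ℝ) : ℂ) := by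
    rw [Measure.map_id, charFun_gaussianReal]
    push_cast
    congr 1
    simp
  simp only [ProbabilityMeasure.coe_mk, hlim]
  have hmain := (Complex.continuous_ofReal.tendsto _).comp (tendsto_exp_main hn hm hmp s)
  -- Lévy's continuity theorem has reduced the claim to pointwise convergence; the characteristic
  -- function is split as an error tending to 0 plus the explicit Gaussian factor.
  refine (zero_add ((Real.exp (-(s ^ 2 / 2)) : ℝ) : ℂ)) ▸
    ((squeeze_zero_norm' ?_ (tendsto_exp_error hn hm hW s)).add hmain).congr fun t =>
      sub_add_cancel _ _
  have hmp1 : ∀ᶠ t in atTop, (m t : ℝ) / (p t : ℝ) < 1 := hmp.eventually_lt_const zero_lt_one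
  filter_upwards [hn.eventually_ge_atTop 2, hm.eventually_ge_atTop 2, hp.eventually_ge_atTop 1,
    hmp1] with t hn2 hm2 hp1 ht
  have hp0 : (0 : ℝ) < p t := by exact_mod_cast hp1
  rw [div_lt_one hp0] at ht
  refine le_trans (le_of_eq ?_) (exp_error_bound (ha t) hn2 hm2 (by exact_mod_cast ht.le) s)
  rw [charFun_apply_real, integral_map (hmeas t) (Measurable.aestronglyMeasurable (by fun_prop))]
  simp only [Function.comp_apply, Complex.ofReal_mul]

/-! ### Bounds on the variance under the alternative -/

/-- Nonnegativity of the principal 2 × 2 minor, 1 - σ² ≥ 0. -/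
lemma sq_apply_le_one {ι : Type*} [Fintype ι] [DecidableEq ι] {S : Matrix ι ι ℝ}
    (hS : S.PosSemidef) (hd : ∀ i, S i i = 1) (i j : ι) : S i j ^ 2 ≤ 1 := by
  have h1 := (hS.submatrix ![i, j]).det_nonneg
  rw [Matrix.det_fin_two] at h1
  simp only [Matrix.submatrix_apply, Matrix.cons_val_zero, Matrix.cons_val_one, hd] at h1
  have h2 : S j i = S i j := by simpa using hS.1.apply i j
  rw [h2] at h1
  linarith

lemma three_le_card_of_ne {p : ℕ} {i j k l : Fin p} (hij : i < j) (hkl : k < l)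
    (h : (i, j) ≠ (k, l)) : 3 ≤ ({i, j, k, l} : Finset (Fin p)).card := by
  by_cases hk : k = i ∨ k = j
  · have hl : l ≠ i ∧ l ≠ j := by
      rcases hk with rfl | rfl
      · exact ⟨hkl.ne', fun h' => h (by rw [h'])⟩
      · exact ⟨(hij.trans hkl).ne', hkl.ne'⟩
    have h3 : ({i, j, l} : Finset (Fin p)).card = 3 :=
      Finset.card_eq_three.2 ⟨i, j, l, hij.ne, hl.1.symm, hl.2.symm, rfl⟩
    rw [← h3]
    exact Finset.card_le_card fun t => by simp; tauto
  · push Not at hk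
    have h3 : ({i, j, k} : Finset (Fin p)).card = 3 :=
      Finset.card_eq_three.2 ⟨i, j, k, hij.ne, hk.1.symm, hk.2.symm, rfl⟩
    rw [← h3]
    exact Finset.card_le_card fun t => by simp; tauto

lemma card_of_not_touch {p : ℕ} {x x' : Fin p × Fin p} (hx : x.1 < x.2) (hx' : x'.1 < x'.2)
    (h : ¬ Touch x x') : ({x.1, x.2, x'.1, x'.2} : Finset (Fin p)).card = 4 := by
  unfold Touch at h
  push Not at h
  obtain ⟨h1, h2, h3, h4⟩ := h
  rw [Finset.card_insert_of_notMem, Finset.card_insert_of_notMem, Finset.card_pair hx'.ne]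
  · simp [h2.symm, h4.symm]
  · simp [hx.ne, h1.symm, h3.symm]

lemma Touch.symm {p : ℕ} {x x' : Fin p × Fin p} (h : Touch x x') : Touch x' x := by
  unfold Touch at *
  tauto

lemma touch_self {p : ℕ} (x : Fin p × Fin p) : Touch x x := Or.inl rfl

/-- The squared off-diagonal entries of a matrix. -/
def offSq {p : ℕ} (S : Matrix (Fin p) (Fin p) ℝ) (i j : Fin p) : ℝ := if i = j then 0 else S i j ^ 2

/-! ### Bounds for sums over the feature covariances. -/

section CovBounds

variable {p m : ℕ} (a : unitInterval) {S : Matrix (Fin p) (Fin p) ℝ}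

lemma offSq_nonneg (i j : Fin p) : 0 ≤ offSq S i j := by
  unfold offSq; split_ifs <;> positivity

/-- The squares of the crossed products in Wick's formula. -/
def crossSq (S : Matrix (Fin p) (Fin p) ℝ) (x x' : Fin p × Fin p) : ℝ :=
  S x.1 x'.1 ^ 2 * S x.2 x'.2 ^ 2 + S x.1 x'.2 ^ 2 * S x.2 x'.1 ^ 2

/-- For distinct ordered pairs no crossed product consists of two diagonal entries, so one
off-diagonal factor can be kept and the other factor bounded by 1. In the second product the order
of the indices excludes the diagonal case. -/
lemma crossSq_le (hS : S.PosSemidef) (hd : ∀ i, S i i = 1) {x x' : Fin p × Fin p}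
    (hx : x.1 < x.2) (hx' : x'.1 < x'.2) (h : x ≠ x') :
    crossSq S x x' ≤ (offSq S x.1 x'.1 + offSq S x.2 x'.2) +
      (offSq S x.1 x'.2 + offSq S x.2 x'.1) := by
  have key : ∀ i j k l : Fin p, ¬(i = k ∧ j = l) →
      S i k ^ 2 * S j l ^ 2 ≤ offSq S i k + offSq S j l := fun i j k l hne => by
    have h1 := sq_apply_le_one hS hd i k
    have h2 := sq_apply_le_one hS hd j l
    have h3 := sq_nonneg (S i k)
    have h4 := sq_nonneg (S j l)
    by_cases hik : i = k
    · have hjl : j ≠ l := fun hjl => hne ⟨hik, hjl⟩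
      rw [offSq, offSq, if_pos hik, if_neg hjl]
      nlinarith
    · have := offSq_nonneg (S := S) j l
      rw [offSq, if_neg hik]
      nlinarith
  refine add_le_add (key _ _ _ _ fun h' => h (Prod.ext h'.1 h'.2)) (key _ _ _ _ fun h' => ?_)
  have := h'.1 ▸ h'.2 ▸ hx
  exact absurd (this.trans hx') (lt_irrefl _)

lemma sum_comp_le_of_fiber_le {ι κ : Type*} [Fintype κ] [DecidableEq κ] (s : Finset ι) (f : ι → κ)
    (hf : ∀ k, (s.filter fun x => f x = k).card ≤ m) {φ : κ → ℝ} (hφ : ∀ k, 0 ≤ φ k) :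
    ∑ x ∈ s, φ (f x) ≤ m * ∑ k, φ k := by
  rw [← Finset.sum_fiberwise s f, Finset.mul_sum]
  refine Finset.sum_le_sum fun k _ => ?_
  rw [Finset.sum_congr rfl fun x hx => by rw [(Finset.mem_filter.1 hx).2], Finset.sum_const,
    nsmul_eq_mul]
  exact mul_le_mul_of_nonneg_right (by exact_mod_cast hf k) (hφ k)

/-- Each index is an endpoint of a given kind for at most m band pairs, so each of the two sums
costs a factor m. -/
lemma sum_sum_offSq_comp_le {f g : Fin p × Fin p → Fin p}
    (hf : ∀ k, ((bandPairs p m).filter fun x => f x = k).card ≤ m)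
    (hg : ∀ k, ((bandPairs p m).filter fun x => g x = k).card ≤ m) :
    ∑ x : bandPairs p m, ∑ x' : bandPairs p m, offSq S (f x) (g x') ≤
      m ^ 2 * ∑ i, ∑ j, offSq S i j := by
  rw [Finset.sum_coe_sort (bandPairs p m) fun x => ∑ x' : bandPairs p m, offSq S (f x) (g x')]
  calc ∑ x ∈ bandPairs p m, ∑ x' : bandPairs p m, offSq S (f x) (g x')
      ≤ ∑ x ∈ bandPairs p m, m * ∑ j, offSq S (f x) j := by
        refine Finset.sum_le_sum fun x _ => ?_
        rw [Finset.sum_coe_sort (bandPairs p m) fun x' => offSq S (f x) (g x')]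
        exact sum_comp_le_of_fiber_le _ g hg (φ := offSq S (f x)) fun j => offSq_nonneg _ _
    _ ≤ m * ∑ i, m * ∑ j, offSq S i j :=
        sum_comp_le_of_fiber_le _ f hf (φ := fun i => m * ∑ j, offSq S i j) fun i =>
          mul_nonneg (Nat.cast_nonneg m) (Finset.sum_nonneg fun j _ => offSq_nonneg _ _)
    _ = _ := by rw [← Finset.mul_sum]; ring

lemma sum_crossSq_le (hS : S.PosSemidef) (hd : ∀ i, S i i = 1) :
    ∑ x : bandPairs p m, ∑ x' : bandPairs p m, (if x = x' then 0 else crossSq S x x') ≤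
      4 * m ^ 2 * ∑ i, ∑ j, offSq S i j := by
  have h1 := sum_sum_offSq_comp_le (S := S) (card_bandPairs_fst_le p m) (card_bandPairs_fst_le p m)
  have h2 := sum_sum_offSq_comp_le (S := S) (card_bandPairs_snd_le p m) (card_bandPairs_snd_le p m)
  have h3 := sum_sum_offSq_comp_le (S := S) (card_bandPairs_fst_le p m) (card_bandPairs_snd_le p m)
  have h4 := sum_sum_offSq_comp_le (S := S) (card_bandPairs_snd_le p m) (card_bandPairs_fst_le p m)
  have h5 : ∑ x : bandPairs p m, ∑ x' : bandPairs p m, (if x = x' then 0 else crossSq S x x') ≤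
      ∑ x : bandPairs p m, ∑ x' : bandPairs p m, ((offSq S x.1.1 x'.1.1 + offSq S x.1.2 x'.1.2) +
      (offSq S x.1.1 x'.1.2 + offSq S x.1.2 x'.1.1)) := by
    refine Finset.sum_le_sum fun x _ => Finset.sum_le_sum fun x' _ => ?_
    split_ifs with h
    · exact add_nonneg (add_nonneg (offSq_nonneg _ _) (offSq_nonneg _ _))
        (add_nonneg (offSq_nonneg _ _) (offSq_nonneg _ _))
    · exact crossSq_le hS hd (mem_bandPairs.1 x.2).1 (mem_bandPairs.1 x'.2).1
        fun h' => h (Subtype.ext h')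
  simp only [Finset.sum_add_distrib] at h5
  linarith

lemma sum_touch_le {w : bandPairs p m → ℝ} (hw : ∀ x, 0 ≤ w x) :
    ∑ x : bandPairs p m, ∑ x' : bandPairs p m, (if Touch x.1 x'.1 then w x else 0) ≤
      4 * m * ∑ x, w x := by
  rw [Finset.mul_sum]
  refine Finset.sum_le_sum fun x _ => ?_
  have h1 : ∀ x' : bandPairs p m, (if Touch x.1 x'.1 then w x else 0) =
      w x * (if Touch x.1 x'.1 then (1 : ℝ) else 0) := fun x' => by split_ifs <;> simp
  simp only [h1]
  rw [← Finset.mul_sum, mul_comm]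
  exact mul_le_mul_of_nonneg_right (sum_indicator_touch_le x) (hw x)

lemma sum_touch_swap_le {w : bandPairs p m → ℝ} (hw : ∀ x, 0 ≤ w x) :
    ∑ x : bandPairs p m, ∑ x' : bandPairs p m, (if Touch x.1 x'.1 then w x' else 0) ≤
      4 * m * ∑ x, w x := by
  rw [Finset.sum_comm]
  refine le_trans (le_of_eq ?_) (sum_touch_le hw)
  refine Finset.sum_congr rfl fun x _ => Finset.sum_congr rfl fun x' _ => ?_
  exact if_congr ⟨Touch.symm, Touch.symm⟩ rfl rfl

lemma sq_bandCov_self_le (hS : S.PosSemidef) (hd : ∀ i, S i i = 1) (x : bandPairs p m) :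
    bandCov m a S x x ^ 2 ≤ (a : ℝ) ^ 4 * (1 + 8 * S x.1.1 x.1.2 ^ 2) := by
  have hx := (mem_bandPairs.1 x.2).1
  have hc : ({x.1.1, x.1.2, x.1.1, x.1.2} : Finset (Fin p)) = {x.1.1, x.1.2} := by
    ext t; simp
  have hsym : S x.1.2 x.1.1 = S x.1.1 x.1.2 := by simpa using hS.1.apply x.1.1 x.1.2
  have h1 := sq_apply_le_one hS hd x.1.1 x.1.2
  have h0 := sq_nonneg (S x.1.1 x.1.2)
  have ha := a.2.1
  have ha1 : (a : ℝ) ^ 2 ≤ 1 := pow_le_one₀ ha a.2.2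
  rw [bandCov, hc, Finset.card_pair hx.ne, bandMean, hd, hd, hsym]
  set u := S x.1.1 x.1.2
  set b := (a : ℝ) ^ 2
  have hb : 0 ≤ b := sq_nonneg _
  have h2 : 0 ≤ b * (u * u + 1 * 1 + u * u) - b * u * (b * u) := by nlinarith [mul_nonneg hb h0]
  have h3 : b * (u * u + 1 * 1 + u * u) - b * u * (b * u) ≤ b * (1 + 2 * u ^ 2) := by
    nlinarith [mul_nonneg hb h0, sq_nonneg (b * u)]
  calc _ ≤ (b * (1 + 2 * u ^ 2)) ^ 2 := pow_le_pow_left₀ h2 h3 2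
    _ = b ^ 2 * (1 + 4 * u ^ 2 + 4 * u ^ 2 * u ^ 2) := by ring
    _ ≤ b ^ 2 * (1 + 4 * u ^ 2 + 4 * u ^ 2 * 1) := by gcongr
    _ = (a : ℝ) ^ 4 * (1 + 8 * u ^ 2) := by simp only [b]; ring

/-- The product of the means cancels exactly the uncrossed Wick term when the four indices are
distinct. When the pairs touch, its coefficient a^card - a⁴ lies between 0 and a^c. -/
lemma abs_bandCov_le {x x' : bandPairs p m} {c : ℕ}
    (hc : c ≤ ({x.1.1, x.1.2, x'.1.1, x'.1.2} : Finset (Fin p)).card) :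
    |bandCov m a S x x'| ≤ (a : ℝ) ^ c * ((if Touch x.1 x'.1 then
      |S x.1.1 x.1.2 * S x'.1.1 x'.1.2| else 0) +
        (|S x.1.1 x'.1.1 * S x.1.2 x'.1.2| + |S x.1.1 x'.1.2 * S x.1.2 x'.1.1|)) := by
  have hx := (mem_bandPairs.1 x.2).1
  have hx' := (mem_bandPairs.1 x'.2).1
  have ha := a.2.1
  rw [bandCov, bandMean, bandMean]
  by_cases h : Touch x.1 x'.1
  · rw [if_pos h]
    have hc4 : ({x.1.1, x.1.2, x'.1.1, x'.1.2} : Finset (Fin p)).card ≤ 4 := Finset.card_le_four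
    have h1 : (a : ℝ) ^ ({x.1.1, x.1.2, x'.1.1, x'.1.2} : Finset (Fin p)).card ≤ (a : ℝ) ^ c :=
      pow_le_pow_of_le_one ha a.2.2 hc
    have h4 : (a : ℝ) ^ 4 ≤ (a : ℝ) ^ ({x.1.1, x.1.2, x'.1.1, x'.1.2} : Finset (Fin p)).card :=
      pow_le_pow_of_le_one ha a.2.2 hc4
    have h0 : 0 ≤ (a : ℝ) ^ 4 := by positivity
    set A := (a : ℝ) ^ ({x.1.1, x.1.2, x'.1.1, x'.1.2} : Finset (Fin p)).card
    set u := S x.1.1 x.1.2 * S x'.1.1 x'.1.2 with hu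
    set v := S x.1.1 x'.1.1 * S x.1.2 x'.1.2
    set w := S x.1.1 x'.1.2 * S x.1.2 x'.1.1
    have h5 : A * (u + v + w) - (a : ℝ) ^ 2 * S x.1.1 x.1.2 * ((a : ℝ) ^ 2 * S x'.1.1 x'.1.2) =
        (A - (a : ℝ) ^ 4) * u + A * (v + w) := by rw [hu]; ring
    rw [h5]
    calc _ ≤ |(A - (a : ℝ) ^ 4) * u| + |A * (v + w)| := abs_add_le _ _
      _ = (A - (a : ℝ) ^ 4) * |u| + A * |v + w| := by
          rw [abs_mul (A - _), abs_mul A, abs_of_nonneg (sub_nonneg.2 h4), abs_of_nonneg (h0.trans h4)]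
      _ ≤ (a : ℝ) ^ c * |u| + (a : ℝ) ^ c * (|v| + |w|) := by
          refine add_le_add (mul_le_mul_of_nonneg_right (by linarith) (abs_nonneg _)) ?_
          exact mul_le_mul h1 (abs_add_le _ _) (abs_nonneg _) (by positivity)
      _ = _ := by ring
  · rw [if_neg h, zero_add]
    rw [card_of_not_touch hx hx' h] at hc ⊢
    have h1 : (a : ℝ) ^ 4 ≤ (a : ℝ) ^ c := pow_le_pow_of_le_one ha a.2.2 hc
    set v := S x.1.1 x'.1.1 * S x.1.2 x'.1.2
    set w := S x.1.1 x'.1.2 * S x.1.2 x'.1.1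
    have h5 : (a : ℝ) ^ 4 * (S x.1.1 x.1.2 * S x'.1.1 x'.1.2 + v + w) -
        (a : ℝ) ^ 2 * S x.1.1 x.1.2 * ((a : ℝ) ^ 2 * S x'.1.1 x'.1.2) =
        (a : ℝ) ^ 4 * (v + w) := by ring
    rw [h5, abs_mul, abs_of_nonneg (by positivity)]
    exact mul_le_mul h1 (abs_add_le _ _) (abs_nonneg _) (by positivity)

lemma sq_bandCov_le (hS : S.PosSemidef) (hd : ∀ i, S i i = 1) {x x' : bandPairs p m}
    (h : x ≠ x') :
    bandCov m a S x x' ^ 2 ≤ 3 * (a : ℝ) ^ 6 *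
      ((if Touch x.1 x'.1 then S x.1.1 x.1.2 ^ 2 else 0) + crossSq S x.1 x'.1) := by
  have hx := (mem_bandPairs.1 x.2).1
  have hx' := (mem_bandPairs.1 x'.2).1
  have h1 := abs_bandCov_le a (S := S)
    (three_le_card_of_ne hx hx' fun h' => h (Subtype.ext h'))
  have h2 := sq_apply_le_one hS hd x'.1.1 x'.1.2
  rw [← sq_abs]
  refine (pow_le_pow_left₀ (abs_nonneg _) h1 2).trans ?_
  rw [mul_pow, ← pow_mul, mul_comm (3 : ℝ), mul_assoc]
  refine mul_le_mul_of_nonneg_left ?_ (by have := a.2.1; positivity)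
  have key : ∀ u v w : ℝ, (u + (v + w)) ^ 2 ≤ 3 * (u ^ 2 + (v ^ 2 + w ^ 2)) := fun u v w => by
    nlinarith [sq_nonneg (u - v), sq_nonneg (u - w), sq_nonneg (v - w)]
  refine (key _ _ _).trans ?_
  rw [sq_abs, sq_abs, mul_pow, mul_pow, ← crossSq]
  gcongr
  split_ifs
  · rw [sq_abs, mul_pow]
    exact mul_le_of_le_one_right (sq_nonneg _) h2
  · simp

lemma sum_sq_bandCov_le (hS : S.PosSemidef) (hd : ∀ i, S i i = 1) :
    ∑ x, ∑ x', bandCov m a S x x' ^ 2 ≤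
      (a : ℝ) ^ 4 * ((bandPairs p m).card + 8 * ∑ x ∈ bandPairs p m, S x.1 x.2 ^ 2) +
        3 * (a : ℝ) ^ 6 * (4 * m * ∑ x ∈ bandPairs p m, S x.1 x.2 ^ 2 +
          4 * m ^ 2 * ∑ i, ∑ j, offSq S i j) := by
  have ha := a.2.1
  have h1 : ∀ x x' : bandPairs p m, bandCov m a S x x' ^ 2 ≤
      (if x = x' then (a : ℝ) ^ 4 * (1 + 8 * S x.1.1 x.1.2 ^ 2) else 0) +
        3 * (a : ℝ) ^ 6 * ((if Touch x.1 x'.1 then S x.1.1 x.1.2 ^ 2 else 0) +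
          if x = x' then 0 else crossSq S x.1 x'.1) := fun x x' => by
    by_cases h : x = x'
    · subst h
      rw [if_pos rfl, if_pos rfl, if_pos (touch_self _)]
      exact (sq_bandCov_self_le a hS hd x).trans (le_add_of_nonneg_right (by positivity))
    · rw [if_neg h, if_neg h, zero_add]
      exact sq_bandCov_le a hS hd h
  refine (Finset.sum_le_sum fun x _ => Finset.sum_le_sum fun x' _ => h1 x x').trans ?_
  simp only [Finset.sum_add_distrib, ← Finset.mul_sum, Finset.sum_ite_eq, Finset.mem_univ, if_true]
  rw [Finset.sum_const, Finset.card_univ, Fintype.card_coe, nsmul_one,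
    Finset.sum_coe_sort (bandPairs p m) fun x => S x.1 x.2 ^ 2]
  have h2 := sum_touch_le (p := p) (m := m) (w := fun x => S x.1.1 x.1.2 ^ 2)
    fun x => sq_nonneg _
  rw [Finset.sum_coe_sort (bandPairs p m) fun x => S x.1 x.2 ^ 2] at h2
  have h3 := sum_crossSq_le (m := m) hS hd
  gcongr

/-- Touching pairs, diagonal included: all three Wick products are at most 1, giving 3a², and |σσ'|
≤ (σ² + σ'²)/2. Disjoint pairs: only crossed products remain, with a⁴ from the means and a⁴ from the
covariance. -/
lemma bandMean_mul_bandMean_mul_bandCov_le (hS : S.PosSemidef) (hd : ∀ i, S i i = 1)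
    (x x' : bandPairs p m) :
    bandMean m a S x * bandMean m a S x' * bandCov m a S x x' ≤
      3 * (a : ℝ) ^ 6 / 2 * ((if Touch x.1 x'.1 then S x.1.1 x.1.2 ^ 2 else 0) +
        (if Touch x.1 x'.1 then S x'.1.1 x'.1.2 ^ 2 else 0)) +
      (a : ℝ) ^ 8 * (|S x.1.1 x.1.2 * S x'.1.1 x'.1.2| * (if x = x' then 0 else
        (|S x.1.1 x'.1.1 * S x.1.2 x'.1.2| + |S x.1.1 x'.1.2 * S x.1.2 x'.1.1|))) := by
  have hx := (mem_bandPairs.1 x.2).1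
  have hx' := (mem_bandPairs.1 x'.2).1
  have ha := a.2.1
  have h0 : bandMean m a S x * bandMean m a S x' * bandCov m a S x x' ≤
      (a : ℝ) ^ 4 * |S x.1.1 x.1.2 * S x'.1.1 x'.1.2| * |bandCov m a S x x'| := by
    refine (le_abs_self _).trans (le_of_eq ?_)
    rw [abs_mul, bandMean, bandMean, mul_mul_mul_comm, abs_mul ((a : ℝ) ^ 2 * _), ← pow_add,
      abs_of_nonneg (a := (a : ℝ) ^ (2 + 2)) (by positivity)]
  refine h0.trans ?_
  by_cases h : Touch x.1 x'.1
  · have hle : ∀ i j k l : Fin p, |S i j * S k l| ≤ 1 := fun i j k l => by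
      have h1 := sq_apply_le_one hS hd i j
      have h2 := sq_apply_le_one hS hd k l
      rw [← sq_le_one_iff_abs_le_one, mul_pow]
      exact mul_le_one₀ h1 (sq_nonneg _) h2
    have hc : 2 ≤ ({x.1.1, x.1.2, x'.1.1, x'.1.2} : Finset (Fin p)).card := by
      rw [← Finset.card_pair hx.ne]
      exact Finset.card_le_card fun t => by simp; tauto
    have h1 := abs_bandCov_le a (S := S) hc
    rw [if_pos h] at h1
    rw [if_pos h, if_pos h]
    have h2 : |bandCov m a S x x'| ≤ (a : ℝ) ^ 2 * (1 + (1 + 1)) :=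
      h1.trans (mul_le_mul_of_nonneg_left (add_le_add (hle _ _ _ _)
        (add_le_add (hle _ _ _ _) (hle _ _ _ _))) (by positivity))
    have h3 : |S x.1.1 x.1.2 * S x'.1.1 x'.1.2| ≤
        (S x.1.1 x.1.2 ^ 2 + S x'.1.1 x'.1.2 ^ 2) / 2 := by
      rw [abs_mul, ← sq_abs (S x.1.1 x.1.2), ← sq_abs (S x'.1.1 x'.1.2)]
      nlinarith [sq_nonneg (|S x.1.1 x.1.2| - |S x'.1.1 x'.1.2|)]
    refine le_add_of_le_of_nonneg ?_ ?_
    · calc _ ≤ (a : ℝ) ^ 4 * ((S x.1.1 x.1.2 ^ 2 + S x'.1.1 x'.1.2 ^ 2) / 2) *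
            ((a : ℝ) ^ 2 * (1 + (1 + 1))) := by gcongr
        _ = _ := by ring
    · split_ifs <;> positivity
  · have hne : x ≠ x' := fun h' => h (h' ▸ touch_self _)
    have h1 := abs_bandCov_le a (S := S) (card_of_not_touch hx hx' h).ge
    rw [if_neg h, zero_add] at h1
    rw [if_neg h, if_neg h, if_neg hne]
    calc _ ≤ (a : ℝ) ^ 4 * |S x.1.1 x.1.2 * S x'.1.1 x'.1.2| * ((a : ℝ) ^ 4 *
          (|S x.1.1 x'.1.1 * S x.1.2 x'.1.2| + |S x.1.1 x'.1.2 * S x.1.2 x'.1.1|)) := by gcongr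
      _ = _ := by ring

/-- Cauchy–Schwarz over pairs of pairs: the first factor squares and sums to the square of the band
mass, the second is controlled by `sum_crossSq_le`. Setting the diagonal to 0 is essential, as its
crossed product would contain S i i * S j j = 1. -/
lemma sum_abs_mul_cross_le (hS : S.PosSemidef) (hd : ∀ i, S i i = 1) :
    ∑ x : bandPairs p m, ∑ x' : bandPairs p m,
      |S x.1.1 x.1.2 * S x'.1.1 x'.1.2| * (if x = x' then 0 else
        (|S x.1.1 x'.1.1 * S x.1.2 x'.1.2| + |S x.1.1 x'.1.2 * S x.1.2 x'.1.1|)) ≤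
      (∑ x ∈ bandPairs p m, S x.1 x.2 ^ 2) * √(8 * m ^ 2 * ∑ i, ∑ j, offSq S i j) := by
  set s := ∑ x ∈ bandPairs p m, S x.1 x.2 ^ 2 with hs
  have hs0 : 0 ≤ s := Finset.sum_nonneg fun x _ => sq_nonneg _
  rw [← Fintype.sum_prod_type' fun x x' : bandPairs p m =>
    |S x.1.1 x.1.2 * S x'.1.1 x'.1.2| * (if x = x' then 0 else
        (|S x.1.1 x'.1.1 * S x.1.2 x'.1.2| + |S x.1.1 x'.1.2 * S x.1.2 x'.1.1|))]
  refine (Real.sum_mul_le_sqrt_mul_sqrt _ _ _).trans ?_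
  have h1 : ∑ z : bandPairs p m × bandPairs p m,
      |S z.1.1.1 z.1.1.2 * S z.2.1.1 z.2.1.2| ^ 2 = s ^ 2 := by
    rw [Fintype.sum_prod_type, sq, hs, ← Finset.sum_coe_sort (bandPairs p m),
      Finset.sum_mul_sum]
    simp only [sq_abs, mul_pow]
  rw [h1, Real.sqrt_sq hs0]
  refine mul_le_mul_of_nonneg_left (Real.sqrt_le_sqrt ?_) hs0
  rw [Fintype.sum_prod_type]
  have h2 : ∀ x x' : bandPairs p m, (if x = x' then 0 else
        (|S x.1.1 x'.1.1 * S x.1.2 x'.1.2| + |S x.1.1 x'.1.2 * S x.1.2 x'.1.1|)) ^ 2 ≤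
      2 * (if x = x' then 0 else crossSq S x.1 x'.1) := fun x x' => by
    split_ifs
    · simp
    · refine (add_sq_le).trans (le_of_eq ?_)
      rw [sq_abs, sq_abs, mul_pow, mul_pow, crossSq]
  refine (Finset.sum_le_sum fun x _ => Finset.sum_le_sum fun x' _ => h2 x x').trans ?_
  simp only [← Finset.mul_sum]
  have h3 := sum_crossSq_le (m := m) hS hd
  linarith

lemma sum_bandMean_mul_bandMean_mul_bandCov_le (hS : S.PosSemidef) (hd : ∀ i, S i i = 1) :
    ∑ x, ∑ x', bandMean m a S x * bandMean m a S x' * bandCov m a S x x' ≤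
      12 * (a : ℝ) ^ 6 * m * ∑ x ∈ bandPairs p m, S x.1 x.2 ^ 2 +
        (a : ℝ) ^ 8 * ((∑ x ∈ bandPairs p m, S x.1 x.2 ^ 2) *
          √(8 * m ^ 2 * ∑ i, ∑ j, offSq S i j)) := by
  have ha := a.2.1
  refine (Finset.sum_le_sum fun x _ => Finset.sum_le_sum fun x' _ =>
    bandMean_mul_bandMean_mul_bandCov_le a hS hd x x').trans ?_
  simp only [Finset.sum_add_distrib, ← Finset.mul_sum]
  have h2 := sum_touch_le (p := p) (m := m) (w := fun x => S x.1.1 x.1.2 ^ 2)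
    fun x => sq_nonneg _
  have h3 := sum_touch_swap_le (p := p) (m := m) (w := fun x => S x.1.1 x.1.2 ^ 2)
    fun x => sq_nonneg _
  rw [Finset.sum_coe_sort (bandPairs p m) fun x => S x.1 x.2 ^ 2] at h2 h3
  refine add_le_add ?_ (mul_le_mul_of_nonneg_left (sum_abs_mul_cross_le hS hd) (by positivity))
  calc _ ≤ 3 * (a : ℝ) ^ 6 / 2 * (4 * m * ∑ x ∈ bandPairs p m, S x.1 x.2 ^ 2 +
        4 * m * ∑ x ∈ bandPairs p m, S x.1 x.2 ^ 2) :=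
        mul_le_mul_of_nonneg_left (add_le_add h2 h3) (by positivity)
    _ = _ := by ring

end CovBounds

/-! ### Consequences of the Sobolev condition. -/

section Sobolev

variable {p : ℕ} {α : ℝ} {S : Matrix (Fin p) (Fin p) ℝ}

lemma sum_sq_mul_rpow_le (hp : 1 ≤ p) (hS : S ∈ sobolevClass p α) :
    ∑ x ∈ (Finset.univ : Finset (Fin p × Fin p)).filter (fun x => x.1 < x.2),
      S x.1 x.2 ^ 2 * |(x.1 : ℝ) - (x.2 : ℝ)| ^ (2 * α) ≤ p := by
  have h := hS.2.2
  have hp0 : (0 : ℝ) < p := by exact_mod_cast hp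
  rw [one_div, ← div_eq_inv_mul, div_le_one hp0] at h
  refine le_trans (le_of_eq ?_) h
  rw [Finset.sum_filter, Fintype.sum_prod_type]
  exact Finset.sum_congr rfl fun i _ => (Finset.sum_filter _ _).symm

lemma card_bandPairs_le (p m : ℕ) : ((bandPairs p m).card : ℝ) ≤ p * m := by
  have := sum_comp_le_of_fiber_le (bandPairs p m) Prod.fst (card_bandPairs_fst_le p m)
    (φ := fun _ => 1) fun _ => zero_le_one
  simp only [Finset.sum_const, nsmul_eq_mul, mul_one, Finset.card_univ, Fintype.card_fin] at this
  linarith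

/-- Distinct indices are at distance at least 1, so the Sobolev weight is at least 1. -/
lemma sum_bandPairs_sq_le (m : ℕ) (hα : 0 ≤ α) (hp : 1 ≤ p) (hS : S ∈ sobolevClass p α) :
    ∑ x ∈ bandPairs p m, S x.1 x.2 ^ 2 ≤ p := by
  refine le_trans ?_ (sum_sq_mul_rpow_le hp hS)
  refine (Finset.sum_le_sum fun x hx => ?_).trans
    (Finset.sum_le_sum_of_subset_of_nonneg (fun x hx => ?_) fun x _ _ => by positivity)
  · have h1 : (1 : ℝ) ≤ |(x.1 : ℝ) - (x.2 : ℝ)| := by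
      have h2 : (x.1 : ℕ) + 1 ≤ x.2 := (mem_bandPairs.1 hx).1
      have h3 : (x.1 : ℝ) + 1 ≤ x.2 := by exact_mod_cast h2
      rw [abs_sub_comm]
      exact le_abs.2 (Or.inl (by linarith))
    exact le_mul_of_one_le_right (sq_nonneg _) (Real.one_le_rpow h1 (by linarith))
  · exact Finset.mem_filter.2 ⟨Finset.mem_univ _, (mem_bandPairs.1 hx).1⟩

/-- Outside the band the distance is at least m, so the Sobolev weight is at least m^(2α). The
factor 2 counts both orders of the indices. -/
lemma sum_offSq_le {m : ℕ} (hm : 1 ≤ m) (hα : 0 ≤ α) (hp : 1 ≤ p) (hS : S ∈ sobolevClass p α) :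
    ∑ i, ∑ j, offSq S i j ≤
      2 * (∑ x ∈ bandPairs p m, S x.1 x.2 ^ 2 + p * (m : ℝ) ^ (-(2 * α))) := by
  have hm0 : (0 : ℝ) < m := by exact_mod_cast hm
  have hsym : ∀ i j, S j i = S i j := fun i j => by
    simpa using hS.1.posSemidef.1.apply i j
  have h1 : ∑ i, ∑ j, offSq S i j = 2 * ∑ i, ∑ j, if i < j then S i j ^ 2 else 0 := by
    have h2 : ∀ i j, offSq S i j = (if i < j then S i j ^ 2 else 0) +
        (if j < i then S j i ^ 2 else 0) := fun i j => by
      rcases lt_trichotomy i j with h | h | h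
      · simp [offSq, h, h.ne, h.not_gt]
      · simp [offSq, h]
      · simp [offSq, h, h.ne', h.not_gt, hsym i j]
    simp only [h2, Finset.sum_add_distrib]
    rw [Finset.sum_comm (f := fun i j => if j < i then S j i ^ 2 else 0)]
    ring
  rw [h1]
  refine mul_le_mul_of_nonneg_left ?_ zero_le_two
  rw [← Fintype.sum_prod_type' fun i j => if i < j then S i j ^ 2 else 0, ← Finset.sum_filter]
  set F := (Finset.univ : Finset (Fin p × Fin p)).filter fun x => x.1 < x.2 with hF
  have hsub : bandPairs p m ⊆ F := fun x hx =>
    Finset.mem_filter.2 ⟨Finset.mem_univ _, (mem_bandPairs.1 hx).1⟩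
  rw [← Finset.sum_sdiff hsub, add_comm]
  refine add_le_add le_rfl ?_
  calc ∑ x ∈ F \ bandPairs p m, S x.1 x.2 ^ 2
      ≤ ∑ x ∈ F \ bandPairs p m, S x.1 x.2 ^ 2 * |(x.1 : ℝ) - (x.2 : ℝ)| ^ (2 * α) *
          (m : ℝ) ^ (-(2 * α)) := by
        refine Finset.sum_le_sum fun x hx => ?_
        obtain ⟨hx1, hx2⟩ := Finset.mem_sdiff.1 hx
        have hlt := (Finset.mem_filter.1 hx1).2
        have h2 : (x.1 : ℕ) + m ≤ x.2 := by
          by_contra hcon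
          exact hx2 (mem_bandPairs.2 ⟨hlt, by omega⟩)
        have h3 : (m : ℝ) ≤ |(x.1 : ℝ) - (x.2 : ℝ)| := by
          have h4 : (x.1 : ℝ) + m ≤ x.2 := by exact_mod_cast h2
          rw [abs_sub_comm]
          exact le_abs.2 (Or.inl (by linarith))
        rw [mul_assoc]
        refine le_mul_of_one_le_right (sq_nonneg _) ?_
        rw [Real.rpow_neg hm0.le, ← div_eq_mul_inv, one_le_div (by positivity)]
        exact Real.rpow_le_rpow hm0.le h3 (by linarith)
    _ = (∑ x ∈ F \ bandPairs p m, S x.1 x.2 ^ 2 * |(x.1 : ℝ) - (x.2 : ℝ)| ^ (2 * α)) *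
          (m : ℝ) ^ (-(2 * α)) := by rw [Finset.sum_mul]
    _ ≤ p * (m : ℝ) ^ (-(2 * α)) := by
        refine mul_le_mul_of_nonneg_right (le_trans ?_ (sum_sq_mul_rpow_le hp hS)) (by positivity)
        exact Finset.sum_le_sum_of_subset_of_nonneg Finset.sdiff_subset fun x _ _ => by positivity

end Sobolev

/-! ### Final estimates for T₁ and T₂ in terms of the mean. -/

lemma trace_bound_arith {A s p m R D ρ η : ℝ} (hA : 0 ≤ A) (hA1 : A ≤ 1) (hs : 0 ≤ s)
    (hsp : s ≤ p) (hm : 1 ≤ m) (hD : D ≤ p * m) (hR : R ≤ 2 * (s + p * (ρ ^ 2 / m)))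
    (hη : 8 / m + 24 * ρ ^ 2 ≤ η) :
    (A ^ 2 * (D + 8 * s) + 3 * A ^ 3 * (4 * m * s + 4 * m ^ 2 * R)) / m ≤
      p * A ^ 2 * (1 + η) + 36 * (A ^ 3 * m * s) := by
  have hm0 : 0 < m := by linarith
  have hp : 0 ≤ p := hs.trans hsp
  have h1 : (A ^ 2 * (D + 8 * s) + 3 * A ^ 3 * (4 * m * s + 4 * m ^ 2 * R)) / m ≤
      -- Here A = a², s is the band mass and ρ²/m stands for m^(-2α). In the diagonal term s ≤ p
      -- suffices, as division by m makes it o(p).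
      (A ^ 2 * (p * m + 8 * p) +
        3 * A ^ 3 * (4 * m * s + 4 * m ^ 2 * (2 * (s + p * (ρ ^ 2 / m))))) / m := by gcongr
  have h2 : (A ^ 2 * (p * m + 8 * p) +
        3 * A ^ 3 * (4 * m * s + 4 * m ^ 2 * (2 * (s + p * (ρ ^ 2 / m))))) / m =
      p * A ^ 2 * (1 + 8 / m) + A ^ 2 * A * (24 * ρ ^ 2 * p) + 12 * (A ^ 3 * 1 * s) +
        24 * (A ^ 3 * m * s) := by
    field_simp
    ring
  have h3 : A ^ 2 * A * (24 * ρ ^ 2 * p) ≤ A ^ 2 * 1 * (24 * ρ ^ 2 * p) := by gcongr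
  have h4 : 12 * (A ^ 3 * 1 * s) ≤ 12 * (A ^ 3 * m * s) := by gcongr
  have h5 : p * A ^ 2 * (8 / m + 24 * ρ ^ 2) ≤ p * A ^ 2 * η := by gcongr
  linarith

lemma sqrt_add_le_sqrt_add_sqrt {x y : ℝ} (hx : 0 ≤ x) (hy : 0 ≤ y) : √(x + y) ≤ √x + √y := by
  rw [Real.sqrt_le_left (by positivity), add_sq, Real.sq_sqrt hx, Real.sq_sqrt hy]
  have : 0 ≤ √x * √y := by positivity
  linarith

/-- Subadditivity of the square root separates the band mass, which yields the E^(3/2) term, from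
the Sobolev tail, which yields the o(a⁴) term. -/
lemma quadratic_bound_arith {A s p m R ρ : ℝ} (hs : 0 ≤ s) (hp : 0 ≤ p)
    (hm : 1 ≤ m) (hρ : 0 ≤ ρ) (hR : R ≤ 2 * (s + p * (ρ ^ 2 / m))) :
    2 * (12 * A ^ 3 * m * s + A ^ 4 * (s * √(8 * m ^ 2 * R))) / m ≤
      24 * (A ^ 3 * s) + 8 * (A ^ 4 * (s * √s)) + 8 * (A ^ 4 * (s * (√p * (ρ / √m)))) := by
  have hm0 : 0 < m := by linarith
  have h1 : √(8 * m ^ 2 * R) ≤ 4 * m * (√s + √p * (ρ / √m)) := by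
    calc √(8 * m ^ 2 * R) ≤ √(8 * m ^ 2 * (2 * (s + p * (ρ ^ 2 / m)))) := by gcongr
      _ = √((4 * m) ^ 2 * (s + p * (ρ ^ 2 / m))) := by ring_nf
      _ = 4 * m * √(s + p * (ρ ^ 2 / m)) := by
          rw [Real.sqrt_mul (sq_nonneg _), Real.sqrt_sq (by positivity)]
      _ ≤ 4 * m * (√s + √(p * (ρ ^ 2 / m))) := by
          gcongr
          exact sqrt_add_le_sqrt_add_sqrt hs (by positivity)
      _ = _ := by rw [Real.sqrt_mul hp, Real.sqrt_div (sq_nonneg ρ), Real.sqrt_sq hρ]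
  calc _ ≤ 2 * (12 * A ^ 3 * m * s + A ^ 4 * (s * (4 * m * (√s + √p * (ρ / √m))))) / m := by
        gcongr
    _ = _ := by
        field_simp
        ring

section Final

variable {p m : ℕ} {α : ℝ} {S : Matrix (Fin p) (Fin p) ℝ} (a : unitInterval)

lemma rpow_three_halves {x : ℝ} (hx : 0 ≤ x) : x ^ (3 / 2 : ℝ) = x * √x := by
  rw [show (3 / 2 : ℝ) = 1 + 1 / 2 by norm_num, Real.rpow_add_of_nonneg hx (by norm_num)
    (by norm_num), Real.rpow_one, ← Real.sqrt_eq_rpow]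

lemma rpow_three_fourths {x : ℝ} (hx : 0 ≤ x) : x ^ (3 / 4 : ℝ) = √x * √√x := by
  rw [Real.sqrt_eq_rpow x, Real.sqrt_eq_rpow, ← Real.rpow_mul hx,
    ← Real.rpow_add_of_nonneg hx (by norm_num) (by norm_num)]
  norm_num

/-- Solving pE = A²s/√(2m) for s turns each bound in s into one in E. The powers of 2 are absorbed
in the generous 100, and 12 exceeds 8√2. -/
lemma mean_arith {A s p m E : ℝ} (hA : 0 ≤ A) (hs : 0 ≤ s) (hp : 0 < p) (hm : 1 ≤ m)
    (hE : E = A ^ 2 / (p * √(2 * m)) * s) :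
    36 * (A ^ 3 * m * s) ≤ p * E * (100 * (A * m * √m)) ∧
    24 * (A ^ 3 * s) ≤ p * E * (100 * (A * √m)) ∧
    8 * (A ^ 4 * (s * √s)) ≤ p ^ (3 / 2 : ℝ) * (E ^ (3 / 2 : ℝ) * (100 * (A * m ^ (3 / 4 : ℝ)))) ∧
    ∀ ρ η, 0 ≤ ρ → 12 * ρ ≤ η → 8 * (A ^ 4 * (s * (√p * (ρ / √m)))) ≤
      p ^ (3 / 2 : ℝ) * (E * (η * A ^ 2)) := by
  have hm0 : 0 < m := by linarith
  have h2 : √2 ≤ 3 / 2 := by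
    rw [Real.sqrt_le_left (by norm_num)]
    norm_num
  have h20 : 0 < √2 := Real.sqrt_pos.2 two_pos
  have hsm : 0 < √m := Real.sqrt_pos.2 hm0
  have hsp : 0 < √p := Real.sqrt_pos.2 hp
  have hpE : p * E = A ^ 2 * s / (√2 * √m) := by
    rw [hE, Real.sqrt_mul zero_le_two]
    field_simp
  have hE0 : 0 ≤ E := by rw [hE]; positivity
  refine ⟨?_, ?_, ?_, fun ρ η hρ h => ?_⟩
  · rw [hpE, show A ^ 2 * s / (√2 * √m) * (100 * (A * m * √m)) =
      A ^ 3 * m * s * (100 / √2) by field_simp, mul_comm]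
    refine mul_le_mul_of_nonneg_left ?_ (by positivity)
    rw [le_div_iff₀ h20]
    linarith
  · rw [hpE, show A ^ 2 * s / (√2 * √m) * (100 * (A * √m)) =
      A ^ 3 * s * (100 / √2) by field_simp, mul_comm]
    refine mul_le_mul_of_nonneg_left ?_ (by positivity)
    rw [le_div_iff₀ h20]
    linarith
  · rw [← mul_assoc (p ^ (3 / 2 : ℝ)), ← Real.mul_rpow hp.le hE0, rpow_three_halves (by positivity),
      hpE, rpow_three_fourths hm0.le, Real.sqrt_div (by positivity), Real.sqrt_mul (by positivity),
      Real.sqrt_sq hA, Real.sqrt_mul h20.le]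
    have h3 : √√2 ≤ 3 / 2 := by
      rw [Real.sqrt_le_left (by norm_num)]
      linarith
    have h30 : 0 < √√2 := Real.sqrt_pos.2 h20
    have h40 : 0 < √√m := Real.sqrt_pos.2 hsm
    rw [show A ^ 2 * s / (√2 * √m) * (A * √s / (√√2 * √√m)) * (100 * (A * (√m * √√m))) =
      A ^ 4 * (s * √s) * (100 / (√2 * √√2)) by field_simp, mul_comm]
    refine mul_le_mul_of_nonneg_left ?_ (by positivity)
    rw [le_div_iff₀ (by positivity)]
    nlinarith
  · rw [rpow_three_halves hp.le, show p * √p * (E * (η * A ^ 2)) =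
      p * E * √p * (η * A ^ 2) by ring, hpE, show A ^ 2 * s / (√2 * √m) * √p * (η * A ^ 2) =
      A ^ 4 * s * √p / √m * (η / √2) by field_simp,
      show 8 * (A ^ 4 * (s * (√p * (ρ / √m)))) = A ^ 4 * s * √p / √m * (8 * ρ) by ring]
    refine mul_le_mul_of_nonneg_left ?_ (by positivity)
    rw [le_div_iff₀ h20]
    nlinarith

lemma exists_forall_rpow_small {α η : ℝ} (hα : 1 / 2 < α) (hη : 0 < η) :
    ∃ M : ℕ, ∀ m : ℕ, M ≤ m → 12 * (m : ℝ) ^ (-(α - 1 / 2)) ≤ η ∧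
      8 / (m : ℝ) + 24 * ((m : ℝ) ^ (-(α - 1 / 2))) ^ 2 ≤ η := by
  have h1 : Tendsto (fun m : ℕ => (m : ℝ) ^ (-(α - 1 / 2))) atTop (𝓝 0) :=
    (tendsto_rpow_neg_atTop (by linarith)).comp tendsto_natCast_atTop_atTop
  have h2 : Tendsto (fun m : ℕ => 12 * (m : ℝ) ^ (-(α - 1 / 2))) atTop (𝓝 0) := by
    simpa using h1.const_mul 12
  have h3 : Tendsto (fun m : ℕ => 8 / (m : ℝ) + 24 * ((m : ℝ) ^ (-(α - 1 / 2))) ^ 2) atTop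
      (𝓝 0) := by
    simpa using (tendsto_const_div_atTop_nhds_zero_nat 8).add ((h1.pow 2).const_mul 24)
  exact eventually_atTop.1 ((h2.eventually_le_const hη).and (h3.eventually_le_const hη))

/-- Writes the Sobolev tail as ρ²/m with ρ = m^(-(α - 1/2)); α > 1/2 is what sends ρ to 0. -/
lemma rpow_neg_two_mul {α x : ℝ} (hx : 0 < x) :
    x ^ (-(2 * α)) = (x ^ (-(α - 1 / 2))) ^ 2 / x := by
  rw [← Real.rpow_natCast, ← Real.rpow_mul hx.le, eq_div_iff hx.ne', ← Real.rpow_add_one hx.ne']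
  congr 1
  push_cast
  ring

lemma sum_sq_bandCov_div_le {E η : ℝ} (hm : 1 ≤ m) (hp : 1 ≤ p) (hα : 1 / 2 < α)
    (hη : 8 / (m : ℝ) + 24 * ((m : ℝ) ^ (-(α - 1 / 2))) ^ 2 ≤ η) (hS : S ∈ sobolevClass p α)
    (hE : E = (a : ℝ) ^ 4 / ((p : ℝ) * √(2 * (m : ℝ))) * ∑ x ∈ bandPairs p m, S x.1 x.2 ^ 2) :
    (∑ x, ∑ x', bandCov m a S x x' ^ 2) / m ≤ (p : ℝ) * (a : ℝ) ^ 4 * (1 + η) +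
      (p : ℝ) * E * (100 * ((a : ℝ) ^ 2 * (m : ℝ) * √(m : ℝ))) := by
  have hm1 : (1 : ℝ) ≤ m := by exact_mod_cast hm
  have hp0 : (0 : ℝ) < p := by exact_mod_cast hp
  have ha := a.2.1
  have hs0 : 0 ≤ ∑ x ∈ bandPairs p m, S x.1 x.2 ^ 2 := Finset.sum_nonneg fun x _ => sq_nonneg _
  have hR := sum_offSq_le hm (by linarith) hp hS
  rw [rpow_neg_two_mul (by linarith)] at hR
  have h1 := sum_sq_bandCov_le (m := m) a hS.1.posSemidef hS.2.1
  have h2 := trace_bound_arith (A := (a : ℝ) ^ 2) (by positivity) (pow_le_one₀ ha a.2.2) hs0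
    (sum_bandPairs_sq_le m (by linarith) hp hS) hm1 (card_bandPairs_le p m) hR hη
  have hE' : E = ((a : ℝ) ^ 2) ^ 2 / (p * √(2 * m)) * ∑ x ∈ bandPairs p m, S x.1 x.2 ^ 2 := by
    rw [hE, ← pow_mul]
  have h3 := (mean_arith (A := (a : ℝ) ^ 2) (by positivity) hs0 hp0 hm1 hE').1
  simp only [← pow_mul, Nat.reduceMul] at h2 h3
  exact (div_le_div_of_nonneg_right h1 (by linarith)).trans (h2.trans (add_le_add le_rfl h3))

lemma sum_bandMean_bandCov_div_le {E η : ℝ} (hm : 1 ≤ m) (hp : 1 ≤ p) (hα : 1 / 2 < α)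
    (hη : 12 * (m : ℝ) ^ (-(α - 1 / 2)) ≤ η) (hS : S ∈ sobolevClass p α)
    (hE : E = (a : ℝ) ^ 4 / ((p : ℝ) * √(2 * (m : ℝ))) * ∑ x ∈ bandPairs p m, S x.1 x.2 ^ 2) :
    2 * (∑ x, ∑ x', bandMean m a S x * bandMean m a S x' * bandCov m a S x x') / m ≤
      (p : ℝ) * E * (100 * ((a : ℝ) ^ 2 * √(m : ℝ))) + (p : ℝ) ^ (3 / 2 : ℝ) *
        (E ^ (3 / 2 : ℝ) * (100 * ((a : ℝ) ^ 2 * (m : ℝ) ^ (3 / 4 : ℝ))) +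
          E * (η * (a : ℝ) ^ 4)) := by
  have hm1 : (1 : ℝ) ≤ m := by exact_mod_cast hm
  have hp0 : (0 : ℝ) < p := by exact_mod_cast hp
  have ha := a.2.1
  have hs0 : 0 ≤ ∑ x ∈ bandPairs p m, S x.1 x.2 ^ 2 := Finset.sum_nonneg fun x _ => sq_nonneg _
  have hR := sum_offSq_le hm (by linarith) hp hS
  rw [rpow_neg_two_mul (by linarith)] at hR
  have h1 := sum_bandMean_mul_bandMean_mul_bandCov_le (m := m) a hS.1.posSemidef hS.2.1
  have hρ : 0 ≤ (m : ℝ) ^ (-(α - 1 / 2)) := by positivity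
  have h2 := quadratic_bound_arith (A := (a : ℝ) ^ 2) hs0 hp0.le hm1 hρ hR
  have hE' : E = ((a : ℝ) ^ 2) ^ 2 / (p * √(2 * m)) * ∑ x ∈ bandPairs p m, S x.1 x.2 ^ 2 := by
    rw [hE, ← pow_mul]
  obtain ⟨-, h3, h4, h5⟩ := mean_arith (A := (a : ℝ) ^ 2) (by positivity) hs0 hp0 hm1 hE'
  have h6 := h5 _ η hρ hη
  simp only [← pow_mul, Nat.reduceMul] at h2 h3 h4 h6
  rw [mul_add, ← add_assoc]
  exact (div_le_div_of_nonneg_right (mul_le_mul_of_nonneg_left h1 zero_le_two)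
    (by linarith)).trans (h2.trans (add_le_add (add_le_add h3 h4) h6))

end Final

theorem mainTheorem5 :
    -- Null hypothesis: the statistic is centred, with its exact variance.
    (∀ (n p m : ℕ) (a : unitInterval), 2 ≤ n → 1 ≤ m → m ≤ p → 0 < (a : ℝ) → (a : ℝ) < 1 →
      MemLp (testStat n p m) 2 (sampleLaw n a (1 : Matrix (Fin p) (Fin p) ℝ)) ∧
      ∫ y, testStat n p m y ∂(sampleLaw n a (1 : Matrix (Fin p) (Fin p) ℝ)) = 0 ∧
      variance (testStat n p m) (sampleLaw n a (1 : Matrix (Fin p) (Fin p) ℝ)) =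
        (a : ℝ) ^ 4 / ((n : ℝ) * ((n : ℝ) - 1) * (p : ℝ)) *
          ((1 - 1 / (m : ℝ)) * (1 - (m : ℝ) / (2 * (p : ℝ))))) ∧
    -- Null hypothesis: the variance is `(1 + o(1)) a⁴ / (n (n - 1) p)`, uniformly in `n` and `a`,
    -- as `m → ∞` and `m / p → 0`.
    (∀ η : ℝ, 0 < η → ∃ M : ℕ, ∃ δ : ℝ, 0 < δ ∧
      ∀ (n p m : ℕ) (a : unitInterval), 2 ≤ n → 1 ≤ p → M ≤ m → (m : ℝ) ≤ δ * (p : ℝ) →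
        0 < (a : ℝ) → (a : ℝ) < 1 →
        |variance (testStat n p m) (sampleLaw n a (1 : Matrix (Fin p) (Fin p) ℝ)) -
            (a : ℝ) ^ 4 / ((n : ℝ) * ((n : ℝ) - 1) * (p : ℝ))| ≤
          η * ((a : ℝ) ^ 4 / ((n : ℝ) * ((n : ℝ) - 1) * (p : ℝ)))) ∧
    -- Null hypothesis: asymptotic normality.
    (∀ (n p m : ℕ → ℕ) (a : ℕ → unitInterval),
      (∀ t, 0 < (a t : ℝ)) → (∀ t, (a t : ℝ) < 1) →
      Tendsto n atTop atTop → Tendsto p atTop atTop → Tendsto m atTop atTop →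
      Tendsto (fun t => (m t : ℝ) / (p t : ℝ)) atTop (𝓝 0) →
      Tendsto (fun t => (a t : ℝ) ^ 2 * (n t : ℝ) * √(p t : ℝ)) atTop atTop →
      TendstoInDistribution
        (fun t (y : Fin (n t) → Fin (p t) → ℝ) =>
          (n t : ℝ) * √(p t : ℝ) / (a t : ℝ) ^ 2 * testStat (n t) (p t) (m t) y)
        atTop (id : ℝ → ℝ)
        (fun t => sampleLaw (n t) (a t) (1 : Matrix (Fin (p t)) (Fin (p t)) ℝ))
        (gaussianReal 0 1)) ∧
    -- Alternative: `T₁` and `T₂` do not depend on the sample size `n`.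
    (∃ T₁ T₂ : (p : ℕ) → (m : ℕ) → unitInterval → Matrix (Fin p) (Fin p) ℝ → ℝ,
      ∀ α : ℝ, 1 / 2 < α →
        -- the mean and the decomposition of the variance
        (∀ (n p m : ℕ) (a : unitInterval) (S : Matrix (Fin p) (Fin p) ℝ),
          2 ≤ n → 1 ≤ p → 1 ≤ m → 0 < (a : ℝ) → (a : ℝ) < 1 → S ∈ sobolevClass p α →
          MemLp (testStat n p m) 2 (sampleLaw n a S) ∧
          ∫ y, testStat n p m y ∂(sampleLaw n a S) =
            (a : ℝ) ^ 4 / ((p : ℝ) * √(2 * (m : ℝ))) * ∑ x ∈ bandPairs p m, S x.1 x.2 ^ 2 ∧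
          variance (testStat n p m) (sampleLaw n a S) =
            T₁ p m a S / ((n : ℝ) * ((n : ℝ) - 1) * (p : ℝ) ^ 2) +
              T₂ p m a S / ((n : ℝ) * (p : ℝ) ^ 2)) ∧
        -- the bounds: `C` is the constant in every `O`, and `η` bounds every `o(1)`
        (∃ C : ℝ, 0 < C ∧ ∀ η : ℝ, 0 < η → ∃ M : ℕ, ∃ δ : ℝ, 0 < δ ∧
          ∀ (n p m : ℕ) (a : unitInterval) (S : Matrix (Fin p) (Fin p) ℝ) (E : ℝ),
            2 ≤ n → 1 ≤ p → 1 ≤ m → M ≤ m → (m : ℝ) ≤ δ * (p : ℝ) →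
            0 < (a : ℝ) → (a : ℝ) < 1 → S ∈ sobolevClass p α →
            E = ∫ y, testStat n p m y ∂(sampleLaw n a S) →
            T₁ p m a S ≤ (p : ℝ) * (a : ℝ) ^ 4 * (1 + η) +
                (p : ℝ) * E * (C * ((a : ℝ) ^ 2 * (m : ℝ) * √(m : ℝ))) ∧
            T₂ p m a S ≤ (p : ℝ) * E * (C * ((a : ℝ) ^ 2 * √(m : ℝ))) +
                (p : ℝ) ^ (3 / 2 : ℝ) *
                  (E ^ (3 / 2 : ℝ) * (C * ((a : ℝ) ^ 2 * (m : ℝ) ^ (3 / 4 : ℝ))) +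
                    E * (η * (a : ℝ) ^ 4)))) := by
  refine ⟨fun n p m a hn hm hmp _ _ => ⟨(hasMoments_testStat m a 1 n).memLp_two,
    integral_testStat_one p m a hn, variance_testStat_one a hn hm hmp⟩,
    fun η hη => exists_variance_testStat_one_close hη,
    fun n p m a ha _ hn hp hm hmp hW => tendstoInDistribution_testStat n p m a ha hn hp hm hmp hW,
    fun p m a S => (∑ x, ∑ x', bandCov m a S x x' ^ 2) / m,
    fun p m a S => 2 * (∑ x, ∑ x', bandMean m a S x * bandMean m a S x' * bandCov m a S x x') / m,
    fun α hα => ⟨fun n p m a S hn hp hm _ _ hS => ⟨(hasMoments_testStat m a S n).memLp_two,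
      integral_testStat m a hS.1.posSemidef hn, variance_testStat m a hS.1.posSemidef hn hm⟩,
    100, by norm_num, fun η hη => ?_⟩⟩
  obtain ⟨M, hM⟩ := exists_forall_rpow_small hα hη
  refine ⟨M, 1, one_pos, fun n p m a S E hn hp hm hMm _ _ _ hS hE => ?_⟩
  rw [integral_testStat m a hS.1.posSemidef hn] at hE
  exact ⟨sum_sq_bandCov_div_le a hm hp hα (hM m hMm).2 hS hE,
    sum_bandMean_bandCov_div_le a hm hp hα (hM m hMm).1 hS hE⟩
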